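/- A set $S$ of positive integers is called multiplicative if $1\in S$ and, for all coprime $m,n$, one has $mn\in S$ if and only if $m\in S$ and $n\in S$. Let $\chi_S$ be its characteristic function, $S(x)$ the number of $n\le x$ in $S$, $\pi_S(x)$ the number of primes $p\le x$ in $S$, $\mathrm{Li}(x)=\int_2^x\frac{dt}{\log t}$, and $L_S(s)=\sum_{n\in S}n^{-s}$ for $\mathrm{Re}(s)>1$. Let $S$ be multiplicative and satisfy Condition B: there are fixed numbers $\delta>0$ and $\rho>0$ such that $$\pi_S(x)=\delta\,\mathrm{Li}(x)+O\Big(\frac{x}{\log^{2+\rho}x}\Big)\qquad(x\to\infty).$$ Then the limits $$C_0=\frac1{\Gamma(\delta)}\lim_{P\to\infty}\prod_{p<P}\Big(1+\frac{\chi_S(p)}{p}+\frac{\chi_S(p^2)}{p^2}+\cdots\Big)\Big(1-\frac1p\Big)^{\delta},\qquad \gamma_S=\lim_{s\to1+0}\Big(\frac{L_S'(s)}{L_S(s)}+\frac{\delta}{s-1}\Big)$$ ($p$ running over primes, $s$ over reals) exist, and the following holds. (i) If $\gamma_S<1/2$, then for all sufficiently large real $x$ $$\Big|S(x)-C_0\int_2^x\log^{\delta-1}t\,dt\Big|<\big|S(x)-C_0\,x\log^{\delta-1}x\big|,$$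 that is, the Ramanujan approximation is better than the Landau approximation. (ii) If $\gamma_S>1/2$ and $\delta\neq1$, then for all sufficiently large real $x$ $$\big|S(x)-C_0\,x\log^{\delta-1}x\big|<\Big|S(x)-C_0\int_2^x\log^{\delta-1}t\,dt\Big|,$$ that is, the Landau approximation is better than the Ramanujan approximation. -/

import Mathlib

namespace MultiplicativeSets

/-- A set `S` of positive integers is multiplicative if it contains `1` and if, for coprime
`m` and `n`, the product `m * n` lies in `S` exactly when both `m` and `n` do. -/
structure IsMultiplicativeSet (S : Set ℕ) : Prop where
  zero_notMem : 0 ∉ S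
  one_mem : 1 ∈ S
  mul_mem_iff : ∀ m n : ℕ, m.Coprime n → (m * n ∈ S ↔ m ∈ S ∧ n ∈ S)

/-- The counting function `S(x)`: the number of `n ≤ x` in `S`. -/
noncomputable def count (S : Set ℕ) (x : ℝ) : ℝ :=
  ({n : ℕ | n ∈ S ∧ (n : ℝ) ≤ x}.ncard : ℝ)

/-- The prime counting function `π_S(x)`: the number of primes `p ≤ x` in `S`. -/
noncomputable def primeCount (S : Set ℕ) (x : ℝ) : ℝ :=
  ({p : ℕ | p.Prime ∧ p ∈ S ∧ (p : ℝ) ≤ x}.ncard : ℝ)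

/-- The logarithmic integral `Li(x) = ∫_2^x dt / log t`. -/
noncomputable def Li (x : ℝ) : ℝ := ∫ t in (2 : ℝ)..x, 1 / Real.log t

/-- Condition B with the constant `δ`: `δ > 0` and, for some fixed `ρ > 0`,
`π_S(x) = δ Li(x) + O(x / log^{2+ρ} x)` as `x → ∞`. -/
def ConditionB (S : Set ℕ) (δ : ℝ) : Prop :=
  0 < δ ∧ ∃ ρ : ℝ, 0 < ρ ∧
    Asymptotics.IsBigO Filter.atTop (fun x : ℝ => primeCount S x - δ * Li x)
      (fun x : ℝ => x / Real.log x ^ (2 + ρ))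

/-- `C` is the constant `C_0(S)`, that is, the limit as `P → ∞` of
`Γ(δ)⁻¹ ∏_{p < P} (1 + χ_S(p)/p + χ_S(p²)/p² + ⋯) (1 - 1/p)^δ`, where `χ_S` is the
characteristic function of `S`. -/
def IsLandauConstant (S : Set ℕ) (δ C : ℝ) : Prop :=
  Filter.Tendsto
    (fun P : ℕ => 1 / Real.Gamma δ * ∏ p ∈ Nat.primesBelow P,
      ((1 + ∑' k : ℕ, S.indicator (1 : ℕ → ℝ) (p ^ (k + 1)) / (p : ℝ) ^ (k + 1)) *
        (1 - 1 / (p : ℝ)) ^ δ))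
    Filter.atTop (nhds C)

/-- The Dirichlet series `L_S(s) = ∑_{n ∈ S} n^{-s}`. -/
noncomputable def dirichletSeries (S : Set ℕ) : ℂ → ℂ :=
  LSeries (S.indicator (1 : ℕ → ℂ))

/-- `γ` is the Euler-Kronecker constant `γ_S`, that is, the limit of
`L_S'(s)/L_S(s) + δ/(s-1)` as the real variable `s` tends to `1` from the right. -/
def IsEulerKroneckerConstant (S : Set ℕ) (δ γ : ℝ) : Prop :=
  Filter.Tendsto
    (fun s : ℝ => deriv (dirichletSeries S) (s : ℂ) / dirichletSeries S (s : ℂ)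
      + (δ : ℂ) / ((s : ℂ) - 1))
    (nhdsWithin 1 (Set.Ioi 1)) (nhds (γ : ℂ))

/-- The Landau approximation `C_0 x log^{δ-1} x`. -/
noncomputable def landauApprox (δ C x : ℝ) : ℝ := C * (x * Real.log x ^ (δ - 1))

/-- The Ramanujan approximation `C_0 ∫_2^x log^{δ-1} t dt`. -/
noncomputable def ramanujanApprox (δ C x : ℝ) : ℝ :=
  C * ∫ t in (2 : ℝ)..x, Real.log t ^ (δ - 1)

/-- The Landau approximation is strictly closer to `S(x)` for all sufficiently large `x`. -/
def LandauBetter (S : Set ℕ) (δ C : ℝ) : Prop :=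
  ∀ᶠ x : ℝ in Filter.atTop,
    |count S x - landauApprox δ C x| < |count S x - ramanujanApprox δ C x|

/-- The Ramanujan approximation is strictly closer to `S(x)` for all sufficiently large `x`. -/
def RamanujanBetter (S : Set ℕ) (δ C : ℝ) : Prop :=
  ∀ᶠ x : ℝ in Filter.atTop,
    |count S x - ramanujanApprox δ C x| < |count S x - landauApprox δ C x|

end MultiplicativeSets

/-!
Both claims follow from a second-order expansion of `S(x)`. With `u = log x`,

`S(x) = C x u^{δ-1} (1 + (1 - δ)(1 - γ)/u + o(1/u))`,

where `C` is the Landau constant and `γ` the Euler-Kronecker constant (`exists_secondOrder`), while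
`∫_2^x log^{δ-1} t dt = x u^{δ-1} (1 + (1 - δ)/u + o(1/u))` (`tendsto_mul_integral_sub_one`). On the
scale `x u^{δ-2}` the errors of the Landau and the Ramanujan approximation thus tend to
`C (1 - δ)(1 - γ)` and `-C (1 - δ) γ`. For `δ ≠ 1` the comparison is that of `|1 - γ|` with `|γ|`,
and `γ = 1/2` is the threshold. For `δ = 1` the expansion decides nothing, but then `γ` is at least
Euler's constant, which exceeds `1/2` (`eulerMascheroniConstant_le`): `L_S(s)/ζ(s)` increases with
`s > 1`, because each of its Euler factors does.

The expansion of `S(x)` is obtained by real methods, without analytic continuation. Let `g` be the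
indicator function of the integers all of whose primes lie in `S` (`smoothFun`), and write the
indicator function of `S` as `h * g`, where `h` (`correctionFun`) is bounded by `1` and supported on
the powerful numbers. Condition B says that `Λ_g = g Λ` (`smoothMangoldt`) obeys a prime number
theorem with a saving `log^{1+ρ}`, so that `∑_{n ≤ x} Λ_g(n)/n = δ log x + B + o(1)`. The identity
`g log = g * Λ_g` is then used twice.

* For the logarithmic sums `M(x) = ∑_{n ≤ x} g(n)/n` it becomes a differential equation for
  `∑_{n ≤ x} (g(n)/n) log (x/n)`, whose solution gives `M(x) = A u^δ (1 - δ B/u + o(1/u))` with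
  some `A > 0` (`exists_logarithmicSum_asymptotic`).
* For `G(x) = ∑_{n ≤ x} g(n)` it reads
  `G(x) log x = δ x M(x) + ∑ g(n) E(x/n) + ∑ g(n) log (x/n)`, where `E` is the error term in the
  prime number theorem for `Λ_g`, and all three terms are evaluated to the required precision
  (`tendsto_partialSum_secondOrder`).

Dominated convergence in `S(x) = ∑ h(d) G(x/d)` finishes the expansion (`tendsto_partialSum_mul`). Its
coefficients are expressed through `A`, `B`, `H = ∑ h(n)/n` and `H' = ∑ h(n) log n / n`, and they
are matched with the two constants by an Abelian theorem (`tendsto_rpow_mul_tsum`): from the Dirichlet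
series one finds `γ = -B - H'/H` (`isEulerKroneckerConstant`), and from the Euler product, with
Dirichlet's convergence test and Mertens' estimate to reach the point `s = 1`, one finds
`C = δ A H` (`isLandauConstant`).
-/


/-! ### Partial sums and comparison of right derivatives -/

namespace MultiplicativeSets

open Filter Topology

/-- The sum of `a n` over the positive integers `n ≤ x`. -/
noncomputable def partialSum (a : ℕ → ℝ) (x : ℝ) : ℝ := ∑ n ∈ Finset.Ioc 0 ⌊x⌋₊, a n

lemma partialSum_mono {a : ℕ → ℝ} (ha : ∀ n, 0 ≤ a n) : Monotone (partialSum a) := by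
  intro x y hxy
  exact Finset.sum_le_sum_of_subset_of_nonneg
    (Finset.Ioc_subset_Ioc_right (Nat.floor_le_floor hxy)) fun n _ _ => ha n

lemma partialSum_nonneg {a : ℕ → ℝ} (ha : ∀ n, 0 ≤ a n) (x : ℝ) : 0 ≤ partialSum a x :=
  Finset.sum_nonneg fun n _ => ha n

lemma partialSum_le_self {a : ℕ → ℝ} (ha : ∀ n, a n ≤ 1) {x : ℝ} (hx : 0 ≤ x) :
    partialSum a x ≤ x := by
  calc partialSum a x ≤ ∑ n ∈ Finset.Ioc 0 ⌊x⌋₊, (1 : ℝ) := Finset.sum_le_sum fun n _ => ha n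
    _ = ⌊x⌋₊ := by simp
    _ ≤ x := Nat.floor_le hx

lemma partialSum_of_lt_one (a : ℕ → ℝ) {x : ℝ} (hx : x < 1) : partialSum a x = 0 := by
  simp [partialSum, Nat.floor_eq_zero.2 hx]

lemma mem_Ioc_floor {x : ℝ} {n : ℕ} (h : n ∈ Finset.Ioc 0 ⌊x⌋₊) :
    (1 : ℝ) ≤ n ∧ (n : ℝ) ≤ x := by
  rw [Finset.mem_Ioc] at h
  exact ⟨by exact_mod_cast h.1, (Nat.le_floor_iff' (by omega)).1 h.2⟩

lemma mem_Ioc_floor_iff {x : ℝ} {n : ℕ} :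
    n ∈ Finset.Ioc 0 ⌊x⌋₊ ↔ 0 < n ∧ (n : ℝ) ≤ x := by
  rw [Finset.mem_Ioc]
  constructor
  · rintro ⟨h1, h2⟩
    exact ⟨h1, (Nat.le_floor_iff' (by omega)).1 h2⟩
  · rintro ⟨h1, h2⟩
    exact ⟨h1, (Nat.le_floor_iff' (by omega)).2 h2⟩

/-- Dirichlet's rearrangement of the partial sums of a convolution. -/
lemma partialSum_mul (f g : ArithmeticFunction ℝ) (x : ℝ) :
    partialSum (fun n => (f * g) n) x = ∑ n ∈ Finset.Ioc 0 ⌊x⌋₊, f n * partialSum g (x / n) := by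
  unfold partialSum
  rw [ArithmeticFunction.sum_Ioc_mul_eq_sum_sum]
  refine Finset.sum_congr rfl fun n _ => ?_
  rw [Nat.floor_div_natCast]

/-- The pointwise product of an arithmetic function with a weight `w`. -/
def weighted (f : ArithmeticFunction ℝ) (w : ℕ → ℝ) : ArithmeticFunction ℝ :=
  ⟨fun n => f n * w n, by simp⟩

@[simp] lemma weighted_apply (f : ArithmeticFunction ℝ) (w : ℕ → ℝ) (n : ℕ) :
    weighted f w n = f n * w n := rfl

lemma weighted_mul (f g : ArithmeticFunction ℝ) {w : ℕ → ℝ}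
    (hw : ∀ a b, w (a * b) = w a * w b) : weighted (f * g) w = weighted f w * weighted g w := by
  ext n
  simp only [weighted_apply, ArithmeticFunction.mul_apply, Finset.sum_mul]
  refine Finset.sum_congr rfl fun p hp => ?_
  rw [← (Nat.mem_divisorsAntidiagonal.1 hp).1, hw]
  ring

lemma partialSum_mul_div (f g : ArithmeticFunction ℝ) (x : ℝ) :
    partialSum (fun n => (f * g) n / n) x
      = ∑ n ∈ Finset.Ioc 0 ⌊x⌋₊, f n / n * partialSum (fun k => g k / k) (x / n) := by
  have h := partialSum_mul (weighted f fun n => (n : ℝ)⁻¹) (weighted g fun n => (n : ℝ)⁻¹) x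
  rw [← weighted_mul f g (fun a b => by push_cast; rw [mul_inv])] at h
  exact h

/-- `∑_{n ≤ e^v} a(n) (φ(v) - φ(log n))`, the partial sum of `a` smoothed by `φ`. It is a
continuous function of `v`. -/
noncomputable def smoothedSum (a : ℕ → ℝ) (φ : ℝ → ℝ) (v : ℝ) : ℝ :=
  ∑ n ∈ Finset.Ioc 0 ⌊Real.exp v⌋₊, a n * (φ v - φ (Real.log n))

lemma smoothedSum_eq (a : ℕ → ℝ) (φ : ℝ → ℝ) (v : ℝ) :
    smoothedSum a φ v = φ v * partialSum a (Real.exp v)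
      - partialSum (fun n => a n * φ (Real.log n)) (Real.exp v) := by
  simp only [smoothedSum, partialSum, mul_sub, Finset.sum_sub_distrib, Finset.mul_sum]
  simp only [mul_comm]

/-- The smoothed sum has right derivative `φ'(v) ∑_{n ≤ e^v} a(n)`. -/
lemma hasDerivWithinAt_smoothedSum (a : ℕ → ℝ) {φ : ℝ → ℝ} {φ' v : ℝ} (hφ : HasDerivAt φ φ' v) :
    HasDerivWithinAt (smoothedSum a φ) (φ' * partialSum a (Real.exp v)) (Set.Ici v) v := by
  have h1 : HasDerivWithinAt
      (fun w => ∑ n ∈ Finset.Ioc 0 ⌊Real.exp v⌋₊, a n * (φ w - φ (Real.log n)))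
      (∑ n ∈ Finset.Ioc 0 ⌊Real.exp v⌋₊, a n * φ') (Set.Ici v) v :=
    HasDerivWithinAt.fun_sum fun n _ => ((hφ.sub_const _).const_mul _).hasDerivWithinAt
  have h2 : ∑ n ∈ Finset.Ioc 0 ⌊Real.exp v⌋₊, a n * φ' = φ' * partialSum a (Real.exp v) := by
    rw [partialSum, Finset.mul_sum]
    simp only [mul_comm]
  rw [← h2]
  refine h1.congr_of_eventuallyEq ?_ rfl
  have h3 : ∀ᶠ w in 𝓝[≥] v, Real.exp w < ⌊Real.exp v⌋₊ + 1 :=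
    nhdsWithin_le_nhds (Real.continuous_exp.continuousAt.eventually_lt_const
      (Nat.lt_floor_add_one _))
  filter_upwards [h3, self_mem_nhdsWithin] with w hw hvw
  have : ⌊Real.exp w⌋₊ = ⌊Real.exp v⌋₊ := by
    rw [Nat.floor_eq_iff (Real.exp_pos _).le]
    exact ⟨(Nat.floor_le (Real.exp_pos _).le).trans (Real.exp_le_exp.2 hvw), hw⟩
  rw [smoothedSum, this]

lemma continuous_smoothedSum (a : ℕ → ℝ) {φ : ℝ → ℝ} (hφ : Continuous φ) :
    Continuous (smoothedSum a φ) := by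
  rw [continuous_iff_continuousAt]
  intro v
  set N := ⌊Real.exp (v + 1)⌋₊
  -- Truncating each term at `log n` gives a sum of fixed length near `v`.
  have h1 : Continuous fun w =>
      ∑ n ∈ Finset.Ioc 0 N, a n * (φ (max w (Real.log n)) - φ (Real.log n)) := by
    fun_prop
  refine h1.continuousAt.congr ?_
  filter_upwards [eventually_lt_nhds (show v < v + 1 by linarith)] with w hw
  have hsub : Finset.Ioc 0 ⌊Real.exp w⌋₊ ⊆ Finset.Ioc 0 N :=
    Finset.Ioc_subset_Ioc_right (Nat.floor_le_floor (Real.exp_le_exp.2 hw.le))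
  rw [smoothedSum, ← Finset.sum_subset hsub]
  · refine Finset.sum_congr rfl fun n hn => ?_
    have h := mem_Ioc_floor hn
    rw [max_eq_left ((Real.log_le_iff_le_exp (by linarith)).2 h.2)]
  · intro n hn hn'
    have h := mem_Ioc_floor hn
    rw [mem_Ioc_floor_iff] at hn'
    have h2 : Real.exp w < n := by
      by_contra hcon
      exact hn' ⟨(Finset.mem_Ioc.1 hn).1, not_lt.1 hcon⟩
    rw [max_eq_right ((Real.le_log_iff_exp_le (by linarith)).2 h2.le)]
    simp

lemma sub_le_sub_of_rightDeriv_le {f f' F F' : ℝ → ℝ} {a : ℝ}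
    (hf : ContinuousOn f (Set.Ici a)) (hF : ContinuousOn F (Set.Ici a))
    (hf' : ∀ x, a ≤ x → HasDerivWithinAt f (f' x) (Set.Ici x) x)
    (hF' : ∀ x, a ≤ x → HasDerivWithinAt F (F' x) (Set.Ici x) x)
    (h : ∀ x, a ≤ x → f' x ≤ F' x) {x : ℝ} (hx : a ≤ x) : f x - f a ≤ F x - F a := by
  have := image_le_of_deriv_right_le_deriv_boundary (f := f) (f' := f') (a := a) (b := x)
    (B := fun y => F y + (f a - F a)) (B' := F')
    (hf.mono fun y hy => hy.1) (fun y hy => hf' y hy.1) (by simp)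
    ((hF.mono fun y hy => hy.1).add continuousOn_const)
    (fun y hy => (hF' y hy.1).add_const _) (fun y hy => h y hy.1) (Set.right_mem_Icc.2 hx)
  linarith

/-- A function whose right derivative is bounded by that of `-φ`, where `φ` decreases to `0`,
converges, and its distance from the limit is at most `φ`. -/
lemma exists_limit_of_abs_rightDeriv_le {f f' φ φ' : ℝ → ℝ} {a : ℝ}
    (hf : ContinuousOn f (Set.Ici a)) (hφ : ContinuousOn φ (Set.Ici a))
    (hf' : ∀ x, a ≤ x → HasDerivWithinAt f (f' x) (Set.Ici x) x)
    (hφ' : ∀ x, a ≤ x → HasDerivWithinAt φ (φ' x) (Set.Ici x) x)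
    (h : ∀ x, a ≤ x → |f' x| ≤ -φ' x) (hlim : Tendsto φ atTop (𝓝 0)) :
    ∃ L, Tendsto f atTop (𝓝 L) ∧ ∀ x, a ≤ x → |f x - L| ≤ φ x := by
  have key : ∀ x, a ≤ x → ∀ y, x ≤ y → |f y - f x| ≤ φ x - φ y := by
    intro x hx y hxy
    have hsub : Set.Ici x ⊆ Set.Ici a := Set.Ici_subset_Ici.2 hx
    rw [abs_le]
    constructor
    · have := sub_le_sub_of_rightDeriv_le (hφ.mono hsub) (hf.mono hsub)
        (fun z hz => hφ' z (hx.trans hz)) (fun z hz => hf' z (hx.trans hz))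
        (fun z hz => by linarith [neg_abs_le (f' z), h z (hx.trans hz)]) hxy
      linarith
    · have := sub_le_sub_of_rightDeriv_le (hf.mono hsub) (hφ.neg.mono hsub)
        (fun z hz => hf' z (hx.trans hz)) (fun z hz => (hφ' z (hx.trans hz)).neg)
        (fun z hz => by linarith [le_abs_self (f' z), h z (hx.trans hz)]) hxy
      simp only [Pi.neg_apply] at this
      linarith
  have hanti : ∀ x, a ≤ x → ∀ y, x ≤ y → φ y ≤ φ x := fun x hx y hxy => by
    linarith [key x hx y hxy, abs_nonneg (f y - f x)]
  have hnn : ∀ x, a ≤ x → 0 ≤ φ x := fun x hx =>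
    le_of_tendsto hlim (by filter_upwards [eventually_ge_atTop x] with y hy using hanti x hx y hy)
  have hC : CauchySeq f := by
    rw [Metric.cauchySeq_iff']
    intro ε hε
    obtain ⟨N, hN, hN'⟩ := ((hlim.eventually_lt_const hε).and (eventually_ge_atTop a)).exists
    refine ⟨N, fun n hn => ?_⟩
    rw [Real.dist_eq]
    linarith [key N hN' n hn, hnn n (hN'.trans hn)]
  obtain ⟨L, hL⟩ := cauchySeq_tendsto_of_complete hC
  refine ⟨L, hL, fun x hx => ?_⟩
  have h1 : Tendsto (fun y => |f y - f x|) atTop (𝓝 |L - f x|) := (hL.sub_const _).abs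
  rw [abs_sub_comm]
  refine le_of_tendsto h1 ?_
  filter_upwards [eventually_ge_atTop x] with y hy
  linarith [key x hx y hy, hnn y (hx.trans hy)]

end MultiplicativeSets

/-! ### Logarithmic sums -/

namespace MultiplicativeSets

open Filter Topology

/-- If `u² Z'(u) → c` then `Z` has a limit, which it approaches like `-c / u`. -/
lemma exists_limit_of_sq_mul_rightDeriv {Z z : ℝ → ℝ} {a c : ℝ}
    (hZ : ContinuousOn Z (Set.Ici a)) (hz : ∀ x, a ≤ x → HasDerivWithinAt Z (z x) (Set.Ici x) x)
    (h : Tendsto (fun u => u ^ 2 * z u) atTop (𝓝 c)) :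
    ∃ K, Tendsto (fun u => u * (K - Z u)) atTop (𝓝 c) := by
  -- Add `c / x` to `Z`: its right derivative is then `o(1 / x²)`, dominated by that of `ε / x`.
  have key : ∀ ε > 0, ∃ L, Tendsto Z atTop (𝓝 L) ∧ ∀ᶠ x in atTop, |Z x + c / x - L| ≤ ε / x := by
    intro ε hε
    have h1 : ∀ᶠ u in atTop, |u ^ 2 * z u - c| < ε := by
      have := (h.sub_const c).abs
      simp only [sub_self, abs_zero] at this
      exact this.eventually_lt_const hε
    obtain ⟨b0, hb0⟩ := eventually_atTop.1 h1
    set b := max (max a 1) b0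
    have hb1 : 1 ≤ b := (le_max_right a 1).trans (le_max_left _ _)
    have hba : a ≤ b := (le_max_left a 1).trans (le_max_left _ _)
    have hdiv : ∀ k x : ℝ, b ≤ x → HasDerivAt (fun y => k / y) (-k / x ^ 2) x := by
      intro k x hx
      have := (hasDerivAt_inv (x := x) (by linarith)).const_mul k
      simpa [div_eq_mul_inv] using this
    have hcont : ∀ k : ℝ, ContinuousOn (fun y => k / y) (Set.Ici b) := fun k x hx =>
      (hdiv k x hx).continuousAt.continuousWithinAt
    obtain ⟨L, hL, hL'⟩ := exists_limit_of_abs_rightDeriv_le (a := b)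
      (f := fun x => Z x + c / x) (f' := fun x => z x + -c / x ^ 2)
      (φ := fun x => ε / x) (φ' := fun x => -ε / x ^ 2)
      ((hZ.mono (Set.Ici_subset_Ici.2 hba)).add (hcont c)) (hcont ε)
      (fun x hx => (hz x (hba.trans hx)).add (hdiv c x hx).hasDerivWithinAt)
      (fun x hx => (hdiv ε x hx).hasDerivWithinAt)
      (fun x hx => by
        have hx1 : 0 < x := by linarith
        have hx0 : 0 < x ^ 2 := by positivity
        have e1 : z x + -c / x ^ 2 = (x ^ 2 * z x - c) / x ^ 2 := by field_simp; ring
        rw [e1, abs_div, abs_of_pos hx0, neg_div, neg_neg]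
        gcongr
        exact (hb0 x ((le_max_right _ _).trans hx)).le)
      (tendsto_const_nhds.div_atTop tendsto_id)
    refine ⟨L, ?_, eventually_atTop.2 ⟨b, hL'⟩⟩
    have h2 : Tendsto (fun x : ℝ => c / x) atTop (𝓝 0) := tendsto_const_nhds.div_atTop tendsto_id
    simpa using hL.sub h2
  obtain ⟨K, hK, -⟩ := key 1 one_pos
  refine ⟨K, ?_⟩
  rw [Metric.tendsto_atTop']
  intro ε hε
  obtain ⟨L, hL, hL'⟩ := key (ε / 2) (by positivity)
  have hLK : L = K := tendsto_nhds_unique hL hK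
  subst hLK
  obtain ⟨b, hb⟩ := eventually_atTop.1 (hL'.and (eventually_gt_atTop 0))
  refine ⟨b, fun x hx => ?_⟩
  obtain ⟨h1, h2⟩ := hb x hx.le
  rw [Real.dist_eq]
  have e1 : x * (L - Z x) - c = -(x * (Z x + c / x - L)) := by field_simp; ring
  rw [e1, abs_neg, abs_mul, abs_of_pos h2]
  calc x * |Z x + c / x - L| ≤ x * (ε / 2 / x) := by gcongr
    _ = ε / 2 := by field_simp
    _ < ε := by linarith

section

variable {g L : ArithmeticFunction ℝ} {δ B K : ℝ}

/-- `G(x) log x ≪ x M(x)` for `G(x) = ∑_{n ≤ x} g(n)` and `M(x) = ∑_{n ≤ x} g(n) / n`. -/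
lemma partialSum_mul_log_le (hg0 : ∀ n, 0 ≤ g n)
    (hconv : ∀ n : ℕ, g n * Real.log n = (g * L) n)
    (hψ : ∀ x, 1 ≤ x → partialSum L x ≤ K * x) {x : ℝ} (hx : 1 ≤ x) :
    partialSum g x * Real.log x ≤ (K + 1) * x * partialSum (fun n => g n / n) x := by
  have h1 : partialSum (fun n => g n * Real.log n) x
      ≤ K * x * partialSum (fun n => g n / n) x := by
    simp only [hconv]
    rw [partialSum_mul, partialSum, Finset.mul_sum]
    refine Finset.sum_le_sum fun n hn => ?_
    obtain ⟨hn1, hn2⟩ := mem_Ioc_floor hn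
    calc g n * partialSum L (x / n) ≤ g n * (K * (x / n)) :=
          mul_le_mul_of_nonneg_left (hψ _ ((one_le_div (by linarith)).2 hn2)) (hg0 n)
      _ = K * x * (g n / n) := by ring
  have h2 : partialSum g x * Real.log x - partialSum (fun n => g n * Real.log n) x
      ≤ x * partialSum (fun n => g n / n) x := by
    simp only [partialSum, Finset.mul_sum, Finset.sum_mul, ← Finset.sum_sub_distrib]
    refine Finset.sum_le_sum fun n hn => ?_
    obtain ⟨hn1, hn2⟩ := mem_Ioc_floor hn
    have : Real.log x - Real.log n ≤ x / n := by
      rw [← Real.log_div (by linarith) (by linarith)]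
      linarith [Real.log_le_sub_one_of_pos (show 0 < x / n by positivity)]
    calc g n * Real.log x - g n * Real.log n = g n * (Real.log x - Real.log n) := by ring
      _ ≤ g n * (x / n) := mul_le_mul_of_nonneg_left this (hg0 n)
      _ = x * (g n / n) := by ring
  linarith

/-- Averaging a bounded null function `e(x / n)` with weights `g(n) / n` gives a null function,
because the terms with `n` close to `x` carry a negligible part of the total weight. -/
lemma tendsto_average_zero (hg0 : ∀ n, 0 ≤ g n) (hg1 : g 1 = 1)
    (hconv : ∀ n : ℕ, g n * Real.log n = (g * L) n)
    (hψ : ∀ x, 1 ≤ x → partialSum L x ≤ K * x) {e : ℝ → ℝ} {E : ℝ}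
    (he : ∀ y, 1 ≤ y → |e y| ≤ E) (he0 : Tendsto e atTop (𝓝 0)) :
    Tendsto (fun x => (∑ n ∈ Finset.Ioc 0 ⌊x⌋₊, g n / n * e (x / n))
      / partialSum (fun n => g n / n) x) atTop (𝓝 0) := by
  have hE : 0 ≤ E := (abs_nonneg _).trans (he 1 le_rfl)
  rw [Metric.tendsto_atTop']
  intro ε hε
  obtain ⟨T0, hT0⟩ := (Metric.tendsto_atTop'.1 he0) (ε / 3) (by positivity)
  set T := max (T0 + 1) 1
  have hT : ∀ y, T ≤ y → |e y| ≤ ε / 3 := fun y hy => by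
    have := hT0 y (by linarith [le_max_left (T0 + 1) 1])
    rw [Real.dist_eq, sub_zero] at this
    exact this.le
  have hT1 : 1 ≤ T := le_max_right _ _
  have hlim : Tendsto (fun x => E * T * (K + 1) / Real.log x) atTop (𝓝 0) :=
    tendsto_const_nhds.div_atTop Real.tendsto_log_atTop
  obtain ⟨b, hb⟩ := eventually_atTop.1
    ((hlim.eventually_lt_const (show 0 < ε / 3 by positivity)).and (eventually_gt_atTop 1))
  refine ⟨b, fun x hx => ?_⟩
  obtain ⟨h1, h2⟩ := hb x hx.le
  -- Terms with `x / n ≥ T` are small; the others have total weight at most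
  -- `(T / x) G(x) ≪ M(x) / log x`.
  set M := partialSum (fun n => g n / n) x
  have hM : 1 ≤ M := by
    have : g 1 / ((1 : ℕ) : ℝ) ≤ M := Finset.single_le_sum
      (f := fun n : ℕ => g n / n) (fun n _ => div_nonneg (hg0 n) n.cast_nonneg)
      (mem_Ioc_floor_iff.2 ⟨one_pos, by simpa using h2.le⟩)
    simpa [hg1] using this
  have hlog : 0 < Real.log x := Real.log_pos h2
  have hG : partialSum g x ≤ (K + 1) * x * M / Real.log x := by
    rw [le_div_iff₀ hlog]
    exact partialSum_mul_log_le hg0 hconv hψ h2.le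
  have h3 : |∑ n ∈ Finset.Ioc 0 ⌊x⌋₊, g n / n * e (x / n)|
      ≤ ε / 3 * M + E * T / x * partialSum g x := by
    refine (Finset.abs_sum_le_sum_abs _ _).trans ?_
    simp only [M, partialSum, Finset.mul_sum, ← Finset.sum_add_distrib]
    refine Finset.sum_le_sum fun n hn => ?_
    obtain ⟨hn1, hn2⟩ := mem_Ioc_floor hn
    have hn0 : (0 : ℝ) < n := by linarith
    have hx0 : 0 < x := by linarith
    have h4 : |e (x / n)| ≤ ε / 3 + E * T / x * n := by
      rcases le_total T (x / n) with h | h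
      · have := hT _ h
        have : 0 ≤ E * T / x * n := by positivity
        linarith
      · have h5 := he (x / n) ((one_le_div hn0).2 hn2)
        have h6 : 1 ≤ T / x * n := by
          rw [div_le_iff₀ hn0] at h
          rw [div_mul_eq_mul_div, one_le_div hx0]
          exact h
        calc |e (x / n)| ≤ E * 1 := by linarith
          _ ≤ E * (T / x * n) := by gcongr
          _ ≤ ε / 3 + E * T / x * n := by
            have : E * (T / x * n) = E * T / x * n := by ring
            linarith
    rw [abs_mul, abs_of_nonneg (div_nonneg (hg0 n) hn0.le)]
    calc g n / n * |e (x / n)| ≤ g n / n * (ε / 3 + E * T / x * n) :=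
          mul_le_mul_of_nonneg_left h4 (div_nonneg (hg0 n) hn0.le)
      _ = ε / 3 * (g n / n) + E * T / x * g n := by field_simp
  rw [Real.dist_eq, sub_zero, abs_div, abs_of_pos (show 0 < M by linarith),
    div_lt_iff₀ (by linarith)]
  calc _ ≤ ε / 3 * M + E * T / x * partialSum g x := h3
    _ ≤ ε / 3 * M + E * T / x * ((K + 1) * x * M / Real.log x) := by gcongr
    _ = ε / 3 * M + E * T * (K + 1) / Real.log x * M := by field_simp
    _ ≤ ε / 3 * M + ε / 3 * M := by gcongr
    _ < ε * M := by nlinarith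

/-- The sum `M(x) = ∑_{n ≤ x} g(n) / n` to second order. With `u = log x` and
`J(u) = ∑_{n ≤ x} (g(n) / n) (u - log n)`, the convolution identity `g log = g * L` becomes
`(u - B - o(1)) J' = (1 + δ) J`, which is then integrated. -/
theorem exists_logarithmicSum_asymptotic (hg0 : ∀ n, 0 ≤ g n) (hg1 : g 1 = 1)
    (hL : ∀ n, 0 ≤ L n) (hconv : ∀ n : ℕ, g n * Real.log n = (g * L) n) (hδ : 0 < δ)
    (hψ : ∀ x, 1 ≤ x → partialSum L x ≤ K * x)
    (hm : Tendsto (fun x => partialSum (fun n => L n / n) x - δ * Real.log x) atTop (𝓝 B)) :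
    ∃ A, 0 < A ∧ Tendsto (fun u => u * (partialSum (fun n => g n / n) (Real.exp u) / u ^ δ - A))
      atTop (𝓝 (-(δ * B * A))) := by
  set M : ℝ → ℝ := fun u => partialSum (fun n => g n / n) (Real.exp u) with hMdef
  set e : ℝ → ℝ := fun x => partialSum (fun n => L n / n) x - δ * Real.log x - B with hedef
  have he0 : Tendsto e atTop (𝓝 0) := by simpa using hm.sub_const B
  have hLn : ∀ n : ℕ, 0 ≤ L n / n := fun n => div_nonneg (hL n) n.cast_nonneg
  obtain ⟨E, hE⟩ : ∃ E, ∀ y, 1 ≤ y → |e y| ≤ E := by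
    obtain ⟨b, hb⟩ := (Metric.tendsto_atTop'.1 he0) 1 one_pos
    set Y := max (b + 1) 1
    refine ⟨max 1 (partialSum (fun n => L n / n) Y + δ * Real.log Y + |B|), fun y hy => ?_⟩
    rcases le_total Y y with h | h
    · have := hb y (by linarith [le_max_left (b + 1) 1])
      rw [Real.dist_eq, sub_zero] at this
      exact this.le.trans (le_max_left _ _)
    · refine le_trans ?_ (le_max_right _ _)
      have h1 := partialSum_mono hLn h
      have h2 := partialSum_nonneg hLn y
      have h3 : Real.log y ≤ Real.log Y := Real.log_le_log (by linarith) h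
      have h4 : 0 ≤ Real.log y := Real.log_nonneg hy
      have h5 : δ * Real.log y ≤ δ * Real.log Y := by gcongr
      have h6 : 0 ≤ δ * Real.log y := by positivity
      rw [abs_le]
      constructor <;> linarith [neg_abs_le B, le_abs_self B]
  have havg := (tendsto_average_zero hg0 hg1 hconv hψ hE he0).comp Real.tendsto_exp_atTop
  set η : ℝ → ℝ := fun u => (∑ n ∈ Finset.Ioc 0 ⌊Real.exp u⌋₊, g n / n * e (Real.exp u / n))
      / M u with hηdef
  have hη : Tendsto η atTop (𝓝 0) := havg
  have hM1 : ∀ u, 0 ≤ u → 1 ≤ M u := by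
    intro u hu
    have : g 1 / ((1 : ℕ) : ℝ) ≤ M u := Finset.single_le_sum
      (f := fun n : ℕ => g n / n) (fun n _ => div_nonneg (hg0 n) n.cast_nonneg)
      (mem_Ioc_floor_iff.2 ⟨one_pos, by simpa using hu⟩)
    simpa [hg1] using this
  set J : ℝ → ℝ := smoothedSum (fun n => g n / n) id with hJdef
  have hJ' : ∀ u, HasDerivWithinAt J (M u) (Set.Ici u) u := fun u => by
    simpa using hasDerivWithinAt_smoothedSum (fun n => g n / n) (hasDerivAt_id u)
  have hJc : Continuous J := continuous_smoothedSum _ continuous_id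
  have hode : ∀ u, 0 ≤ u → (u - B - η u) * M u = (1 + δ) * J u := by
    intro u hu
    have hMu := hM1 u hu
    have h1 : η u * M u = ∑ n ∈ Finset.Ioc 0 ⌊Real.exp u⌋₊, g n / n * e (Real.exp u / n) := by
      rw [hηdef]; field_simp
    have h2 : J u = u * M u - partialSum (fun n => (g * L) n / n) (Real.exp u) := by
      rw [hJdef, smoothedSum_eq]
      simp only [id, ← hconv]
      simp only [div_mul_eq_mul_div, hMdef]
    have h3 : partialSum (fun n => (g * L) n / n) (Real.exp u)
        = δ * J u + B * M u + η u * M u := by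
      have hMsum : M u = ∑ n ∈ Finset.Ioc 0 ⌊Real.exp u⌋₊, g n / n := rfl
      rw [partialSum_mul_div, h1, hJdef, hMsum]
      simp only [smoothedSum, Finset.mul_sum, ← Finset.sum_add_distrib]
      refine Finset.sum_congr rfl fun n hn => ?_
      obtain ⟨hn1, hn2⟩ := mem_Ioc_floor hn
      have : Real.log (Real.exp u / n) = u - Real.log n := by
        rw [Real.log_div (Real.exp_ne_zero _) (by linarith), Real.log_exp]
      simp only [hedef, this, id]
      ring
    linarith
  have hden : Tendsto (fun u => u - B - η u) atTop atTop := by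
    have : Tendsto (fun u : ℝ => u + (-B - η u)) atTop atTop :=
      tendsto_atTop_add_right_of_le' _ (-B - 1) tendsto_id
        (by filter_upwards [hη.eventually_lt_const one_pos] with u hu; linarith)
    refine this.congr fun u => by ring
  obtain ⟨a, ha⟩ := eventually_atTop.1 ((hden.eventually_ge_atTop 1).and (eventually_ge_atTop 1))
  have hJpos : ∀ u, a ≤ u → 0 < J u := by
    intro u hu
    obtain ⟨h1, h2⟩ := ha u hu
    have h3 := hode u (by linarith)
    have h4 := hM1 u (by linarith)
    have : 0 < (1 + δ) * J u := by rw [← h3]; positivity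
    exact (pos_iff_pos_of_mul_pos this).1 (by linarith)
  -- Since `J` grows like `u^{1 + δ}`, its normalised logarithm `Z` converges.
  set Z : ℝ → ℝ := fun u => Real.log (J u) - (1 + δ) * Real.log u with hZdef
  have hZc : ContinuousOn Z (Set.Ici a) := by
    refine ContinuousOn.sub (hJc.continuousOn.log fun u hu => (hJpos u hu).ne') ?_
    exact continuousOn_const.mul (continuousOn_id.log fun u hu => by
      have := (ha u hu).2
      simp only [id]
      linarith)
  have hZ' : ∀ u, a ≤ u →
      HasDerivWithinAt Z (M u / J u - (1 + δ) * u⁻¹) (Set.Ici u) u := by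
    intro u hu
    have hu1 := (ha u hu).2
    exact ((hJ' u).log (hJpos u hu).ne').sub
      (((Real.hasDerivAt_log (by linarith)).const_mul _).hasDerivWithinAt)
  have hratio : Tendsto (fun u => u / (u - B - η u)) atTop (𝓝 1) := by
    have h1 : Tendsto (fun u => 1 + (B + η u) / (u - B - η u)) atTop (𝓝 (1 + 0)) :=
      tendsto_const_nhds.add ((tendsto_const_nhds.add hη).div_atTop hden)
    rw [add_zero] at h1
    refine h1.congr' ?_
    filter_upwards [hden.eventually_ge_atTop 1] with u hu
    field_simp
    ring
  have hZlim : Tendsto (fun u => u ^ 2 * (M u / J u - (1 + δ) * u⁻¹)) atTop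
      (𝓝 ((1 + δ) * B)) := by
    have h1 : Tendsto (fun u => (1 + δ) * (B + η u) * (u / (u - B - η u))) atTop
        (𝓝 ((1 + δ) * (B + 0) * 1)) :=
      ((tendsto_const_nhds.add hη).const_mul _).mul hratio
    rw [add_zero, mul_one] at h1
    refine h1.congr' ?_
    filter_upwards [eventually_ge_atTop a] with u hu
    obtain ⟨h2, h3⟩ := ha u hu
    have h4 : M u / J u = (1 + δ) / (u - B - η u) := by
      rw [div_eq_div_iff (hJpos u hu).ne' (by linarith), mul_comm, hode u (by linarith)]
    rw [h4]
    have : u - B - η u ≠ 0 := by linarith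
    have : u ≠ 0 := by linarith
    field_simp
    ring
  obtain ⟨K', hK'⟩ := exists_limit_of_sq_mul_rightDeriv hZc hZ' hZlim
  refine ⟨(1 + δ) * Real.exp K', by positivity, ?_⟩
  have hw : Tendsto (fun u => Z u - K') atTop (𝓝 0) := by
    have h1 := hK'.neg.div_atTop tendsto_id
    refine h1.congr' ?_
    filter_upwards [eventually_gt_atTop 0] with u hu
    simp only [id]
    field_simp
    ring
  -- `Z = K' - (1 + δ) B / u + o(1 / u)`, and exponentiation preserves the expansion.
  have hexp : Tendsto (fun u => u * (Real.exp (Z u - K') - 1)) atTop (𝓝 (-((1 + δ) * B))) := by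
    have h1 : ContinuousAt (dslope Real.exp 0) 0 :=
      continuousAt_dslope_same.2 Real.differentiableAt_exp
    have h2 : Tendsto (fun u => dslope Real.exp 0 (Z u - K')) atTop (𝓝 1) := by
      have := h1.tendsto.comp hw
      simpa [dslope_same, Function.comp_def] using this
    have h3 := hK'.neg.mul h2
    rw [mul_one] at h3
    refine h3.congr fun u => ?_
    have h4 := sub_smul_dslope Real.exp 0 (Z u - K')
    simp only [sub_zero, smul_eq_mul, Real.exp_zero] at h4
    rw [← h4]
    ring
  have hfin : Tendsto (fun u => (1 + δ) * Real.exp K' *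
      (u * (Real.exp (Z u - K') - 1) * (u / (u - B - η u))
        + (B + η u) * (u / (u - B - η u)))) atTop
      (𝓝 ((1 + δ) * Real.exp K' * (-((1 + δ) * B) * 1 + (B + 0) * 1))) :=
    ((hexp.mul hratio).add ((tendsto_const_nhds.add hη).mul hratio)).const_mul _
  have hval : (1 + δ) * Real.exp K' * (-((1 + δ) * B) * 1 + (B + 0) * 1)
      = -(δ * B * ((1 + δ) * Real.exp K')) := by ring
  rw [hval] at hfin
  refine hfin.congr' ?_
  filter_upwards [eventually_ge_atTop a] with u hu
  obtain ⟨h2, h3⟩ := ha u hu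
  have hu0 : 0 < u := by linarith
  have hden0 : u - B - η u ≠ 0 := by linarith
  have h4 : J u = u ^ (1 + δ) * Real.exp K' * Real.exp (Z u - K') := by
    rw [mul_assoc, ← Real.exp_add, add_sub_cancel, hZdef, Real.exp_sub, Real.exp_log (hJpos u hu),
      Real.rpow_def_of_pos hu0, mul_comm (Real.log u)]
    field_simp
  have h5 : M u = (1 + δ) * J u / (u - B - η u) := by
    rw [eq_div_iff hden0, mul_comm, hode u hu0.le]
  have h6 : M u / u ^ δ = (1 + δ) * Real.exp K' * Real.exp (Z u - K') * (u / (u - B - η u)) := by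
    rw [h5, h4, Real.rpow_add hu0, Real.rpow_one]
    have : u ^ δ ≠ 0 := (Real.rpow_pos_of_pos hu0 _).ne'
    field_simp
  change _ = u * (M u / u ^ δ - _)
  rw [h6]
  field_simp
  ring

end

end MultiplicativeSets

/-! ### Growth of functions with a given right derivative -/

namespace MultiplicativeSets

open Filter Topology

lemma hasDerivAt_exp_mul_rpow (κ : ℝ) {u : ℝ} (hu : 0 < u) :
    HasDerivAt (fun u => Real.exp u * u ^ κ) (Real.exp u * u ^ κ * (1 + κ / u)) u := by
  have h := (Real.hasDerivAt_exp u).mul (Real.hasDerivAt_rpow_const (p := κ) (Or.inl hu.ne'))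
  refine h.congr_deriv ?_
  rw [Real.rpow_sub_one hu.ne']
  ring

lemma tendsto_exp_mul_rpow (κ : ℝ) :
    Tendsto (fun u : ℝ => Real.exp u * u ^ κ) atTop atTop := by
  have h := tendsto_exp_div_rpow_atTop (-κ)
  refine h.congr' ?_
  filter_upwards [eventually_ge_atTop 0] with u hu
  rw [Real.rpow_neg hu, div_inv_eq_mul]

/-- A bound for `f'` by `e^u u^κ` passes to `f`, because `2 e^u u^κ` has derivative at least
`e^u u^κ` for large `u`. -/
lemma eventually_abs_le_of_rightDeriv_le {f f' : ℝ → ℝ} {κ ε a : ℝ} (hε : 0 < ε)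
    (hf : ContinuousOn f (Set.Ici a)) (hf' : ∀ x, a ≤ x → HasDerivWithinAt f (f' x) (Set.Ici x) x)
    (h : ∀ᶠ u in atTop, |f' u| ≤ ε * (Real.exp u * u ^ κ)) :
    ∀ᶠ u in atTop, |f u| ≤ 3 * ε * (Real.exp u * u ^ κ) := by
  have h0 : Tendsto (fun u : ℝ => κ / u) atTop (𝓝 0) := tendsto_const_nhds.div_atTop tendsto_id
  have h1 := h0.eventually_const_lt (show (-(1 / 2) : ℝ) < 0 by norm_num)
  obtain ⟨b0, hb0⟩ := eventually_atTop.1 ((h.and h1).and (eventually_gt_atTop 0))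
  set b := max a b0
  have hba : a ≤ b := le_max_left _ _
  have hbb : ∀ x, b ≤ x → b0 ≤ x := fun x hx => (le_max_right a b0).trans hx
  set F : ℝ → ℝ := fun u => 2 * ε * (Real.exp u * u ^ κ)
  have hFd : ∀ x, b ≤ x →
      HasDerivAt F (2 * ε * (Real.exp x * x ^ κ * (1 + κ / x))) x := fun x hx =>
    (hasDerivAt_exp_mul_rpow κ (hb0 x (hbb x hx)).2).const_mul _
  have hFc : ContinuousOn F (Set.Ici b) := fun x hx =>
    (hFd x hx).continuousAt.continuousWithinAt
  have hfc := hf.mono (Set.Ici_subset_Ici.2 hba)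
  have hbound : ∀ x, b ≤ x → |f' x| ≤ 2 * ε * (Real.exp x * x ^ κ * (1 + κ / x)) := by
    intro x hx
    obtain ⟨⟨h2, h3⟩, h4⟩ := hb0 x (hbb x hx)
    have : 0 ≤ Real.exp x * x ^ κ := by positivity
    calc |f' x| ≤ ε * (Real.exp x * x ^ κ) := h2
      _ = 2 * ε * (Real.exp x * x ^ κ * (1 / 2)) := by ring
      _ ≤ _ := by gcongr; linarith
  have hup : ∀ x, b ≤ x → |f x - f b| ≤ F x - F b := by
    intro x hx
    rw [abs_le]
    constructor
    · have := sub_le_sub_of_rightDeriv_le (f := fun x => -F x) hFc.neg hfc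
        (fun y hy => (hFd y hy).neg.hasDerivWithinAt) (fun y hy => hf' y (hba.trans hy))
        (fun y hy => by linarith [hbound y hy, neg_abs_le (f' y)]) hx
      linarith
    · exact sub_le_sub_of_rightDeriv_le hfc hFc (fun y hy => hf' y (hba.trans hy))
        (fun y hy => (hFd y hy).hasDerivWithinAt)
        (fun y hy => (le_abs_self _).trans (hbound y hy)) hx
  have hFb : 0 ≤ F b := by
    have := (hb0 b (hbb b le_rfl)).2
    positivity
  have hbig := (tendsto_exp_mul_rpow κ).const_mul_atTop hε
  filter_upwards [hbig.eventually_ge_atTop |f b|, eventually_ge_atTop b] with x hx1 hx2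
  have h5 := hup x hx2
  have h6 : |f x| ≤ |f x - f b| + |f b| := by
    have := abs_add_le (f x - f b) (f b)
    rwa [sub_add_cancel] at this
  have h7 : F x = 2 * ε * (Real.exp x * x ^ κ) := rfl
  linarith

/-- A form of L'Hôpital's rule: `f' ~ C e^u u^κ` implies `f ~ C e^u u^κ`. -/
lemma tendsto_div_of_rightDeriv {f f' : ℝ → ℝ} {κ C a : ℝ}
    (hf : ContinuousOn f (Set.Ici a)) (hf' : ∀ x, a ≤ x → HasDerivWithinAt f (f' x) (Set.Ici x) x)
    (h : Tendsto (fun u => f' u / (Real.exp u * u ^ κ)) atTop (𝓝 C)) :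
    Tendsto (fun u => f u / (Real.exp u * u ^ κ)) atTop (𝓝 C) := by
  set b := max a 1
  have hb1 : ∀ x, b ≤ x → 0 < x := fun x hx => by linarith [(le_max_right a 1).trans hx]
  have hba : a ≤ b := le_max_left _ _
  have hFd : ∀ x, b ≤ x → HasDerivAt (fun u => C * (Real.exp u * u ^ κ))
      (C * (Real.exp x * x ^ κ * (1 + κ / x))) x := fun x hx =>
    (hasDerivAt_exp_mul_rpow κ (hb1 x hx)).const_mul _
  have h0 : Tendsto (fun u : ℝ => κ / u) atTop (𝓝 0) := tendsto_const_nhds.div_atTop tendsto_id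
  have h2 : Tendsto (fun u => |f' u / (Real.exp u * u ^ κ) - C * (1 + κ / u)|) atTop (𝓝 0) := by
    have := (h.sub ((h0.const_add 1).const_mul C)).abs
    simpa using this
  rw [Metric.tendsto_atTop']
  intro ε hε
  -- Compare `f` with `C e^u u^κ`, whose derivative is also asymptotic to `C e^u u^κ`.
  have h3 : ∀ᶠ u in atTop, |f' u - C * (Real.exp u * u ^ κ * (1 + κ / u))|
      ≤ ε / 4 * (Real.exp u * u ^ κ) := by
    filter_upwards [h2.eventually_lt_const (show 0 < ε / 4 by positivity),
      eventually_gt_atTop 0] with u hu hu0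
    have hp : 0 < Real.exp u * u ^ κ := by positivity
    have e1 : f' u - C * (Real.exp u * u ^ κ * (1 + κ / u))
        = (f' u / (Real.exp u * u ^ κ) - C * (1 + κ / u)) * (Real.exp u * u ^ κ) := by
      field_simp
    rw [e1, abs_mul, abs_of_pos hp]
    gcongr
  have h4 := eventually_abs_le_of_rightDeriv_le (f := fun u => f u - C * (Real.exp u * u ^ κ))
    (a := b) (show 0 < ε / 4 by positivity)
    ((hf.mono (Set.Ici_subset_Ici.2 hba)).sub fun x hx =>
      (hFd x hx).continuousAt.continuousWithinAt)
    (fun x hx => (hf' x (hba.trans hx)).sub (hFd x hx).hasDerivWithinAt) h3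
  obtain ⟨N, hN⟩ := eventually_atTop.1 (h4.and (eventually_gt_atTop 0))
  refine ⟨N, fun u hu => ?_⟩
  obtain ⟨h5, hu0⟩ := hN u hu.le
  have hp : 0 < Real.exp u * u ^ κ := by positivity
  rw [Real.dist_eq]
  have e1 : f u / (Real.exp u * u ^ κ) - C
      = (f u - C * (Real.exp u * u ^ κ)) / (Real.exp u * u ^ κ) := by field_simp
  rw [e1, abs_div, abs_of_pos hp, div_lt_iff₀ hp]
  nlinarith

lemma tendsto_one_sub_div (s : ℝ) : Tendsto (fun u : ℝ => (u - s) / u) atTop (𝓝 1) := by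
  have h0 : Tendsto (fun u : ℝ => s / u) atTop (𝓝 0) := tendsto_const_nhds.div_atTop tendsto_id
  have h1 := h0.const_sub 1
  rw [sub_zero] at h1
  refine h1.congr' ?_
  filter_upwards [eventually_gt_atTop 0] with u hu
  field_simp

lemma tendsto_sub_div_rpow (s κ : ℝ) :
    Tendsto (fun u : ℝ => ((u - s) / u) ^ κ) atTop (𝓝 1) := by
  have h := (tendsto_one_sub_div s).rpow_const (p := κ) (Or.inl one_ne_zero)
  rwa [Real.one_rpow] at h

lemma tendsto_mul_sub_div_rpow_sub_one (s κ : ℝ) :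
    Tendsto (fun u : ℝ => u * (((u - s) / u) ^ κ - 1)) atTop (𝓝 (-(κ * s))) := by
  have h1 : HasDerivAt (fun t : ℝ => (1 - s * t) ^ κ) (-(κ * s)) 0 := by
    have h2 : HasDerivAt (fun t : ℝ => 1 - s * t) (-s) 0 := by
      simpa using ((hasDerivAt_id (0 : ℝ)).const_mul s).const_sub 1
    have := h2.rpow_const (p := κ) (Or.inl (by simp))
    convert this using 1
    simp
    ring
  have h2 := h1.tendsto_slope_zero_right.comp tendsto_inv_atTop_nhdsGT_zero
  refine h2.congr' ?_
  filter_upwards [eventually_gt_atTop 0] with u hu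
  simp only [Function.comp, inv_inv, zero_add, mul_zero, sub_zero, Real.one_rpow, smul_eq_mul]
  congr 3
  field_simp

lemma tendsto_div_exp_mul_rpow_shift {G : ℝ → ℝ} {κ C : ℝ}
    (h : Tendsto (fun u => G u / (Real.exp u * u ^ κ)) atTop (𝓝 C)) (s : ℝ) :
    Tendsto (fun u => G (u - s) / (Real.exp u * u ^ κ)) atTop (𝓝 (C * Real.exp (-s))) := by
  have h1 : Tendsto (fun u : ℝ => u - s) atTop atTop := tendsto_atTop_add_const_right _ _ tendsto_id
  have h2 := ((h.comp h1).mul_const (Real.exp (-s))).mul (tendsto_sub_div_rpow s κ)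
  rw [mul_one] at h2
  refine h2.congr' ?_
  filter_upwards [eventually_gt_atTop 0, eventually_gt_atTop s] with u hu hus
  have h3 : 0 < u - s := by linarith
  simp only [Function.comp]
  rw [Real.div_rpow h3.le hu.le, sub_eq_add_neg, Real.exp_add, ← sub_eq_add_neg]
  have := (Real.rpow_pos_of_pos h3 κ).ne'
  have := (Real.rpow_pos_of_pos hu κ).ne'
  field_simp

/-- Interchange of limits for an approximation whose error is small for large parameter. -/
lemma tendsto_of_approx {X σ : ℝ → ℝ} {L τ : ℕ → ℝ} {Y : ℕ → ℝ → ℝ} {l : ℝ}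
    (hY : ∀ j, Tendsto (Y j) atTop (𝓝 (L j))) (hL : Tendsto L atTop (𝓝 l))
    (hτ : Tendsto τ atTop (𝓝 0)) (hσ : Tendsto σ atTop (𝓝 0))
    (h : ∀ j, ∀ᶠ u : ℝ in atTop, |X u - Y j u| ≤ τ j + σ u) : Tendsto X atTop (𝓝 l) := by
  rw [Metric.tendsto_nhds]
  intro ε hε
  have h4 : 0 < ε / 4 := by positivity
  obtain ⟨j, hj1, hj2⟩ := ((hτ.eventually_lt_const h4).and
    (Metric.tendsto_nhds.1 hL _ h4)).exists
  filter_upwards [h j, hσ.eventually_lt_const h4, Metric.tendsto_nhds.1 (hY j) _ h4]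
    with u h1 h2 h3
  rw [Real.dist_eq] at *
  have e : X u - l = (X u - Y j u) + (Y j u - L j) + (L j - l) := by ring
  rw [e]
  calc _ ≤ |X u - Y j u| + |Y j u - L j| + |L j - l| := abs_add_three _ _ _
    _ < ε := by linarith

end MultiplicativeSets

/-! ### From logarithmic sums to ordinary sums -/

namespace MultiplicativeSets

open Filter Topology

section

variable {g L : ArithmeticFunction ℝ} {δ A B K ρ : ℝ}

/-- The part `n ≤ e^{-j} x` of a sum `∑ g(n) (x / n) / (1 + log (x / n))^{1 + ρ}` is negligible
for large `j`. The range of `n` is cut into blocks on which `⌊log (x / n)⌋` is constant; blocks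
with `n ≥ √x` are estimated by `G(y) ≪ y log^{δ-1} y`, the others together by
`M(x) ≪ log^δ x`. -/
lemma exists_tail_bound (hρ : 0 < ρ) (hg0 : ∀ n, 0 ≤ g n) {c : ℝ}
    (hG : ∀ᶠ u in atTop, partialSum g (Real.exp u) ≤ c * (Real.exp u * u ^ (δ - 1)))
    (hM : ∀ᶠ u in atTop, partialSum (fun n => g n / n) (Real.exp u) ≤ c * u ^ δ) :
    ∃ (τ : ℕ → ℝ) (c' : ℝ), Tendsto τ atTop (𝓝 0) ∧ ∀ᶠ u in atTop, ∀ j : ℕ,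
      ∑ n ∈ Finset.Ioc 0 ⌊Real.exp u⌋₊ with (j : ℝ) ≤ u - Real.log (n : ℕ),
        g n * ((Real.exp u / n) * (1 + (u - Real.log n)) ^ (-(1 + ρ)))
      ≤ (τ j + c' * u ^ (-ρ)) * (Real.exp u * u ^ (δ - 1)) := by
  obtain ⟨u0, hu0⟩ := eventually_atTop.1 hG
  have hsum : Summable fun i : ℕ => (1 + (i : ℝ)) ^ (-(1 + ρ)) := by
    have h := (summable_nat_add_iff 1).2 (Real.summable_nat_rpow.2 (show -(1 + ρ) < -1 by linarith))
    refine h.congr fun i => ?_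
    push_cast
    rw [add_comm]
  set a : ℕ → ℝ := fun i => (1 + (i : ℝ)) ^ (-(1 + ρ)) with hadef
  have ha0 : ∀ i, 0 ≤ a i := fun i => by positivity
  set c1 := Real.exp 1 * (|c| * 2 ^ |δ - 1|) with hc1
  have hc1' : 0 ≤ c1 := by positivity
  refine ⟨fun j => c1 * (∑' i, a i - ∑ i ∈ Finset.range j, a i), |c| * 2 ^ (1 + ρ), ?_, ?_⟩
  · have := (hsum.hasSum.tendsto_sum_nat.const_sub (∑' i, a i)).const_mul c1
    simpa using this
  filter_upwards [hM, eventually_ge_atTop (2 * u0), eventually_gt_atTop 0] with u hMu hu1 hu2 j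
  set x := Real.exp u with hx
  have hx0 : 0 < x := Real.exp_pos _
  set t : ℕ → ℝ := fun n => g n * ((x / n) * (1 + (u - Real.log n)) ^ (-(1 + ρ)))
  set F := Finset.Ioc 0 ⌊x⌋₊ with hF
  have hFmem : ∀ n ∈ F, (1 : ℝ) ≤ n ∧ Real.log n ≤ u := by
    intro n hn
    obtain ⟨h1, h2⟩ := mem_Ioc_floor hn
    exact ⟨h1, (Real.log_le_iff_le_exp (by linarith)).2 h2⟩
  have ht0 : ∀ n ∈ F, 0 ≤ t n := by
    intro n hn
    obtain ⟨h1, h2⟩ := hFmem n hn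
    exact mul_nonneg (hg0 n) (mul_nonneg (by positivity) (Real.rpow_nonneg (by linarith) _))
  -- The block `i ≤ log (x / n) < i + 1`, for `i ≤ u / 2`, contributes `≪ (1 + i)^{-1-ρ}` in
  -- units of `x u^{δ - 1}`.
  set N := ⌊u / 2⌋₊ with hN
  have hblock : ∀ i ∈ Finset.Ico j (N + 1),
      ∑ n ∈ F with ⌊u - Real.log (n : ℕ)⌋₊ = i, t n ≤ c1 * a i * (x * u ^ (δ - 1)) := by
    intro i hi
    have hi2 : (i : ℝ) ≤ u / 2 := by
      have : i ≤ N := by have := (Finset.mem_Ico.1 hi).2; omega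
      exact (Nat.le_floor_iff (by positivity)).1 this
    have hiu : u0 ≤ u - i := by linarith
    have hGi := hu0 _ hiu
    have hterm : ∀ n ∈ F.filter (fun n : ℕ => ⌊u - Real.log n⌋₊ = i),
        t n ≤ g n * (Real.exp (i + 1) * a i) := by
      intro n hn
      rw [Finset.mem_filter] at hn
      obtain ⟨h1, h2⟩ := hFmem n hn.1
      have h3 := (Nat.floor_eq_iff (by linarith)).1 hn.2
      have hn0 : (0 : ℝ) < n := by linarith
      have h4 : x / n ≤ Real.exp (i + 1) := by
        rw [← Real.log_le_iff_le_exp (by positivity), Real.log_div hx0.ne' hn0.ne', hx,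
          Real.log_exp]
        exact h3.2.le
      refine mul_le_mul_of_nonneg_left ?_ (hg0 n)
      have h5 : (1 + (u - Real.log n)) ^ (-(1 + ρ)) ≤ a i :=
        Real.rpow_le_rpow_of_nonpos (by positivity) (by linarith [h3.1]) (by linarith)
      exact mul_le_mul h4 h5 (Real.rpow_nonneg (by linarith) _) (Real.exp_pos _).le
    have hGsum : ∑ n ∈ F with ⌊u - Real.log (n : ℕ)⌋₊ = i, g n ≤ partialSum g (Real.exp (u - i)) := by
      refine Finset.sum_le_sum_of_subset_of_nonneg ?_ fun n _ _ => hg0 n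
      intro n hn
      rw [Finset.mem_filter] at hn
      obtain ⟨h1, h2⟩ := hFmem n hn.1
      have h3 := (Nat.floor_eq_iff (by linarith)).1 hn.2
      rw [mem_Ioc_floor_iff]
      refine ⟨(Finset.mem_Ioc.1 hn.1).1, ?_⟩
      rw [← Real.log_le_iff_le_exp (by linarith)]
      linarith [h3.1]
    have hpow : (u - i) ^ (δ - 1) ≤ 2 ^ |δ - 1| * u ^ (δ - 1) := by
      have hv : u / 2 ≤ u - i := by linarith
      rcases le_total 0 (δ - 1) with h | h
      · calc (u - i) ^ (δ - 1) ≤ u ^ (δ - 1) :=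
              Real.rpow_le_rpow (by linarith) (by linarith [(i : ℕ).cast_nonneg (α := ℝ)]) h
          _ = 1 * u ^ (δ - 1) := (one_mul _).symm
          _ ≤ _ := by
            gcongr
            exact Real.one_le_rpow (by norm_num) (abs_nonneg _)
      · calc (u - i) ^ (δ - 1) ≤ (u / 2) ^ (δ - 1) :=
              Real.rpow_le_rpow_of_nonpos (by positivity) hv h
          _ = 2 ^ |δ - 1| * u ^ (δ - 1) := by
            rw [Real.div_rpow hu2.le (by norm_num), abs_of_nonpos h, Real.rpow_neg (by norm_num)]
            field_simp
    calc ∑ n ∈ F with ⌊u - Real.log (n : ℕ)⌋₊ = i, t n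
        ≤ ∑ n ∈ F with ⌊u - Real.log (n : ℕ)⌋₊ = i, g n * (Real.exp (i + 1) * a i) :=
          Finset.sum_le_sum hterm
      _ = (∑ n ∈ F with ⌊u - Real.log (n : ℕ)⌋₊ = i, g n) * (Real.exp (i + 1) * a i) :=
          (Finset.sum_mul _ _ _).symm
      _ ≤ (|c| * (Real.exp (u - i) * (2 ^ |δ - 1| * u ^ (δ - 1)))) * (Real.exp (i + 1) * a i) := by
          refine mul_le_mul_of_nonneg_right ?_ (mul_nonneg (Real.exp_pos _).le (ha0 i))
          refine hGsum.trans (hGi.trans ?_)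
          have hiu' : 0 ≤ u - i := by linarith
          exact mul_le_mul (le_abs_self c) (by gcongr) (by positivity) (abs_nonneg c)
      _ = c1 * a i * (x * u ^ (δ - 1)) := by
          have : Real.exp (u - i) * Real.exp (i + 1) = Real.exp 1 * x := by
            rw [hx, ← Real.exp_add, ← Real.exp_add]
            congr 1
            ring
          rw [hc1]
          linear_combination (|c| * (2 ^ |δ - 1| * u ^ (δ - 1))) * a i * this
  -- For `n < √x` the factor `(1 + log (x / n))^{-1-ρ}` is already `≪ u^{-1-ρ}`.
  have hsmall : ∑ n ∈ F with u / 2 < u - Real.log (n : ℕ), t n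
      ≤ |c| * 2 ^ (1 + ρ) * u ^ (-ρ) * (x * u ^ (δ - 1)) := by
    have hterm : ∀ n ∈ F.filter (fun n : ℕ => u / 2 < u - Real.log n),
        t n ≤ x * (u / 2) ^ (-(1 + ρ)) * (g n / n) := by
      intro n hn
      rw [Finset.mem_filter] at hn
      obtain ⟨h1, h2⟩ := hFmem n hn.1
      have h5 : (1 + (u - Real.log n)) ^ (-(1 + ρ)) ≤ (u / 2) ^ (-(1 + ρ)) :=
        Real.rpow_le_rpow_of_nonpos (by positivity) (by linarith [hn.2]) (by linarith)
      calc t n ≤ g n * (x / n * (u / 2) ^ (-(1 + ρ))) :=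
            mul_le_mul_of_nonneg_left (mul_le_mul_of_nonneg_left h5 (by positivity)) (hg0 n)
        _ = _ := by ring
    calc ∑ n ∈ F with u / 2 < u - Real.log (n : ℕ), t n
        ≤ ∑ n ∈ F with u / 2 < u - Real.log (n : ℕ), x * (u / 2) ^ (-(1 + ρ)) * (g n / n) :=
          Finset.sum_le_sum hterm
      _ ≤ ∑ n ∈ F, x * (u / 2) ^ (-(1 + ρ)) * (g n / n) := by
          refine Finset.sum_le_sum_of_subset_of_nonneg (Finset.filter_subset _ _) fun n _ _ => ?_
          have := hg0 n
          positivity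
      _ = x * (u / 2) ^ (-(1 + ρ)) * partialSum (fun n => g n / n) x := by
          rw [partialSum, Finset.mul_sum]
      _ ≤ x * (u / 2) ^ (-(1 + ρ)) * (|c| * u ^ δ) := by
          gcongr
          refine hMu.trans ?_
          gcongr
          exact le_abs_self c
      _ = |c| * 2 ^ (1 + ρ) * u ^ (-ρ) * (x * u ^ (δ - 1)) := by
          rw [Real.div_rpow hu2.le (by norm_num), Real.rpow_neg (by norm_num : (0 : ℝ) ≤ 2),
            div_inv_eq_mul]
          have : u ^ (-(1 + ρ)) * u ^ δ = u ^ (-ρ) * u ^ (δ - 1) := by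
            rw [← Real.rpow_add hu2, ← Real.rpow_add hu2]
            congr 1
            ring
          linear_combination x * 2 ^ (1 + ρ) * |c| * this
  have hsplit : ∑ n ∈ F with (j : ℝ) ≤ u - Real.log (n : ℕ), t n
      ≤ (∑ i ∈ Finset.Ico j (N + 1), ∑ n ∈ F with ⌊u - Real.log (n : ℕ)⌋₊ = i, t n)
        + ∑ n ∈ F with u / 2 < u - Real.log (n : ℕ), t n := by
    rw [← Finset.sum_filter_add_sum_filter_not (F.filter fun n : ℕ => (j : ℝ) ≤ u - Real.log n)
      (fun n : ℕ => u - Real.log n ≤ u / 2)]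
    refine add_le_add ?_ ?_
    · have hmaps : ∀ n ∈ (F.filter fun n : ℕ => (j : ℝ) ≤ u - Real.log n).filter
          (fun n : ℕ => u - Real.log n ≤ u / 2), ⌊u - Real.log n⌋₊ ∈ Finset.Ico j (N + 1) := by
        intro n hn
        rw [Finset.mem_filter, Finset.mem_filter] at hn
        rw [Finset.mem_Ico]
        exact ⟨Nat.le_floor hn.1.2, Nat.lt_succ_of_le (Nat.floor_le_floor hn.2)⟩
      rw [← Finset.sum_fiberwise_of_maps_to hmaps]
      refine Finset.sum_le_sum fun i _ => ?_
      refine Finset.sum_le_sum_of_subset_of_nonneg ?_ fun n hn _ => ht0 n (Finset.mem_filter.1 hn).1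
      intro n hn
      simp only [Finset.mem_filter] at hn ⊢
      exact ⟨hn.1.1.1, hn.2⟩
    · refine Finset.sum_le_sum_of_subset_of_nonneg ?_ fun n hn _ => ht0 n (Finset.mem_filter.1 hn).1
      intro n hn
      simp only [Finset.mem_filter, not_le] at hn ⊢
      exact ⟨hn.1.1, hn.2⟩
  refine hsplit.trans ?_
  rw [add_mul]
  refine add_le_add ?_ hsmall
  refine (Finset.sum_le_sum hblock).trans ?_
  rw [← Finset.sum_mul, ← Finset.mul_sum]
  gcongr
  rcases le_total j (N + 1) with h | h
  · rw [Finset.sum_Ico_eq_sub _ h]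
    have := hsum.sum_le_tsum (Finset.range (N + 1)) fun i _ => ha0 i
    linarith
  · rw [Finset.Ico_eq_empty_of_le h, Finset.sum_empty]
    have := hsum.sum_le_tsum (Finset.range j) fun i _ => ha0 i
    linarith

end

end MultiplicativeSets


namespace MultiplicativeSets

open Filter Topology

section

variable {g L : ArithmeticFunction ℝ} {δ A B K ρ : ℝ}

lemma tendsto_of_tendsto_mul_sub {f : ℝ → ℝ} {a b : ℝ}
    (h : Tendsto (fun u => u * (f u - a)) atTop (𝓝 b)) : Tendsto f atTop (𝓝 a) := by
  have h1 := (h.div_atTop tendsto_id).add_const a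
  rw [zero_add] at h1
  refine h1.congr' ?_
  filter_upwards [eventually_gt_atTop 0] with u hu
  simp only [id]
  field_simp
  ring

/-- Short intervals: `M(e^u) - M(e^{u-s}) ~ A δ s u^{δ-1}`. The second-order term of `M` is needed
here only to the extent that it is the same at `u` and at `u - s`. -/
lemma tendsto_sub_div_rpow_sub_one {M : ℝ → ℝ} {b : ℝ}
    (hM : Tendsto (fun u => u * (M u / u ^ δ - A)) atTop (𝓝 b)) (s : ℝ) :
    Tendsto (fun u => (M u - M (u - s)) / u ^ (δ - 1)) atTop (𝓝 (A * (δ * s))) := by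
  have h1 : Tendsto (fun u : ℝ => u - s) atTop atTop := tendsto_atTop_add_const_right _ _ tendsto_id
  have h2 := (((tendsto_mul_sub_div_rpow_sub_one s δ).const_mul (-A)).add hM).sub
    ((tendsto_sub_div_rpow s (δ - 1)).mul (hM.comp h1))
  have e : -A * -(δ * s) + b - 1 * b = A * (δ * s) := by ring
  rw [e] at h2
  refine h2.congr' ?_
  filter_upwards [eventually_gt_atTop 0, eventually_gt_atTop s] with u hu hus
  have h3 : 0 < u - s := by linarith
  have h4 := (Real.rpow_pos_of_pos h3 δ).ne'
  have h5 := (Real.rpow_pos_of_pos hu δ).ne'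
  simp only [Function.comp]
  rw [Real.div_rpow h3.le hu.le, Real.div_rpow h3.le hu.le, Real.rpow_sub_one h3.ne',
    Real.rpow_sub_one hu.ne']
  field_simp
  ring

/-- The terms `n` close to `x` in `∑ g(n) ψ(x / n)`, with the order of summation reversed. -/
lemma sum_mul_partialSum_eq (g L : ℕ → ℝ) (u : ℝ) (j : ℕ) :
    ∑ n ∈ Finset.Ioc ⌊Real.exp (u - j)⌋₊ ⌊Real.exp u⌋₊, g n * partialSum L (Real.exp u / n)
      = ∑ k ∈ Finset.Ioc 0 ⌊Real.exp j⌋₊, L k *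
        (partialSum g (Real.exp (u - Real.log k)) - partialSum g (Real.exp (u - j))) := by
  have hin : ∀ k ∈ Finset.Ioc 0 ⌊Real.exp j⌋₊,
      partialSum g (Real.exp (u - Real.log k)) - partialSum g (Real.exp (u - j))
        = ∑ n ∈ Finset.Ioc ⌊Real.exp (u - j)⌋₊ ⌊Real.exp (u - Real.log k)⌋₊, g n := by
    intro k hk
    obtain ⟨h1, h2⟩ := mem_Ioc_floor hk
    have h3 : Real.exp (u - j) ≤ Real.exp (u - Real.log k) := by
      rw [Real.exp_le_exp]
      have := (Real.log_le_iff_le_exp (by linarith)).2 h2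
      linarith
    rw [sub_eq_iff_eq_add', partialSum, partialSum,
      Finset.sum_Ioc_consecutive _ (Nat.zero_le _) (Nat.floor_le_floor h3)]
  refine Eq.trans ?_ (Finset.sum_congr rfl fun k hk => by rw [hin k hk]).symm
  simp only [partialSum, Finset.mul_sum]
  rw [Finset.sum_comm' (t' := Finset.Ioc 0 ⌊Real.exp j⌋₊)
    (s' := fun k => Finset.Ioc ⌊Real.exp (u - j)⌋₊ ⌊Real.exp (u - Real.log k)⌋₊)]
  · exact Finset.sum_congr rfl fun k _ => Finset.sum_congr rfl fun n _ => mul_comm _ _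
  · intro n k
    simp only [Finset.mem_Ioc, Nat.floor_lt (Real.exp_pos _).le,
      Nat.le_floor_iff (Real.exp_pos _).le]
    constructor
    · rintro ⟨⟨h1, h2⟩, h3, h4⟩
      have hn : (0 : ℝ) < n := (Real.exp_pos _).trans h1
      have hk : (0 : ℝ) < k := by exact_mod_cast h3
      rw [Nat.le_floor_iff (by positivity), le_div_iff₀ hn] at h4
      refine ⟨⟨h1, ?_⟩, h3, ?_⟩
      · rw [Real.exp_sub, Real.exp_log hk, le_div_iff₀ hk]
        linarith
      · rw [Real.exp_sub, div_lt_iff₀ (Real.exp_pos _)] at h1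
        have : (k : ℝ) * n < Real.exp j * n := by linarith
        exact (lt_of_mul_lt_mul_right this hn.le).le
    · rintro ⟨⟨h1, h2⟩, h3, h4⟩
      have hn : (0 : ℝ) < n := (Real.exp_pos _).trans h1
      have hk : (1 : ℝ) ≤ k := by exact_mod_cast h3
      rw [Real.exp_sub, Real.exp_log (by linarith), le_div_iff₀ (by linarith)] at h2
      refine ⟨⟨h1, ?_⟩, h3, ?_⟩
      · nlinarith
      · rw [Nat.le_floor_iff (by positivity), le_div_iff₀ hn]
        linarith

/-- The sum `G(x) = ∑_{n ≤ x} g(n)` to second order, from `M(x) = ∑_{n ≤ x} g(n) / n` and the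
identity `G(x) log x = δ x M(x) + ∑ g(n) E(x / n) + ∑ g(n) log (x / n)`, where
`E(y) = ∑_{n ≤ y} L(n) - δ y`. The last two sums are both of the order of `x log^{δ-1} x`. -/
theorem tendsto_partialSum_secondOrder (hg0 : ∀ n, 0 ≤ g n)
    (hconv : ∀ n : ℕ, g n * Real.log n = (g * L) n) (hδ : 0 < δ) (hρ : 0 < ρ)
    (hE : ∀ y, 1 ≤ y → |partialSum L y - δ * y| ≤ K * (y * (1 + Real.log y) ^ (-(1 + ρ))))
    (hm : Tendsto (fun x => partialSum (fun n => L n / n) x - δ * Real.log x) atTop (𝓝 B))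
    (hA : 0 < A)
    (hM : Tendsto (fun u => u * (partialSum (fun n => g n / n) (Real.exp u) / u ^ δ - A))
      atTop (𝓝 (-(δ * B * A)))) :
    Tendsto (fun u => u * (partialSum g (Real.exp u) / (Real.exp u * u ^ (δ - 1)) - δ * A))
      atTop (𝓝 (δ * A * ((1 - δ) * (1 + B)))) := by
  have hK : 0 ≤ K := by
    have := (abs_nonneg _).trans (hE 1 le_rfl)
    simpa using this
  have hψ : ∀ y, 1 ≤ y → partialSum L y ≤ (δ + K) * y := by
    intro y hy
    have h1 := (le_abs_self _).trans (hE y hy)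
    have h2 : (1 + Real.log y) ^ (-(1 + ρ)) ≤ 1 :=
      Real.rpow_le_one_of_one_le_of_nonpos (by linarith [Real.log_nonneg hy]) (by linarith)
    have h3 : K * (y * (1 + Real.log y) ^ (-(1 + ρ))) ≤ K * (y * 1) := by gcongr
    linarith
  set M : ℝ → ℝ := fun u => partialSum (fun n => g n / n) (Real.exp u) with hMdef
  set G : ℝ → ℝ := fun u => partialSum g (Real.exp u) with hGdef
  set N : ℝ → ℝ := fun u => Real.exp u * u ^ (δ - 1) with hNdef
  have hNpos : ∀ u, 0 < u → 0 < N u := fun u hu => by positivity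
  have hMlim : Tendsto (fun u => M u / u ^ δ) atTop (𝓝 A) := tendsto_of_tendsto_mul_sub hM
  have hM2 : ∀ᶠ u in atTop, M u ≤ 2 * A * u ^ δ := by
    filter_upwards [hMlim.eventually_lt_const (show A < 2 * A by linarith),
      eventually_gt_atTop 0] with u hu hu0
    rw [div_lt_iff₀ (by positivity)] at hu
    exact hu.le
  -- A common constant for the upper bounds `G ≪ N` and `M ≪ u^δ`.
  set c := (δ + K + 1) * (2 * A) + 2 * A
  have hcA : 2 * A ≤ c := by
    have : 0 ≤ (δ + K + 1) * (2 * A) := by positivity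
    linarith
  have hG2 : ∀ᶠ u in atTop, G u ≤ c * N u := by
    filter_upwards [hM2, eventually_gt_atTop 0] with u hu hu0
    have h1 := partialSum_mul_log_le hg0 hconv hψ (x := Real.exp u) (by simpa using hu0.le)
    rw [Real.log_exp] at h1
    have h2 : G u * u ≤ (δ + K + 1) * (2 * A) * N u * u := by
      calc G u * u ≤ (δ + K + 1) * Real.exp u * M u := h1
        _ ≤ (δ + K + 1) * Real.exp u * (2 * A * u ^ δ) := by gcongr
        _ = (δ + K + 1) * (2 * A) * N u * u := by
          rw [hNdef]
          simp only [Real.rpow_sub_one hu0.ne']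
          field_simp
    have h3 := le_of_mul_le_mul_right h2 hu0
    refine h3.trans ?_
    have := hNpos u hu0
    gcongr
    linarith
  have hM3 : ∀ᶠ u in atTop, M u ≤ c * u ^ δ := by
    filter_upwards [hM2, eventually_gt_atTop 0] with u hu hu0
    exact hu.trans (by gcongr)
  set E : ℝ → ℝ := fun y => partialSum L y - δ * y with hEdef
  obtain ⟨τ, c', hτ, htail⟩ := exists_tail_bound hρ hg0 hG2 hM3
  -- `X` is the normalised sum of `g(n) E(x / n)`, and `Y j` its part with `n > e^{-j} x`.
  set X : ℝ → ℝ := fun u =>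
    (∑ n ∈ Finset.Ioc 0 ⌊Real.exp u⌋₊, g n * E (Real.exp u / n)) / N u with hXdef
  set Y : ℕ → ℝ → ℝ := fun j u =>
    (∑ n ∈ Finset.Ioc 0 ⌊Real.exp u⌋₊ with ¬ (j : ℝ) ≤ u - Real.log (n : ℕ),
      g n * E (Real.exp u / n)) / N u with hYdef
  have hXY : ∀ᶠ u in atTop, ∀ j, |X u - Y j u| ≤ K * τ j + K * (c' * u ^ (-ρ)) := by
    filter_upwards [htail, eventually_gt_atTop 0] with u hu hu0 j
    have hN := hNpos u hu0
    have h1 : X u - Y j u = (∑ n ∈ Finset.Ioc 0 ⌊Real.exp u⌋₊ with (j : ℝ) ≤ u - Real.log (n : ℕ),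
        g n * E (Real.exp u / n)) / N u := by
      rw [hXdef, hYdef]
      simp only
      rw [← sub_div, ← Finset.sum_filter_add_sum_filter_not (Finset.Ioc 0 ⌊Real.exp u⌋₊)
        (fun n : ℕ => (j : ℝ) ≤ u - Real.log n)]
      ring
    rw [h1, abs_div, abs_of_pos hN, div_le_iff₀ hN]
    calc _ ≤ ∑ n ∈ Finset.Ioc 0 ⌊Real.exp u⌋₊ with (j : ℝ) ≤ u - Real.log (n : ℕ),
          |g n * E (Real.exp u / n)| := Finset.abs_sum_le_sum_abs _ _
      _ ≤ ∑ n ∈ Finset.Ioc 0 ⌊Real.exp u⌋₊ with (j : ℝ) ≤ u - Real.log (n : ℕ),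
          K * (g n * ((Real.exp u / n) * (1 + (u - Real.log n)) ^ (-(1 + ρ)))) := by
        refine Finset.sum_le_sum fun n hn => ?_
        obtain ⟨h2, h3⟩ := mem_Ioc_floor (Finset.mem_filter.1 hn).1
        have h4 := hE (Real.exp u / n) ((one_le_div (by linarith)).2 h3)
        rw [Real.log_div (Real.exp_ne_zero _) (by linarith), Real.log_exp] at h4
        rw [abs_mul, abs_of_nonneg (hg0 n)]
        calc g n * |E (Real.exp u / n)| ≤ g n * _ := mul_le_mul_of_nonneg_left h4 (hg0 n)
          _ = _ := by ring
      _ ≤ K * ((τ j + c' * u ^ (-ρ)) * N u) := by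
        rw [← Finset.mul_sum]
        exact mul_le_mul_of_nonneg_left (hu j) hK
      _ = _ := by ring
  have hσ : Tendsto (fun u : ℝ => K * (c' * u ^ (-ρ))) atTop (𝓝 0) := by
    have := ((tendsto_rpow_neg_atTop hρ).const_mul c').const_mul K
    simpa using this
  have hY0 : ∀ u, 0 ≤ u → Y 0 u = 0 := by
    intro u hu
    rw [hYdef]
    simp only
    rw [Finset.filter_false_of_mem, Finset.sum_empty, zero_div]
    intro n hn
    obtain ⟨h2, h3⟩ := mem_Ioc_floor hn
    have := (Real.log_le_iff_le_exp (by linarith)).2 h3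
    rw [not_not, Nat.cast_zero]
    linarith
  have hXb : ∀ᶠ u in atTop, |X u| ≤ K * τ 0 + 1 := by
    filter_upwards [hXY, hσ.eventually_lt_const one_pos, eventually_ge_atTop 0] with u h1 h2 h3
    have := h1 0
    rw [hY0 u h3, sub_zero] at this
    linarith
  -- `R(log x) = ∑_{n ≤ x} g(n) log (x / n)` has right derivative `G`.
  set R : ℝ → ℝ := smoothedSum g id with hRdef
  have hRc : Continuous R := continuous_smoothedSum _ continuous_id
  have hR' : ∀ u, HasDerivWithinAt R (G u) (Set.Ici u) u := fun u => by
    simpa using hasDerivWithinAt_smoothedSum g (hasDerivAt_id u)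
  have hRb : ∀ᶠ u in atTop, |R u| ≤ 3 * c * N u := by
    refine eventually_abs_le_of_rightDeriv_le (a := 0) (by positivity) hRc.continuousOn
      (fun x _ => hR' x) ?_
    filter_upwards [hG2] with u hu
    rwa [abs_of_nonneg (partialSum_nonneg hg0 _)]
  have hid : ∀ u, 0 < u → u * G u = δ * Real.exp u * M u + X u * N u + R u := by
    intro u hu
    have h1 : X u * N u = ∑ n ∈ Finset.Ioc 0 ⌊Real.exp u⌋₊, g n * E (Real.exp u / n) :=
      div_mul_cancel₀ _ (hNpos u hu).ne'
    have h2 : R u = u * G u - partialSum (fun n => (g * L) n) (Real.exp u) := by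
      rw [hRdef, smoothedSum_eq]
      simp only [id, ← hconv]
      rfl
    have h3 : partialSum (fun n => (g * L) n) (Real.exp u) = δ * Real.exp u * M u + X u * N u := by
      have hMsum : M u = ∑ n ∈ Finset.Ioc 0 ⌊Real.exp u⌋₊, g n / n := rfl
      rw [partialSum_mul, h1, hMsum, Finset.mul_sum, ← Finset.sum_add_distrib]
      refine Finset.sum_congr rfl fun n _ => ?_
      simp only [hEdef]
      ring
    linarith
  have hGid : ∀ u, 0 < u → G u / N u = δ * (M u / u ^ δ) + (X u + R u / N u) / u := by
    intro u hu
    have h1 := hid u hu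
    have hN := hNpos u hu
    have h2 : N u * u = Real.exp u * u ^ δ := by
      rw [hNdef]
      simp only [Real.rpow_sub_one hu.ne']
      field_simp
    have h3 : G u = (δ * Real.exp u * M u + X u * N u + R u) / u := by
      rw [← h1]; field_simp
    have h4 : M u / u ^ δ = Real.exp u * M u / (N u * u) := by
      rw [h2, mul_div_mul_left _ _ (Real.exp_ne_zero u)]
    rw [h3, h4]
    field_simp
    ring
  -- The first-order asymptotics of `G`, which feeds the evaluation of the secondary terms.
  have hGlim : Tendsto (fun u => G u / N u) atTop (𝓝 (δ * A)) := by
    have h0 : Tendsto (fun u => (X u + R u / N u) / u) atTop (𝓝 0) := by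
      have h1 : Tendsto (fun u : ℝ => (K * τ 0 + 1 + 3 * c) / u) atTop (𝓝 0) :=
        tendsto_const_nhds.div_atTop tendsto_id
      refine squeeze_zero_norm' ?_ h1
      filter_upwards [hXb, hRb, eventually_gt_atTop 0] with u h2 h3 h4
      have hN := hNpos u h4
      rw [Real.norm_eq_abs, abs_div, abs_of_pos h4]
      gcongr
      refine (abs_add_le _ _).trans (add_le_add h2 ?_)
      rwa [abs_div, abs_of_pos hN, div_le_iff₀ hN]
    have h1 := (hMlim.const_mul δ).add h0
    rw [add_zero] at h1
    refine h1.congr' ?_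
    filter_upwards [eventually_gt_atTop 0] with u hu
    rw [hGid u hu]
  have hRlim : Tendsto (fun u => R u / N u) atTop (𝓝 (δ * A)) :=
    tendsto_div_of_rightDeriv (a := 0) hRc.continuousOn (fun x _ => hR' x) hGlim
  -- For fixed `j`, reversing the summation turns `Y j` into a finite combination of shifts of `G`
  -- and `M`, whose limits are known.
  have hYlim : ∀ j : ℕ, Tendsto (Y j) atTop
      (𝓝 (∑ k ∈ Finset.Ioc 0 ⌊Real.exp j⌋₊,
        L k * (δ * A * Real.exp (-Real.log k) - δ * A * Real.exp (-(j : ℝ)))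
        - δ * (A * (δ * j)))) := by
    intro j
    have hsh := fun s => tendsto_div_exp_mul_rpow_shift hGlim s
    have h1 := (tendsto_finsetSum (Finset.Ioc 0 ⌊Real.exp (j : ℝ)⌋₊) fun k _ =>
      ((hsh (Real.log k)).sub (hsh j)).const_mul (L k)).sub
      ((tendsto_sub_div_rpow_sub_one hM (j : ℝ)).const_mul δ)
    refine h1.congr' ?_
    filter_upwards [eventually_gt_atTop 0] with u hu
    have hfil : (Finset.Ioc 0 ⌊Real.exp u⌋₊).filter (fun n : ℕ => ¬ (j : ℝ) ≤ u - Real.log n)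
        = Finset.Ioc ⌊Real.exp (u - j)⌋₊ ⌊Real.exp u⌋₊ := by
      ext n
      rw [Finset.mem_filter, Finset.mem_Ioc, Finset.mem_Ioc, Nat.floor_lt (Real.exp_pos _).le]
      constructor
      · rintro ⟨⟨h2, h3⟩, h4⟩
        refine ⟨?_, h3⟩
        rw [← Real.lt_log_iff_exp_lt (by exact_mod_cast h2)]
        linarith
      · rintro ⟨h2, h3⟩
        have h4 : (0 : ℝ) < n := (Real.exp_pos _).trans h2
        refine ⟨⟨by exact_mod_cast h4, h3⟩, ?_⟩
        rw [← Real.lt_log_iff_exp_lt h4] at h2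
        linarith
    have hMd : M u - M (u - j) = ∑ n ∈ Finset.Ioc ⌊Real.exp (u - j)⌋₊ ⌊Real.exp u⌋₊, g n / n := by
      rw [sub_eq_iff_eq_add', hMdef]
      simp only [partialSum]
      rw [Finset.sum_Ioc_consecutive _ (Nat.zero_le _)
        (Nat.floor_le_floor (Real.exp_le_exp.2 (by linarith [j.cast_nonneg (α := ℝ)])))]
    have hN := hNpos u hu
    have hY1 : Y j u = (∑ n ∈ Finset.Ioc ⌊Real.exp (u - j)⌋₊ ⌊Real.exp u⌋₊,
        g n * partialSum L (Real.exp u / n) - δ * Real.exp u * (M u - M (u - j))) / N u := by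
      rw [hYdef]
      simp only
      rw [hfil, hMd, Finset.mul_sum, ← Finset.sum_sub_distrib]
      congr 1
      refine Finset.sum_congr rfl fun n _ => ?_
      simp only [hEdef]
      ring
    rw [hY1, sum_mul_partialSum_eq]
    refine Eq.trans ?_ (sub_div _ _ _).symm
    rw [Finset.sum_div]
    congr 1
    · refine Finset.sum_congr rfl fun k _ => ?_
      rw [← sub_div, mul_div_assoc]
    · rw [hNdef]
      have := Real.exp_ne_zero u
      field_simp
      rfl
  have hLlim : Tendsto (fun j : ℕ => ∑ k ∈ Finset.Ioc 0 ⌊Real.exp j⌋₊,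
        L k * (δ * A * Real.exp (-Real.log k) - δ * A * Real.exp (-(j : ℝ)))
        - δ * (A * (δ * j))) atTop (𝓝 (δ * A * (B - δ))) := by
    have hj : Tendsto (fun j : ℕ => Real.exp (j : ℝ)) atTop atTop :=
      Real.tendsto_exp_atTop.comp tendsto_natCast_atTop_atTop
    have h1 : Tendsto (fun y => partialSum L y / y) atTop (𝓝 δ) := by
      rw [tendsto_iff_norm_sub_tendsto_zero]
      have h2 : Tendsto (fun y => K * (1 + Real.log y) ^ (-(1 + ρ))) atTop (𝓝 0) := by
        have := ((tendsto_rpow_neg_atTop (show 0 < 1 + ρ by linarith)).comp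
          (tendsto_atTop_add_const_left _ 1 Real.tendsto_log_atTop)).const_mul K
        simpa [Function.comp_def] using this
      refine squeeze_zero' (Eventually.of_forall fun _ => norm_nonneg _) ?_ h2
      filter_upwards [eventually_ge_atTop 1] with y hy
      have hy0 : 0 < y := by linarith
      have e1 : partialSum L y / y - δ = (partialSum L y - δ * y) / y := by field_simp
      rw [e1, Real.norm_eq_abs, abs_div, abs_of_pos hy0, div_le_iff₀ hy0]
      calc _ ≤ _ := hE y hy
        _ = _ := by ring
    have h3 := (((hm.comp hj).sub (h1.comp hj))).const_mul (δ * A)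
    refine h3.congr fun j => ?_
    simp only [Function.comp, Real.log_exp, mul_sub, Finset.sum_sub_distrib]
    rw [← Finset.sum_mul]
    have e1 : ∑ k ∈ Finset.Ioc 0 ⌊Real.exp (j : ℝ)⌋₊, L k * (δ * A * Real.exp (-Real.log k))
        = δ * A * partialSum (fun n => L n / n) (Real.exp j) := by
      rw [partialSum, Finset.mul_sum]
      refine Finset.sum_congr rfl fun k hk => ?_
      have := (mem_Ioc_floor hk).1
      rw [Real.exp_neg, Real.exp_log (by linarith)]
      ring
    rw [e1, Real.exp_neg]
    simp only [partialSum]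
    ring
  -- The tail estimate allows the limits in `j` and in `u` to be interchanged.
  have hXlim : Tendsto X atTop (𝓝 (δ * A * (B - δ))) :=
    tendsto_of_approx hYlim hLlim (by simpa using hτ.const_mul K) hσ
      fun j => by filter_upwards [hXY] with u hu using hu j
  have hfin := ((hM.const_mul δ).add hXlim).add hRlim
  have e : δ * -(δ * B * A) + δ * A * (B - δ) + δ * A = δ * A * ((1 - δ) * (1 + B)) := by ring
  rw [e] at hfin
  refine hfin.congr' ?_
  filter_upwards [eventually_gt_atTop 0] with u hu
  change _ = u * (G u / N u - δ * A)
  rw [hGid u hu]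
  field_simp
  ring

end

end MultiplicativeSets

/-! ### Convolution with a sparse factor -/

namespace MultiplicativeSets

open Filter Topology

lemma rpow_le_two_rpow_abs {w : ℝ} (hw : 1 / 2 ≤ w) (hw1 : w ≤ 1) (κ : ℝ) :
    w ^ κ ≤ 2 ^ |κ| := by
  rcases le_total 0 κ with h | h
  · exact (Real.rpow_le_one (by linarith) hw1 h).trans
      (Real.one_le_rpow (by norm_num) (abs_nonneg _))
  · calc w ^ κ ≤ (1 / 2) ^ κ := Real.rpow_le_rpow_of_nonpos (by norm_num) hw h
      _ = 2 ^ |κ| := by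
        rw [abs_of_nonpos h, Real.rpow_neg (by norm_num), Real.div_rpow (by norm_num)
          (by norm_num), Real.one_rpow, one_div]

lemma abs_rpow_sub_one_le {w : ℝ} (hw : 1 / 2 ≤ w) (hw1 : w ≤ 1) (κ : ℝ) :
    |w ^ κ - 1| ≤ |κ| * 2 ^ |κ - 1| * (1 - w) := by
  have h := (convex_Icc (1 / 2 : ℝ) 1).norm_image_sub_le_of_norm_hasDerivWithin_le
    (f := fun t => t ^ κ) (f' := fun t => κ * t ^ (κ - 1)) (C := |κ| * 2 ^ |κ - 1|)
    (x := 1) (y := w)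
    (fun t ht => (Real.hasDerivAt_rpow_const (Or.inl (by linarith [ht.1]))).hasDerivWithinAt)
    (fun t ht => by
      have h1 : 0 ≤ t := by linarith [ht.1]
      rw [norm_mul, Real.norm_eq_abs, Real.norm_eq_abs, abs_of_nonneg (Real.rpow_nonneg h1 _)]
      gcongr
      exact rpow_le_two_rpow_abs ht.1 ht.2 _)
    ⟨by norm_num, le_rfl⟩ ⟨hw, hw1⟩
  rw [Real.norm_eq_abs, Real.norm_eq_abs, Real.one_rpow, abs_sub_comm w 1,
    abs_of_nonneg (by linarith : 0 ≤ 1 - w)] at h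
  exact h

lemma log_le_mul_rpow {d : ℝ} (hd : 1 ≤ d) : Real.log d ≤ 4 * d ^ (1 / 4 : ℝ) := by
  have := Real.log_le_rpow_div (x := d) (ε := 1 / 4) (by linarith) (by norm_num)
  linarith

lemma log_sq_le_mul_rpow {d : ℝ} (hd : 1 ≤ d) : Real.log d ^ 2 ≤ 64 * d ^ (1 / 4 : ℝ) := by
  have h1 := Real.log_le_rpow_div (x := d) (ε := 1 / 8) (by linarith) (by norm_num)
  have h2 : Real.log d ≤ 8 * d ^ (1 / 8 : ℝ) := by linarith
  have h3 : (d ^ (1 / 8 : ℝ)) ^ 2 = d ^ (1 / 4 : ℝ) := by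
    rw [← Real.rpow_natCast, ← Real.rpow_mul (by linarith)]
    norm_num
  calc Real.log d ^ 2 ≤ (8 * d ^ (1 / 8 : ℝ)) ^ 2 :=
        pow_le_pow_left₀ (Real.log_nonneg hd) h2 2
    _ = 64 * d ^ (1 / 4 : ℝ) := by rw [mul_pow, h3]; norm_num

/-- A second-order expansion of `G(x) = ∑_{n ≤ x} g(n)` passes to the partial sums of `h * g`
when `∑ |h(d)| d^{-3/4}` converges, by dominated convergence in
`∑_{n ≤ x} (h * g)(n) = ∑ h(d) G(x / d)`. -/
theorem tendsto_partialSum_mul {g h : ArithmeticFunction ℝ} {δ a b : ℝ} (hδ : 0 < δ)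
    (hg0 : ∀ n, 0 ≤ g n) (hg1 : ∀ n, g n ≤ 1)
    (hh : Summable fun d : ℕ => |h d| * (d : ℝ) ^ (-(3 / 4) : ℝ))
    (hG : Tendsto (fun u => u * (partialSum g (Real.exp u) / (Real.exp u * u ^ (δ - 1)) - a))
      atTop (𝓝 b)) :
    Tendsto (fun u => u * (partialSum (fun n => (h * g) n) (Real.exp u)
        / (Real.exp u * u ^ (δ - 1)) - a * ∑' d : ℕ, h d / d)) atTop
      (𝓝 (b * ∑' d : ℕ, h d / d + a * (1 - δ) * ∑' d : ℕ, h d * Real.log d / d)) := by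
  set N : ℝ → ℝ := fun u => Real.exp u * u ^ (δ - 1) with hNdef
  set r : ℝ → ℝ := fun u => u * (partialSum g (Real.exp u) / N u - a) with hrdef
  have hGr : ∀ v, 0 < v → partialSum g (Real.exp v) = N v * (a + r v / v) := by
    intro v hv
    have : 0 < N v := by positivity
    rw [hrdef]
    simp only
    field_simp
    ring
  have hrb : ∀ᶠ u in atTop, |r u| ≤ |b| + 1 := by
    have := hG.abs.eventually_lt_const (show |b| < |b| + 1 by linarith)
    filter_upwards [this] with u hu using hu.le
  obtain ⟨v1, hv1⟩ := eventually_atTop.1 hrb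
  set v0 := max v1 1
  have hv01 : 1 ≤ v0 := le_max_right _ _
  have hv0 : ∀ v, v0 ≤ v → |r v| ≤ |b| + 1 := fun v hv => hv1 v ((le_max_left _ _).trans hv)
  set q : ℕ → ℝ → ℝ := fun d u => u * (partialSum g (Real.exp u / d) * d / N u - a) with hqdef
  -- The value of `q d u` when `d` is small compared with `e^u`.
  have hq : ∀ d : ℕ, 1 ≤ d → ∀ u, 0 < u - Real.log d → 0 < u →
      q d u = a * (u * (((u - Real.log d) / u) ^ (δ - 1) - 1))
        + u / (u - Real.log d) * ((u - Real.log d) / u) ^ (δ - 1) * r (u - Real.log d) := by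
    intro d hd u hv hu
    have hd0 : (0 : ℝ) < d := by exact_mod_cast hd
    have h1 : Real.exp u / d = Real.exp (u - Real.log d) := by
      rw [Real.exp_sub, Real.exp_log hd0]
    have h2 : Real.exp (u - Real.log d) * d = Real.exp u := by
      rw [← h1]; field_simp
    have h3 : partialSum g (Real.exp u / d) * d / N u
        = ((u - Real.log d) / u) ^ (δ - 1) * (a + r (u - Real.log d) / (u - Real.log d)) := by
      rw [h1, hGr _ hv, Real.div_rpow hv.le hu.le]
      have : u ^ (δ - 1) ≠ 0 := (Real.rpow_pos_of_pos hu _).ne'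
      simp only [hNdef]
      rw [← h2]
      have := Real.exp_ne_zero (u - Real.log d)
      field_simp
    rw [hqdef]
    simp only
    rw [h3]
    field_simp
    ring
  have hqlim : ∀ d : ℕ, 1 ≤ d → Tendsto (q d) atTop (𝓝 (a * (1 - δ) * Real.log d + b)) := by
    intro d hd
    have h1 : Tendsto (fun u : ℝ => u - Real.log d) atTop atTop :=
      tendsto_atTop_add_const_right _ _ tendsto_id
    have h2 : Tendsto (fun u : ℝ => u / (u - Real.log d)) atTop (𝓝 1) := by
      have := (tendsto_one_sub_div (Real.log d)).inv₀ one_ne_zero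
      rw [inv_one] at this
      exact this.congr fun u => inv_div _ _
    have h3 := ((tendsto_mul_sub_div_rpow_sub_one (Real.log d) (δ - 1)).const_mul a).add
      ((h2.mul (tendsto_sub_div_rpow (Real.log d) (δ - 1))).mul (hG.comp h1))
    have e : a * -((δ - 1) * Real.log d) + 1 * 1 * b = a * (1 - δ) * Real.log d + b := by ring
    rw [e] at h3
    refine h3.congr' ?_
    filter_upwards [eventually_gt_atTop 0, eventually_gt_atTop (Real.log d)] with u hu hu2
    rw [hq d hd u (by linarith) hu]
    rfl
  set κ := δ - 1
  set c := |a| * (|κ| * 2 ^ |κ - 1| * 4) + 2 * 2 ^ |κ| * (|b| + 1) + (256 + 8 * |a|) with hcdef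
  -- For `d ≤ e^{u/2}` the bound comes from the expansion of `G`; for larger `d` the trivial
  -- `G(x) ≤ x` suffices, since then `u ≤ 2 log d`.
  have hqb : ∀ u, 2 * v0 ≤ u → ∀ d : ℕ, 1 ≤ d → |q d u| ≤ c * (d : ℝ) ^ (1 / 4 : ℝ) := by
    intro u hu d hd
    have hd1 : (1 : ℝ) ≤ d := by exact_mod_cast hd
    have hu1 : 1 ≤ u := by linarith
    have hl0 := Real.log_nonneg hd1
    have hl1 := log_le_mul_rpow hd1
    have hl2 := log_sq_le_mul_rpow hd1
    have hd4 : 1 ≤ (d : ℝ) ^ (1 / 4 : ℝ) := Real.one_le_rpow hd1 (by norm_num)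
    set D := (d : ℝ) ^ (1 / 4 : ℝ)
    rcases le_total (Real.log d) (u / 2) with hcase | hcase
    · have hv : 0 < u - Real.log d := by linarith
      have hw1 : 1 / 2 ≤ (u - Real.log d) / u := by
        rw [le_div_iff₀ (by linarith)]; linarith
      have hw2 : (u - Real.log d) / u ≤ 1 := by
        rw [div_le_one (by linarith)]; linarith
      rw [hq d hd u hv (by linarith)]
      set w := (u - Real.log d) / u with hw
      have e1 : u * (1 - w) = Real.log d := by rw [hw]; field_simp; ring
      have b1 : |a * (u * (w ^ κ - 1))| ≤ |a| * (|κ| * 2 ^ |κ - 1| * 4) * D := by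
        rw [abs_mul, abs_mul, abs_of_pos (by linarith : 0 < u)]
        calc |a| * (u * |w ^ κ - 1|) ≤ |a| * (u * (|κ| * 2 ^ |κ - 1| * (1 - w))) := by
              gcongr
              exact abs_rpow_sub_one_le hw1 hw2 κ
          _ = |a| * (|κ| * 2 ^ |κ - 1| * Real.log d) := by rw [← e1]; ring
          _ ≤ |a| * (|κ| * 2 ^ |κ - 1| * (4 * D)) := by gcongr
          _ = _ := by ring
      have b2 : |u / (u - Real.log d) * w ^ κ * r (u - Real.log d)|
          ≤ 2 * 2 ^ |κ| * (|b| + 1) := by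
        have hw0 : 0 ≤ w := by linarith
        rw [abs_mul, abs_mul, abs_of_nonneg (Real.rpow_nonneg hw0 κ),
          abs_of_pos (div_pos (by linarith : 0 < u) hv)]
        have : u / (u - Real.log d) ≤ 2 := by
          rw [div_le_iff₀ hv]; linarith
        have h2 := rpow_le_two_rpow_abs hw1 hw2 κ
        have h3 := hv0 (u - Real.log d) (by linarith)
        gcongr
      have b3 : 2 * 2 ^ |κ| * (|b| + 1) ≤ 2 * 2 ^ |κ| * (|b| + 1) * D :=
        le_mul_of_one_le_right (by positivity) hd4
      have b4 : 0 ≤ (256 + 8 * |a|) * D := by positivity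
      refine (abs_add_le _ _).trans ?_
      rw [hcdef, add_mul, add_mul]
      linarith
    · have h1 : 0 ≤ partialSum g (Real.exp u / d) := partialSum_nonneg hg0 _
      have h2 : partialSum g (Real.exp u / d) * d ≤ Real.exp u := by
        have := partialSum_le_self hg1 (x := Real.exp u / d) (by positivity)
        rwa [le_div_iff₀ (by linarith)] at this
      have h3 : |partialSum g (Real.exp u / d) * d / N u - a| ≤ u + |a| := by
        refine (abs_sub _ _).trans (add_le_add ?_ le_rfl)
        have hN : 0 < N u := by positivity
        rw [abs_of_nonneg (by positivity), div_le_iff₀ hN]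
        refine h2.trans ?_
        have : u * N u = Real.exp u * u ^ δ := by
          have h5 : u ^ δ = u ^ κ * u := by
            rw [← Real.rpow_add_one (by linarith), sub_add_cancel]
          rw [h5, hNdef]
          ring
        rw [this]
        exact le_mul_of_one_le_right (Real.exp_pos _).le (Real.one_le_rpow hu1 hδ.le)
      rw [hqdef]
      simp only
      rw [abs_mul, abs_of_pos (by linarith : 0 < u)]
      calc u * |partialSum g (Real.exp u / d) * d / N u - a| ≤ u * (u + |a|) := by gcongr
        _ ≤ (2 * Real.log d) * (2 * Real.log d + |a|) := by gcongr <;> linarith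
        _ = 4 * Real.log d ^ 2 + 2 * |a| * Real.log d := by ring
        _ ≤ 4 * (64 * D) + 2 * |a| * (4 * D) := by gcongr
        _ = (256 + 8 * |a|) * D := by ring
        _ ≤ c * D := by
          gcongr
          rw [hcdef]
          have : 0 ≤ |a| * (|κ| * 2 ^ |κ - 1| * 4) + 2 * 2 ^ |κ| * (|b| + 1) := by positivity
          linarith
  have hpw : ∀ d : ℕ, 1 ≤ d → |h d| / d * (d : ℝ) ^ (1 / 4 : ℝ) = |h d| * (d : ℝ) ^ (-(3 / 4) : ℝ) := by
    intro d hd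
    have hd0 : (0 : ℝ) < d := by exact_mod_cast hd
    have : (d : ℝ) ^ (-(3 / 4) : ℝ) = (d : ℝ) ^ (1 / 4 : ℝ) / d := by
      rw [← Real.rpow_sub_one hd0.ne']; norm_num
    rw [this]
    ring
  have hsum1 : Summable fun d : ℕ => h d / d := by
    refine Summable.of_norm_bounded hh fun d => ?_
    rcases Nat.eq_zero_or_pos d with rfl | hd
    · simp
    · rw [← hpw d hd, norm_div, Real.norm_eq_abs, Real.norm_natCast]
      exact le_mul_of_one_le_right (by positivity)
        (Real.one_le_rpow (by exact_mod_cast hd) (by norm_num))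
  have hsum2 : Summable fun d : ℕ => h d * Real.log d / d := by
    refine Summable.of_norm_bounded (hh.mul_left 4) fun d => ?_
    rcases Nat.eq_zero_or_pos d with rfl | hd
    · simp
    · have hd1 : (1 : ℝ) ≤ d := by exact_mod_cast hd
      rw [← hpw d hd, norm_div, norm_mul, Real.norm_eq_abs, Real.norm_eq_abs, Real.norm_natCast,
        abs_of_nonneg (Real.log_nonneg hd1)]
      calc |h d| * Real.log d / d = |h d| / d * Real.log d := by ring
        _ ≤ |h d| / d * (4 * (d : ℝ) ^ (1 / 4 : ℝ)) := by
          gcongr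
          exact log_le_mul_rpow hd1
        _ = _ := by ring
  have hmain : Tendsto (fun u => ∑' d : ℕ, h d / d * q d u) atTop
      (𝓝 (∑' d : ℕ, h d / d * (a * (1 - δ) * Real.log d + b))) := by
    refine tendsto_tsum_of_dominated_convergence (hh.mul_left c) ?_ ?_
    · intro d
      rcases Nat.eq_zero_or_pos d with rfl | hd
      · simp
      · exact (hqlim d hd).const_mul _
    · filter_upwards [eventually_ge_atTop (2 * v0)] with u hu d
      rcases Nat.eq_zero_or_pos d with rfl | hd
      · simp
      · rw [← hpw d hd, norm_mul, norm_div, Real.norm_natCast, Real.norm_eq_abs,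
          Real.norm_eq_abs]
        calc |h d| / d * |q d u| ≤ |h d| / d * (c * (d : ℝ) ^ (1 / 4 : ℝ)) := by
              gcongr
              exact hqb u hu d hd
          _ = _ := by ring
  have hval : ∑' d : ℕ, h d / d * (a * (1 - δ) * Real.log d + b)
      = b * ∑' d : ℕ, h d / d + a * (1 - δ) * ∑' d : ℕ, h d * Real.log d / d := by
    rw [← tsum_mul_left, ← tsum_mul_left, ← (hsum1.mul_left b).tsum_add (hsum2.mul_left _)]
    exact tsum_congr fun d => by ring
  rw [hval] at hmain
  refine hmain.congr' ?_
  filter_upwards [eventually_gt_atTop 0] with u hu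
  have hN : 0 < N u := by positivity
  have hzero : ∀ d ∉ Finset.Ioc 0 ⌊Real.exp u⌋₊, h d * partialSum g (Real.exp u / d) = 0 := by
    intro d hd
    rcases Nat.eq_zero_or_pos d with rfl | hd'
    · simp
    · rw [partialSum_of_lt_one, mul_zero]
      rw [div_lt_one (by exact_mod_cast hd')]
      by_contra hcon
      exact hd (mem_Ioc_floor_iff.2 ⟨hd', not_lt.1 hcon⟩)
  have hfin : ∑' d : ℕ, h d * partialSum g (Real.exp u / d)
      = partialSum (fun n => (h * g) n) (Real.exp u) := by
    rw [partialSum_mul]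
    exact tsum_eq_sum hzero
  have hfs : Summable fun d : ℕ => h d * partialSum g (Real.exp u / d) :=
    summable_of_ne_finset_zero hzero
  rw [← hfin, ← tsum_mul_left, ← tsum_div_const, ← (hfs.div_const (N u)).tsum_sub
    (hsum1.mul_left a), ← tsum_mul_left]
  refine tsum_congr fun d => ?_
  rcases Nat.eq_zero_or_pos d with rfl | hd
  · simp
  · have hd0 : (0 : ℝ) < d := by exact_mod_cast hd
    rw [hqdef]
    field_simp

end MultiplicativeSets

/-! ### The arithmetic functions attached to a multiplicative set -/

namespace MultiplicativeSets

open Filter Topology ArithmeticFunction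

/-- The characteristic function of `S` as an arithmetic function. -/
noncomputable def charFun (S : Set ℕ) : ArithmeticFunction ℝ :=
  ⟨fun n => if n = 0 then 0 else S.indicator (1 : ℕ → ℝ) n, by simp⟩

open Classical in
/-- The characteristic function of the set of positive integers all of whose prime factors lie
in `S`. It is completely multiplicative. -/
noncomputable def smoothFun (S : Set ℕ) : ArithmeticFunction ℝ :=
  ⟨fun n => if n ≠ 0 ∧ ∀ p, p.Prime → p ∣ n → p ∈ S then 1 else 0, by simp⟩

/-- The von Mangoldt function restricted to powers of primes in `S`. -/
noncomputable def smoothMangoldt (S : Set ℕ) : ArithmeticFunction ℝ :=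
  weighted vonMangoldt (smoothFun S)

/-- The arithmetic function `h` with `charFun S = h * smoothFun S`. It measures the failure of
`S` to be determined by its primes, and it lives on the powerful numbers. -/
noncomputable def correctionFun (S : Set ℕ) : ArithmeticFunction ℝ :=
  charFun S * weighted (moebius : ArithmeticFunction ℝ) (smoothFun S)

variable {S : Set ℕ}

open Classical in
lemma smoothFun_apply (n : ℕ) :
    smoothFun S n = if n ≠ 0 ∧ ∀ p, p.Prime → p ∣ n → p ∈ S then 1 else 0 := rfl

lemma smoothFun_nonneg (n : ℕ) : 0 ≤ smoothFun S n := by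
  rw [smoothFun_apply]; split_ifs <;> norm_num

lemma smoothFun_le_one (n : ℕ) : smoothFun S n ≤ 1 := by
  rw [smoothFun_apply]; split_ifs <;> norm_num

lemma smoothFun_one : smoothFun S 1 = 1 := by
  rw [smoothFun_apply, if_pos]
  exact ⟨one_ne_zero, fun p hp h => absurd (Nat.dvd_one.1 h) hp.ne_one⟩

lemma smoothFun_mul (a b : ℕ) : smoothFun S (a * b) = smoothFun S a * smoothFun S b := by
  classical
  have key : (a * b ≠ 0 ∧ ∀ p, p.Prime → p ∣ a * b → p ∈ S) ↔
      (a ≠ 0 ∧ ∀ p, p.Prime → p ∣ a → p ∈ S) ∧ (b ≠ 0 ∧ ∀ p, p.Prime → p ∣ b → p ∈ S) := by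
    constructor
    · rintro ⟨h1, h2⟩
      exact ⟨⟨left_ne_zero_of_mul h1, fun p hp hd => h2 p hp (hd.mul_right b)⟩,
        right_ne_zero_of_mul h1, fun p hp hd => h2 p hp (hd.mul_left a)⟩
    · rintro ⟨⟨h1, h2⟩, h3, h4⟩
      refine ⟨mul_ne_zero h1 h3, fun p hp hd => ?_⟩
      rcases (hp.dvd_mul).1 hd with h | h
      · exact h2 p hp h
      · exact h4 p hp h
  rw [smoothFun_apply, smoothFun_apply, smoothFun_apply, if_congr key rfl rfl, ite_and]
  split_ifs <;> simp

lemma smoothFun_prime {p : ℕ} (hp : p.Prime) : smoothFun S p = S.indicator (1 : ℕ → ℝ) p := by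
  classical
  rw [smoothFun_apply, Set.indicator_apply]
  refine if_congr ⟨fun h => h.2 p hp dvd_rfl, fun h => ⟨hp.ne_zero, fun q hq hd => ?_⟩⟩ rfl rfl
  rwa [(Nat.prime_dvd_prime_iff_eq hq hp).1 hd]

lemma smoothMangoldt_nonneg (n : ℕ) : 0 ≤ smoothMangoldt S n :=
  mul_nonneg vonMangoldt_nonneg (smoothFun_nonneg n)

lemma weighted_zeta_smoothFun :
    weighted ((zeta : ArithmeticFunction ℕ) : ArithmeticFunction ℝ) (smoothFun S) = smoothFun S := by
  ext n
  rcases eq_or_ne n 0 with rfl | hn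
  · simp
  · simp [natCoe_apply, zeta_apply_ne hn]

lemma smoothFun_mul_log (n : ℕ) :
    smoothFun S n * Real.log n = (smoothFun S * smoothMangoldt S) n := by
  have h := weighted_mul ((zeta : ArithmeticFunction ℕ) : ArithmeticFunction ℝ) vonMangoldt
    (w := smoothFun S) smoothFun_mul
  rw [weighted_zeta_smoothFun, mul_comm (_ : ArithmeticFunction ℝ) vonMangoldt,
    vonMangoldt_mul_zeta] at h
  rw [smoothMangoldt, ← h, weighted_apply, log_apply, mul_comm]

lemma correctionFun_mul_smoothFun : correctionFun S * smoothFun S = charFun S := by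
  have h := weighted_mul (moebius : ArithmeticFunction ℝ)
    ((zeta : ArithmeticFunction ℕ) : ArithmeticFunction ℝ) (w := smoothFun S) smoothFun_mul
  rw [weighted_zeta_smoothFun, coe_moebius_mul_coe_zeta] at h
  have h1 : weighted (1 : ArithmeticFunction ℝ) (smoothFun S) = 1 := by
    ext n
    rcases eq_or_ne n 1 with rfl | hn
    · simp [smoothFun_one]
    · simp [one_apply_ne hn]
  rw [correctionFun, mul_assoc, ← h, h1, mul_one]

lemma charFun_apply (hS : IsMultiplicativeSet S) (n : ℕ) :
    charFun S n = S.indicator (1 : ℕ → ℝ) n := by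
  change (if n = 0 then 0 else S.indicator (1 : ℕ → ℝ) n) = _
  split_ifs with h
  · rw [h, Set.indicator_of_notMem hS.zero_notMem]
  · rfl

lemma charFun_nonneg (n : ℕ) : 0 ≤ charFun S n := by
  change 0 ≤ (if n = 0 then 0 else S.indicator (1 : ℕ → ℝ) n)
  split_ifs
  · rfl
  · exact Set.indicator_nonneg (fun _ _ => zero_le_one) _

lemma charFun_eq_zero_or_one (n : ℕ) : charFun S n = 0 ∨ charFun S n = 1 := by
  classical
  change (if n = 0 then 0 else S.indicator (1 : ℕ → ℝ) n) = 0 ∨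
    (if n = 0 then 0 else S.indicator (1 : ℕ → ℝ) n) = 1
  rw [Set.indicator_apply]
  split_ifs <;> simp

lemma charFun_le_one (n : ℕ) : charFun S n ≤ 1 := by
  rcases charFun_eq_zero_or_one (S := S) n with h | h <;> rw [h]
  exact zero_le_one

lemma charFun_isMultiplicative (hS : IsMultiplicativeSet S) : (charFun S).IsMultiplicative := by
  classical
  refine ⟨by rw [charFun_apply hS, Set.indicator_of_mem hS.one_mem]; rfl, fun {m n} h => ?_⟩
  simp only [charFun_apply hS, Set.indicator_apply, hS.mul_mem_iff m n h, ite_and]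
  split_ifs <;> simp

lemma correctionFun_isMultiplicative (hS : IsMultiplicativeSet S) :
    (correctionFun S).IsMultiplicative := by
  refine (charFun_isMultiplicative hS).mul ⟨?_, fun {m n} h => ?_⟩
  · simp [smoothFun_one]
  · have := isMultiplicative_moebius.map_mul_of_coprime h
    simp only [weighted_apply, intCoe_apply, this, smoothFun_mul]
    push_cast
    ring

lemma correctionFun_prime_pow {p k : ℕ} (hp : p.Prime) :
    correctionFun S (p ^ (k + 1))
      = charFun S (p ^ (k + 1)) - smoothFun S p * charFun S (p ^ k) := by
  rw [correctionFun, mul_apply, Nat.sum_divisorsAntidiagonal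
    (fun i j => charFun S i * weighted (moebius : ArithmeticFunction ℝ) (smoothFun S) j),
    Nat.sum_divisors_prime_pow hp, Finset.sum_range_succ, Finset.sum_range_succ,
    Finset.sum_eq_zero, Nat.div_self (pow_pos hp.pos _), pow_succ, Nat.mul_div_cancel_left _
    (pow_pos hp.pos _)]
  · simp [smoothFun_one, moebius_apply_prime hp]
    ring
  · intro i hi
    rw [Finset.mem_range] at hi
    rw [Nat.pow_div (by omega) hp.pos, weighted_apply, intCoe_apply,
      moebius_apply_prime_pow hp (by omega), if_neg (by omega)]
    simp

lemma abs_correctionFun_le_one (hS : IsMultiplicativeSet S) (n : ℕ) : |correctionFun S n| ≤ 1 := by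
  rcases eq_or_ne n 0 with rfl | hn
  · simp
  rw [IsMultiplicative.multiplicative_factorization _ (correctionFun_isMultiplicative hS) hn,
    Finsupp.prod, Finset.abs_prod]
  refine Finset.prod_le_one (fun _ _ => abs_nonneg _) fun p hp => ?_
  have hp' : p.Prime := Nat.prime_of_mem_primeFactors hp
  have hk : n.factorization p ≠ 0 := Finsupp.mem_support_iff.1 hp
  obtain ⟨k, hk'⟩ := Nat.exists_eq_succ_of_ne_zero hk
  rw [hk', Nat.succ_eq_add_one, correctionFun_prime_pow hp']
  have h1 := charFun_nonneg (S := S) (p ^ (k + 1))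
  have h2 := charFun_le_one (S := S) (p ^ (k + 1))
  have h3 : 0 ≤ smoothFun S p * charFun S (p ^ k) :=
    mul_nonneg (smoothFun_nonneg _) (charFun_nonneg _)
  have h4 : smoothFun S p * charFun S (p ^ k) ≤ 1 :=
    mul_le_one₀ (smoothFun_le_one _) (charFun_nonneg _) (charFun_le_one _)
  rw [abs_le]
  constructor <;> linarith

/-- The powerful numbers: every prime factor occurs at least twice. -/
def powerful : Set ℕ := {n | n ≠ 0 ∧ ∀ p, p.Prime → p ∣ n → p ^ 2 ∣ n}

lemma mem_powerful_of_correctionFun_ne_zero (hS : IsMultiplicativeSet S) {n : ℕ}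
    (h : correctionFun S n ≠ 0) : n ∈ powerful := by
  refine ⟨by rintro rfl; simp at h, fun p hp hd => ?_⟩
  by_contra hd2
  obtain ⟨m, rfl⟩ := hd
  have hpm : ¬ p ∣ m := fun hm => hd2 (by rw [pow_two]; exact Nat.mul_dvd_mul_left p hm)
  rw [(correctionFun_isMultiplicative hS).map_mul_of_coprime ((hp.coprime_iff_not_dvd).2 hpm)] at h
  have h0 := correctionFun_prime_pow (S := S) (k := 0) hp
  rw [zero_add, pow_one, pow_zero, (charFun_isMultiplicative hS).map_one, smoothFun_prime hp,
    charFun_apply hS, mul_one, sub_self] at h0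
  exact h (by rw [h0, zero_mul])

/-- A powerful number is a square times a cube: if `n = b² a` with `a` squarefree then `a ∣ b`. -/
lemma exists_sq_mul_cube_of_mem_powerful {n : ℕ} (h : n ∈ powerful) :
    ∃ q : ℕ × ℕ, n = q.1 ^ 2 * q.2 ^ 3 := by
  obtain ⟨h0, h⟩ := h
  obtain ⟨a, b, hab, hsf⟩ := Nat.sq_mul_squarefree n
  have hdvd : a ∣ b := by
    rw [← Nat.prod_primeFactors_of_squarefree hsf]
    refine Finset.prod_primes_dvd b (fun p hp => (Nat.prime_of_mem_primeFactors hp).prime)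
      fun p hp => ?_
    have hp' := Nat.prime_of_mem_primeFactors hp
    have hpa := Nat.dvd_of_mem_primeFactors hp
    by_contra hpb
    have h1 : p ^ 2 ∣ b ^ 2 * a := hab ▸ h p hp' (hab ▸ hpa.mul_left _)
    have h2 : p ^ 2 ∣ a := (Nat.Coprime.pow 2 2 ((hp'.coprime_iff_not_dvd).2 hpb)).dvd_of_dvd_mul_left h1
    rw [pow_two] at h2
    exact hp'.ne_one (Nat.isUnit_iff.1 (hsf p h2))
  obtain ⟨c, rfl⟩ := hdvd
  exact ⟨(c, a), by rw [← hab]; ring⟩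

lemma summable_powerful {σ : ℝ} (hσ : 1 / 2 < σ) :
    Summable (powerful.indicator fun n : ℕ => (n : ℝ) ^ (-σ)) := by
  rw [← summable_subtype_iff_indicator]
  choose φ hφ using fun n : powerful => exists_sq_mul_cube_of_mem_powerful n.2
  have hinj : Function.Injective φ := fun m n hmn => Subtype.ext (by rw [hφ m, hφ n, hmn])
  have h1 : Summable fun n : ℕ => (n : ℝ) ^ (-(2 * σ)) :=
    Real.summable_nat_rpow.2 (by linarith)
  have h2 : Summable fun n : ℕ => (n : ℝ) ^ (-(3 * σ)) :=
    Real.summable_nat_rpow.2 (by linarith)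
  have h3 := (h1.mul_of_nonneg h2 (fun n => Real.rpow_nonneg n.cast_nonneg _)
    (fun n => Real.rpow_nonneg n.cast_nonneg _)).comp_injective hinj
  refine h3.congr fun n => ?_
  simp only [Function.comp]
  rw [hφ n]
  push_cast
  rw [Real.mul_rpow (by positivity) (by positivity), ← Real.rpow_natCast, ← Real.rpow_natCast,
    ← Real.rpow_mul (by positivity), ← Real.rpow_mul (by positivity)]
  norm_num

lemma summable_correctionFun (hS : IsMultiplicativeSet S) {σ : ℝ} (hσ : 1 / 2 < σ) :
    Summable fun n : ℕ => |correctionFun S n| * (n : ℝ) ^ (-σ) := by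
  refine Summable.of_nonneg_of_le (fun n => by positivity) (fun n => ?_) (summable_powerful hσ)
  by_cases h : correctionFun S n = 0
  · rw [h, abs_zero, zero_mul]
    exact Set.indicator_nonneg (fun _ _ => by positivity) _
  · rw [Set.indicator_of_mem (mem_powerful_of_correctionFun_ne_zero hS h)]
    exact mul_le_of_le_one_left (by positivity) (abs_correctionFun_le_one hS n)

lemma summable_charFun_prime_pow {p : ℕ} (hp : p.Prime) :
    Summable fun k : ℕ => charFun S (p ^ k) / (p : ℝ) ^ k := by
  have h1 : (1 : ℝ) < p := by exact_mod_cast hp.one_lt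
  refine Summable.of_nonneg_of_le (fun k => div_nonneg (charFun_nonneg _) (by positivity))
    (fun k => ?_) (summable_geometric_of_lt_one (r := (p : ℝ)⁻¹) (by positivity)
      (inv_lt_one_of_one_lt₀ h1))
  rw [inv_pow, ← one_div]
  gcongr
  exact charFun_le_one _

/-- The Euler factor of the correction at `p`. -/
lemma tsum_correctionFun_prime_pow (hS : IsMultiplicativeSet S) {p : ℕ} (hp : p.Prime) :
    ∑' k : ℕ, correctionFun S (p ^ k) / ((p ^ k : ℕ) : ℝ)
      = (1 + ∑' k : ℕ, S.indicator (1 : ℕ → ℝ) (p ^ (k + 1)) / (p : ℝ) ^ (k + 1))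
        * (1 - smoothFun S p / p) := by
  have hs := summable_charFun_prime_pow (S := S) hp
  have hp0 : (p : ℝ) ≠ 0 := by exact_mod_cast hp.ne_zero
  have hs1 : Summable fun k : ℕ => charFun S (p ^ (k + 1)) / (p : ℝ) ^ (k + 1) :=
    (summable_nat_add_iff 1).2 hs
  have hstep : ∀ k : ℕ, correctionFun S (p ^ (k + 1)) / ((p ^ (k + 1) : ℕ) : ℝ)
      = charFun S (p ^ (k + 1)) / (p : ℝ) ^ (k + 1)
        - smoothFun S p / p * (charFun S (p ^ k) / (p : ℝ) ^ k) := by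
    intro k
    rw [correctionFun_prime_pow hp]
    push_cast
    field_simp
    ring
  have hc : Summable fun k : ℕ => correctionFun S (p ^ k) / ((p ^ k : ℕ) : ℝ) := by
    rw [← summable_nat_add_iff 1]
    exact (hs1.sub (hs.mul_left _)).congr fun k => (hstep k).symm
  have h0 : ∑' k : ℕ, charFun S (p ^ k) / (p : ℝ) ^ k
      = 1 + ∑' k : ℕ, charFun S (p ^ (k + 1)) / (p : ℝ) ^ (k + 1) := by
    rw [hs.tsum_eq_zero_add]
    simp [(charFun_isMultiplicative hS).map_one]
  rw [hc.tsum_eq_zero_add]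
  simp only [hstep]
  rw [hs1.tsum_sub (hs.mul_left _), tsum_mul_left, h0]
  simp only [← charFun_apply hS]
  simp only [pow_zero, (correctionFun_isMultiplicative hS).map_one, Nat.cast_one]
  ring

/-- `∑ h(n) / n` as the limit of the partial Euler products. -/
lemma tendsto_prod_correctionFun (hS : IsMultiplicativeSet S) :
    Tendsto (fun P : ℕ => ∏ p ∈ Nat.primesBelow P,
      ((1 + ∑' k : ℕ, S.indicator (1 : ℕ → ℝ) (p ^ (k + 1)) / (p : ℝ) ^ (k + 1))
        * (1 - smoothFun S p / p))) atTop (𝓝 (∑' n : ℕ, correctionFun S n / n)) := by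
  have hsum : Summable fun n : ℕ => ‖correctionFun S n / (n : ℝ)‖ := by
    refine (summable_correctionFun hS (σ := 1) (by norm_num)).congr fun n => ?_
    rw [norm_div, Real.norm_natCast, Real.norm_eq_abs, Real.rpow_neg_one, div_eq_mul_inv]
  have hm := correctionFun_isMultiplicative hS
  have h := EulerProduct.eulerProduct (f := fun n : ℕ => correctionFun S n / (n : ℝ))
    (by simp [hm.map_one])
    (fun {m n} hmn => by rw [hm.map_mul_of_coprime hmn]; push_cast; exact mul_div_mul_comm _ _ _ _)
    hsum (by simp)
  refine h.congr fun P => Finset.prod_congr rfl fun p hp => ?_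
  exact tsum_correctionFun_prime_pow hS (Nat.prime_of_mem_primesBelow hp)

/-- `∑ h(n) / n` is at least `1/2`: its Euler factor at `p` is at least `1 - p⁻²`, and
`∏_{n ≥ 2} (1 - n⁻²) = 1/2`. -/
lemma half_le_tsum_correctionFun (hS : IsMultiplicativeSet S) :
    1 / 2 ≤ ∑' n : ℕ, correctionFun S n / n := by
  refine ge_of_tendsto' (tendsto_prod_correctionFun hS) fun P => ?_
  have hfac : ∀ p : ℕ, p.Prime → 1 - 1 / (p : ℝ) ^ 2 ≤
      (1 + ∑' k : ℕ, S.indicator (1 : ℕ → ℝ) (p ^ (k + 1)) / (p : ℝ) ^ (k + 1))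
        * (1 - smoothFun S p / p) := by
    intro p hp
    have hp1 : (1 : ℝ) < p := by exact_mod_cast hp.one_lt
    have hs : Summable fun k : ℕ => S.indicator (1 : ℕ → ℝ) (p ^ (k + 1)) / (p : ℝ) ^ (k + 1) := by
      simp only [← charFun_apply hS]
      exact (summable_nat_add_iff 1).2 (summable_charFun_prime_pow (S := S) hp)
    have hnn : ∀ k : ℕ, 0 ≤ S.indicator (1 : ℕ → ℝ) (p ^ (k + 1)) / (p : ℝ) ^ (k + 1) := fun k =>
      div_nonneg (Set.indicator_nonneg (fun _ _ => zero_le_one) _) (by positivity)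
    have h0 := hs.le_tsum 0 fun k _ => hnn k
    rw [zero_add, pow_one, pow_one, ← smoothFun_prime hp] at h0
    have h1 : smoothFun S p / p ≤ 1 := by
      rw [div_le_one (by linarith)]
      linarith [smoothFun_le_one (S := S) p]
    have h2 : smoothFun S p ^ 2 / (p : ℝ) ^ 2 ≤ 1 / (p : ℝ) ^ 2 := by
      gcongr
      exact pow_le_one₀ (smoothFun_nonneg p) (smoothFun_le_one p)
    calc 1 - 1 / (p : ℝ) ^ 2 ≤ (1 + smoothFun S p / p) * (1 - smoothFun S p / p) := by
          rw [← div_pow] at h2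
          nlinarith
      _ ≤ _ := by
          apply mul_le_mul_of_nonneg_right _ (by linarith)
          linarith
  have hpos : ∀ n : ℕ, 2 ≤ n → 0 ≤ 1 - 1 / (n : ℝ) ^ 2 ∧ 1 - 1 / (n : ℝ) ^ 2 ≤ 1 := by
    intro n hn
    have : (2 : ℝ) ≤ n := by exact_mod_cast hn
    have h1 : 1 / (n : ℝ) ^ 2 ≤ 1 := by
      rw [div_le_one (by positivity)]; nlinarith
    have h2 : 0 ≤ 1 / (n : ℝ) ^ 2 := by positivity
    exact ⟨by linarith, by linarith⟩
  have htel : ∀ m : ℕ, ∏ n ∈ Finset.Ico 2 (m + 2), (1 - 1 / (n : ℝ) ^ 2)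
      = ((m : ℝ) + 2) / (2 * ((m : ℝ) + 1)) := by
    intro m
    induction m with
    | zero => norm_num
    | succ m ih =>
      rw [show m + 1 + 2 = (m + 2) + 1 by ring, Finset.prod_Ico_succ_top (by omega), ih]
      push_cast
      have h1 : (m : ℝ) + 1 ≠ 0 := by positivity
      have h2 : (m : ℝ) + 2 ≠ 0 := by positivity
      have h3 : (m : ℝ) + 1 + 1 ≠ 0 := by positivity
      field_simp
      ring
  have hsub : Nat.primesBelow P ⊆ Finset.Ico 2 (P + 2) := by
    intro p hp
    rw [Finset.mem_Ico]
    exact ⟨(Nat.prime_of_mem_primesBelow hp).two_le, by have := Nat.lt_of_mem_primesBelow hp; omega⟩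
  calc (1 : ℝ) / 2 ≤ (P + 2) / (2 * (P + 1)) := by
        rw [div_le_div_iff₀ (by norm_num) (by positivity)]; linarith
    _ = ∏ n ∈ Finset.Ico 2 (P + 2), (1 - 1 / (n : ℝ) ^ 2) := (htel P).symm
    _ ≤ ∏ p ∈ Nat.primesBelow P, (1 - 1 / (p : ℝ) ^ 2) := by
        refine Finset.prod_le_prod_of_subset_of_le_one hsub
          (fun n hn => (hpos n (Finset.mem_Ico.1 hn).1).1)
          fun n hn _ => (hpos n (Finset.mem_Ico.1 hn).1).2
    _ ≤ _ := Finset.prod_le_prod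
        (fun p hp => (hpos p (Nat.prime_of_mem_primesBelow hp).two_le).1)
        (fun p hp => hfac p (Nat.prime_of_mem_primesBelow hp))

end MultiplicativeSets

/-! ### The prime sums under Condition B -/

namespace MultiplicativeSets

open Filter Topology

section

variable {a : ℕ → ℝ} {δ c ρ : ℝ}

/-- A prime number theorem for `a` that holds for large `x` extends to all `x ≥ 1`, once the
logarithm in the error term is shifted away from `0`. -/
lemma exists_bound_of_eventually (ha : ∀ n, 0 ≤ a n) (hδ : 0 < δ) (hρ : 0 < ρ)
    (h : ∀ᶠ v in atTop, |partialSum a (Real.exp v) - δ * Real.exp v|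
      ≤ c * (Real.exp v * v ^ (-(1 + ρ)))) :
    ∃ K, ∀ y, 1 ≤ y → |partialSum a y - δ * y| ≤ K * (y * (1 + Real.log y) ^ (-(1 + ρ))) := by
  obtain ⟨v0, hv0⟩ := eventually_atTop.1 h
  set V := max v0 1
  have hV1 : 1 ≤ V := le_max_right _ _
  set K1 := |c| * 2 ^ (1 + ρ)
  set K2 := (partialSum a (Real.exp V) + δ * Real.exp V) * (1 + V) ^ (1 + ρ)
  have hP := partialSum_nonneg ha (Real.exp V)
  have hK2 : 0 ≤ K2 := by positivity
  refine ⟨K1 + K2, fun y hy => ?_⟩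
  have hy0 : 0 < y := by linarith
  have hl := Real.log_nonneg hy
  have hpos : 0 < y * (1 + Real.log y) ^ (-(1 + ρ)) := by positivity
  rcases le_total V (Real.log y) with hcase | hcase
  · have h1 := hv0 (Real.log y) ((le_max_left _ _).trans hcase)
    rw [Real.exp_log hy0] at h1
    have hlp : 0 < Real.log y := by linarith
    have h2 : Real.log y ^ (-(1 + ρ)) ≤ 2 ^ (1 + ρ) * (1 + Real.log y) ^ (-(1 + ρ)) := by
      calc Real.log y ^ (-(1 + ρ)) ≤ ((1 + Real.log y) / 2) ^ (-(1 + ρ)) :=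
            Real.rpow_le_rpow_of_nonpos (by positivity) (by linarith) (by linarith)
        _ = _ := by
          rw [Real.div_rpow (by linarith) (by norm_num), Real.rpow_neg (by norm_num : (0:ℝ) ≤ 2),
            div_inv_eq_mul, mul_comm]
    calc |partialSum a y - δ * y| ≤ c * (y * Real.log y ^ (-(1 + ρ))) := h1
      _ ≤ |c| * (y * (2 ^ (1 + ρ) * (1 + Real.log y) ^ (-(1 + ρ)))) := by
        refine mul_le_mul (le_abs_self c) ?_ (by positivity) (abs_nonneg c)
        gcongr
      _ = K1 * (y * (1 + Real.log y) ^ (-(1 + ρ))) := by ring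
      _ ≤ _ := by gcongr; linarith
  · have hyV : y ≤ Real.exp V := (Real.log_le_iff_le_exp hy0).1 hcase
    have h1 := partialSum_mono ha hyV
    have h2 := partialSum_nonneg ha y
    have h3 : δ * y ≤ δ * Real.exp V := by gcongr
    have h4 : |partialSum a y - δ * y| ≤ partialSum a (Real.exp V) + δ * Real.exp V := by
      have : 0 < δ * y := by positivity
      rw [abs_le]
      constructor <;> linarith
    have h5 : 1 ≤ (1 + V) ^ (1 + ρ) * (y * (1 + Real.log y) ^ (-(1 + ρ))) := by
      have h6 : (1 + V) ^ (-(1 + ρ)) ≤ (1 + Real.log y) ^ (-(1 + ρ)) :=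
        Real.rpow_le_rpow_of_nonpos (by positivity) (by linarith) (by linarith)
      have h7 : (1 + V) ^ (1 + ρ) * (1 + V) ^ (-(1 + ρ)) = 1 := by
        rw [← Real.rpow_add (by linarith), add_neg_cancel, Real.rpow_zero]
      calc (1 : ℝ) = (1 + V) ^ (1 + ρ) * (1 * (1 + V) ^ (-(1 + ρ))) := by rw [one_mul, h7]
        _ ≤ _ := by gcongr
    calc |partialSum a y - δ * y| ≤ (partialSum a (Real.exp V) + δ * Real.exp V) * 1 := by
          rw [mul_one]; exact h4
      _ ≤ (partialSum a (Real.exp V) + δ * Real.exp V)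
          * ((1 + V) ^ (1 + ρ) * (y * (1 + Real.log y) ^ (-(1 + ρ)))) := by gcongr
      _ = K2 * (y * (1 + Real.log y) ^ (-(1 + ρ))) := by ring
      _ ≤ _ := by
        gcongr
        have : 0 ≤ K1 := by positivity
        linarith

/-- A prime number theorem for `a` with error `O(x / log^{1+ρ} x)` gives
`∑_{n ≤ x} a(n)/n = δ log x + B + o(1)`, since the error is integrable against `dx / x²`. -/
lemma exists_tendsto_partialSum_div (hρ : 0 < ρ)
    (h : ∀ᶠ v in atTop, |partialSum a (Real.exp v) - δ * Real.exp v|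
      ≤ c * (Real.exp v * v ^ (-(1 + ρ)))) :
    ∃ B, Tendsto (fun x => partialSum (fun n => a n / n) x - δ * Real.log x) atTop (𝓝 B) := by
  obtain ⟨v0, hv0⟩ := eventually_atTop.1 h
  set V := max v0 1
  have hV1 : 1 ≤ V := le_max_right _ _
  have hφ : ∀ v : ℝ, HasDerivAt (fun v => -Real.exp (-v)) (Real.exp (-v)) v := fun v => by
    simpa using ((hasDerivAt_neg v).exp).fun_neg
  -- `f v = ∑_{n ≤ e^v} a(n) (1/n - e^{-v}) - δ v` has right derivative
  -- `e^{-v} ∑_{n ≤ e^v} a(n) - δ`.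
  set f := fun v => smoothedSum a (fun v => -Real.exp (-v)) v - δ * v
  have hpos : ∀ v, V ≤ v → 0 < v := fun v hv => by linarith
  have hdφ : ∀ v, V ≤ v →
      HasDerivAt (fun v => c / ρ * v ^ (-ρ)) (-(c * v ^ (-(1 + ρ)))) v := by
    intro v hv
    have h1 := (Real.hasDerivAt_rpow_const (p := -ρ) (Or.inl (hpos v hv).ne')).const_mul (c / ρ)
    refine h1.congr_deriv ?_
    rw [show -ρ - 1 = -(1 + ρ) by ring]
    field_simp
  have hlim : Tendsto (fun v : ℝ => c / ρ * v ^ (-ρ)) atTop (𝓝 0) := by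
    simpa using (tendsto_rpow_neg_atTop hρ).const_mul (c / ρ)
  obtain ⟨L, hL, -⟩ := exists_limit_of_abs_rightDeriv_le (f := f) (a := V)
    (f' := fun v => Real.exp (-v) * partialSum a (Real.exp v) - δ * 1)
    (((continuous_smoothedSum a (by fun_prop)).sub (by fun_prop)).continuousOn)
    (fun v hv => (hdφ v hv).continuousAt.continuousWithinAt)
    (fun v _ => (hasDerivWithinAt_smoothedSum a (hφ v)).sub
      ((hasDerivAt_id v).const_mul δ).hasDerivWithinAt)
    (fun v hv => (hdφ v hv).hasDerivWithinAt)
    (fun v hv => by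
      rw [neg_neg]
      have h1 := hv0 v ((le_max_left _ _).trans hv)
      have h2 : Real.exp (-v) * Real.exp v = 1 := by rw [← Real.exp_add]; simp
      have e : Real.exp (-v) * partialSum a (Real.exp v) - δ * 1
          = Real.exp (-v) * (partialSum a (Real.exp v) - δ * Real.exp v) := by
        linear_combination δ * h2
      rw [e, abs_mul, abs_of_pos (Real.exp_pos _)]
      calc _ ≤ Real.exp (-v) * (c * (Real.exp v * v ^ (-(1 + ρ)))) := by gcongr
        _ = c * v ^ (-(1 + ρ)) := by linear_combination c * v ^ (-(1 + ρ)) * h2) hlim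
  have hA : Tendsto (fun v => Real.exp (-v) * partialSum a (Real.exp v)) atTop (𝓝 δ) := by
    rw [tendsto_iff_norm_sub_tendsto_zero]
    have h0 : Tendsto (fun v : ℝ => c * v ^ (-(1 + ρ))) atTop (𝓝 0) := by
      simpa using (tendsto_rpow_neg_atTop (show 0 < 1 + ρ by linarith)).const_mul c
    refine squeeze_zero' (Eventually.of_forall fun _ => norm_nonneg _) ?_ h0
    filter_upwards [h] with v hv
    have h2 : Real.exp (-v) * Real.exp v = 1 := by rw [← Real.exp_add]; simp
    have e : Real.exp (-v) * partialSum a (Real.exp v) - δ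
        = Real.exp (-v) * (partialSum a (Real.exp v) - δ * Real.exp v) := by
      linear_combination δ * h2
    rw [e, Real.norm_eq_abs, abs_mul, abs_of_pos (Real.exp_pos _)]
    calc _ ≤ Real.exp (-v) * (c * (Real.exp v * v ^ (-(1 + ρ)))) := by gcongr
      _ = c * v ^ (-(1 + ρ)) := by linear_combination c * v ^ (-(1 + ρ)) * h2
  refine ⟨L + δ, ((hL.add hA).comp Real.tendsto_log_atTop).congr' ?_⟩
  filter_upwards [eventually_gt_atTop 0] with x hx
  simp only [Function.comp, f, smoothedSum_eq, Real.exp_log hx]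
  have : partialSum (fun n => a n * -Real.exp (-Real.log n)) x
      = -partialSum (fun n => a n / n) x := by
    rw [partialSum, partialSum, ← Finset.sum_neg_distrib]
    refine Finset.sum_congr rfl fun n hn => ?_
    rw [Real.exp_neg, Real.exp_log (by linarith [(mem_Ioc_floor hn).1])]
    ring
  rw [this]
  ring

end

open Classical in
/-- `log p` at the primes `p` in `S`, and `0` elsewhere. -/
noncomputable def primeLog (S : Set ℕ) (n : ℕ) : ℝ :=
  if n.Prime then smoothFun S n * Real.log n else 0

variable {S : Set ℕ} {δ : ℝ}

open Classical in
lemma primeCount_eq_partialSum (x : ℝ) :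
    primeCount S x = partialSum (fun n => if n.Prime then smoothFun S n else 0) x := by
  have h : {p : ℕ | p.Prime ∧ p ∈ S ∧ (p : ℝ) ≤ x}
      = ((Finset.Ioc 0 ⌊x⌋₊).filter fun p => p.Prime ∧ p ∈ S : Finset ℕ) := by
    ext p
    simp only [Set.mem_ofPred_eq, Finset.coe_filter, mem_Ioc_floor_iff]
    constructor
    · rintro ⟨h1, h2, h3⟩
      exact ⟨⟨h1.pos, h3⟩, h1, h2⟩
    · rintro ⟨⟨-, h3⟩, h1, h2⟩
      exact ⟨h1, h2, h3⟩
  rw [primeCount, h, Set.ncard_coe_finset, Finset.card_filter, partialSum]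
  push_cast
  refine Finset.sum_congr rfl fun n _ => ?_
  by_cases hn : n.Prime
  · rw [if_pos hn, smoothFun_prime hn, Set.indicator_apply]
    simp [hn]
  · simp [hn]

lemma hasDerivAt_integral_log_rpow_exp (κ : ℝ) {v : ℝ} (hv : 0 < v) :
    HasDerivAt (fun v => ∫ t in (2 : ℝ)..Real.exp v, Real.log t ^ κ) (Real.exp v * v ^ κ) v := by
  have hx : 1 < Real.exp v := Real.one_lt_exp_iff.2 hv
  have hcont : ∀ t : ℝ, 1 < t → ContinuousAt (fun t : ℝ => Real.log t ^ κ) t := fun t ht =>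
    (Real.continuousAt_log (by linarith)).rpow_const (Or.inl (Real.log_pos ht).ne')
  have hint : IntervalIntegrable (fun t : ℝ => Real.log t ^ κ) MeasureTheory.volume 2
      (Real.exp v) := by
    refine ContinuousOn.intervalIntegrable fun t ht => (hcont t ?_).continuousWithinAt
    exact (lt_min one_lt_two hx).trans_le ht.1
  have hmeas : StronglyMeasurableAtFilter (fun t : ℝ => Real.log t ^ κ) (𝓝 (Real.exp v)) :=
    ContinuousOn.stronglyMeasurableAtFilter isOpen_Ioi
      (fun t ht => (hcont t ht).continuousWithinAt) _ hx
  have h := (intervalIntegral.integral_hasDerivAt_right hint hmeas (hcont _ hx)).comp v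
    (Real.hasDerivAt_exp v)
  rw [Real.log_exp, mul_comm] at h
  exact h

lemma hasDerivAt_Li_exp {v : ℝ} (hv : 0 < v) :
    HasDerivAt (fun v => Li (Real.exp v)) (Real.exp v / v) v := by
  simpa only [Li, Real.rpow_neg_one, one_div, div_eq_mul_inv, one_mul] using
    hasDerivAt_integral_log_rpow_exp (-1) hv

open Classical in
/-- Condition B in terms of `∑_{p ≤ x, p ∈ S} log p`. -/
lemma exists_primeLog_bound (hB : ConditionB S δ) :
    ∃ ρ c : ℝ, 0 < ρ ∧ ∀ᶠ v in atTop, |partialSum (primeLog S) (Real.exp v) - δ * Real.exp v|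
      ≤ c * (Real.exp v * v ^ (-(1 + ρ))) := by
  obtain ⟨-, ρ, hρ, hO⟩ := hB
  obtain ⟨c, hc, hcb⟩ := hO.exists_pos
  rw [Asymptotics.isBigOWith_iff] at hcb
  set a : ℕ → ℝ := fun n => if n.Prime then smoothFun S n else 0
  have hΔ : ∀ᶠ v in atTop, |partialSum a (Real.exp v) - δ * Li (Real.exp v)|
      ≤ c * (Real.exp v * v ^ (-(2 + ρ))) := by
    filter_upwards [Real.tendsto_exp_atTop.eventually hcb, eventually_gt_atTop 0] with v hv hv0
    rw [primeCount_eq_partialSum, Real.log_exp, Real.norm_eq_abs, Real.norm_eq_abs,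
      abs_of_nonneg (show 0 ≤ Real.exp v / v ^ (2 + ρ) by positivity)] at hv
    rwa [Real.rpow_neg hv0.le, ← div_eq_mul_inv]
  -- `D` is the error in `∫ π_S(e^t) dt`, the correction term when passing from `π_S` to
  -- `∑_{p ≤ x} log p` by partial summation.
  set D : ℝ → ℝ := fun v => smoothedSum a id v - δ * (v * Li (Real.exp v) - Real.exp v)
  have hLi : ∀ v : ℝ, 1 ≤ v → HasDerivAt (fun v => δ * (v * Li (Real.exp v) - Real.exp v))
      (δ * Li (Real.exp v)) v := by
    intro v hv
    have h1 := (((hasDerivAt_id v).mul (hasDerivAt_Li_exp (by linarith : 0 < v))).sub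
      (Real.hasDerivAt_exp v)).const_mul δ
    refine h1.congr_deriv ?_
    simp only [id]
    field_simp
    ring
  have hD : ∀ᶠ v in atTop, |D v| ≤ 3 * c * (Real.exp v * v ^ (-(2 + ρ))) := by
    refine eventually_abs_le_of_rightDeriv_le (a := 1) hc ?_ (fun v hv => ?_) hΔ
    · exact (continuous_smoothedSum a continuous_id).continuousOn.sub fun v hv =>
        (hLi v hv).continuousAt.continuousWithinAt
    · have := (hasDerivWithinAt_smoothedSum a (hasDerivAt_id v)).sub (hLi v hv).hasDerivWithinAt
      rwa [one_mul] at this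
  refine ⟨ρ, 4 * c, hρ, ?_⟩
  filter_upwards [hΔ, hD, eventually_ge_atTop 1] with v h1 h2 hv
  have hv0 : 0 < v := by linarith
  have hθ : partialSum (primeLog S) (Real.exp v) = v * partialSum a (Real.exp v)
      - smoothedSum a id v := by
    rw [smoothedSum_eq]
    simp only [id, sub_sub_cancel]
    refine Finset.sum_congr rfl fun n _ => ?_
    simp only [primeLog, a]
    split_ifs <;> simp
  have e : partialSum (primeLog S) (Real.exp v) - δ * Real.exp v
      = v * (partialSum a (Real.exp v) - δ * Li (Real.exp v)) - D v := by
    rw [hθ]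
    simp only [D]
    ring
  have h3 : v ^ (-(1 + ρ)) = v * v ^ (-(2 + ρ)) := by
    rw [show -(1 + ρ) = -(2 + ρ) + 1 by ring, Real.rpow_add_one hv0.ne', mul_comm]
  have h4 : 0 ≤ c * (Real.exp v * v ^ (-(2 + ρ))) := by positivity
  rw [e, h3]
  calc _ ≤ |v * (partialSum a (Real.exp v) - δ * Li (Real.exp v))| + |D v| := abs_sub _ _
    _ ≤ v * (c * (Real.exp v * v ^ (-(2 + ρ)))) + 3 * c * (Real.exp v * v ^ (-(2 + ρ))) := by
      rw [abs_mul, abs_of_pos hv0]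
      gcongr
    _ ≤ _ := by nlinarith

/-- Condition B in terms of the von Mangoldt function: the higher prime powers contribute
`O(√x log x)` only. -/
lemma exists_smoothMangoldt_bound (hB : ConditionB S δ) :
    ∃ ρ c : ℝ, 0 < ρ ∧ ∀ᶠ v in atTop,
      |partialSum (smoothMangoldt S) (Real.exp v) - δ * Real.exp v|
        ≤ c * (Real.exp v * v ^ (-(1 + ρ))) := by
  classical
  obtain ⟨ρ, c, hρ, h⟩ := exists_primeLog_bound hB
  refine ⟨ρ, c + 2, hρ, ?_⟩
  have hsmall : ∀ᶠ v : ℝ in atTop, √(Real.exp v) * v ≤ Real.exp v * v ^ (-(1 + ρ)) := by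
    have h1 := (tendsto_exp_mul_div_rpow_atTop (2 + ρ) (1 / 2) (by norm_num)).eventually_ge_atTop 1
    filter_upwards [h1, eventually_gt_atTop 0] with v hv hv0
    rw [one_le_div (by positivity)] at hv
    have h2 : Real.exp v = Real.exp (1 / 2 * v) * Real.exp (1 / 2 * v) := by
      rw [← Real.exp_add]; ring_nf
    have h3 : v = v ^ (2 + ρ) * v ^ (-(1 + ρ)) := by
      rw [← Real.rpow_add hv0]; norm_num
    rw [h2, Real.sqrt_mul_self (Real.exp_pos _).le, mul_assoc]
    refine mul_le_mul_of_nonneg_left ?_ (Real.exp_pos _).le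
    calc v = v ^ (2 + ρ) * v ^ (-(1 + ρ)) := h3
      _ ≤ _ := by gcongr
  filter_upwards [h, hsmall, eventually_ge_atTop 0] with v h1 h2 hv
  have hx : 1 ≤ Real.exp v := by simpa using hv
  have hle : ∀ n, primeLog S n ≤ smoothMangoldt S n := by
    intro n
    unfold primeLog
    split_ifs with hn
    · rw [smoothMangoldt, weighted_apply, ArithmeticFunction.vonMangoldt_apply_prime hn, mul_comm]
    · exact smoothMangoldt_nonneg n
  have h3 : 0 ≤ partialSum (smoothMangoldt S) (Real.exp v) - partialSum (primeLog S) (Real.exp v) :=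
    sub_nonneg.2 (Finset.sum_le_sum fun n _ => hle n)
  have h4 : partialSum (smoothMangoldt S) (Real.exp v) - partialSum (primeLog S) (Real.exp v)
      ≤ Chebyshev.psi (Real.exp v) - Chebyshev.theta (Real.exp v) := by
    rw [Chebyshev.psi, Chebyshev.theta, Finset.sum_filter, partialSum, partialSum,
      ← Finset.sum_sub_distrib, ← Finset.sum_sub_distrib]
    refine Finset.sum_le_sum fun n _ => ?_
    simp only [primeLog, smoothMangoldt, weighted_apply]
    split_ifs with hn
    · rw [ArithmeticFunction.vonMangoldt_apply_prime hn]
      linarith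
    · rw [sub_zero, sub_zero]
      exact mul_le_of_le_one_right ArithmeticFunction.vonMangoldt_nonneg (smoothFun_le_one n)
  have h5 := Chebyshev.psi_sub_theta_le hx
  rw [Real.log_exp] at h5
  rw [abs_le] at h1 ⊢
  have h6 : (c + 2) * (Real.exp v * v ^ (-(1 + ρ)))
      = c * (Real.exp v * v ^ (-(1 + ρ))) + 2 * (Real.exp v * v ^ (-(1 + ρ))) := by ring
  have h7 : 0 ≤ Real.exp v * v ^ (-(1 + ρ)) := by positivity
  rw [h6]
  constructor <;> linarith

end MultiplicativeSets

/-! ### An Abelian theorem for Dirichlet series -/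

namespace MultiplicativeSets

open Filter Topology MeasureTheory

section

variable {a : ℕ → ℝ} {κ c : ℝ}

lemma measurable_partialSum (a : ℕ → ℝ) : Measurable (partialSum a) :=
  (measurable_from_nat (f := fun N : ℕ => ∑ n ∈ Finset.Ioc 0 N, a n)).comp Nat.measurable_floor

lemma exists_abs_partialSum_le
    (h : Tendsto (fun v => partialSum a (Real.exp v) / v ^ κ) atTop (𝓝 c)) :
    ∃ K, 0 ≤ K ∧ ∀ v, 0 ≤ v → |partialSum a (Real.exp v)| ≤ K * (1 + v ^ κ) := by
  have h1 := h.abs.eventually_lt_const (show |c| < |c| + 1 by linarith)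
  obtain ⟨v0, hv0⟩ := eventually_atTop.1 h1
  set V := max v0 1
  set K := partialSum (fun n => |a n|) (Real.exp V)
  have hK : 0 ≤ K := partialSum_nonneg (fun n => abs_nonneg _) _
  refine ⟨|c| + 1 + K, by positivity, fun v hv => ?_⟩
  have hvκ : 0 ≤ v ^ κ := Real.rpow_nonneg hv κ
  rcases le_total V v with hcase | hcase
  · have h2 := hv0 v ((le_max_left _ _).trans hcase)
    have hvp : 0 < v := by linarith [le_max_right v0 1]
    have h3 : 0 < v ^ κ := by positivity
    rw [abs_div, abs_of_pos h3, div_lt_iff₀ h3] at h2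
    nlinarith [abs_nonneg c]
  · have h2 : |partialSum a (Real.exp v)| ≤ K :=
      (Finset.abs_sum_le_sum_abs _ _).trans
        (partialSum_mono (fun n => abs_nonneg (a n)) (Real.exp_le_exp.2 hcase))
    nlinarith [abs_nonneg c]

/-- A Dirichlet series as a Laplace transform of its partial sums. -/
lemma tsum_mul_rpow_eq_integral {ε : ℝ} (hε : 0 < ε)
    (hs : Summable fun n : ℕ => a n * (n : ℝ) ^ (-ε)) :
    ∑' n : ℕ, a n * (n : ℝ) ^ (-ε)
      = ∫ w in Set.Ioi 0, partialSum a (Real.exp (w / ε)) * Real.exp (-w) := by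
  set F : ℕ → ℝ → ℝ := fun n =>
    if n = 0 then 0 else (Set.Ici (ε * Real.log n)).indicator fun w => a n * Real.exp (-w)
  have hlog : ∀ n : ℕ, 0 ≤ ε * Real.log n := fun n =>
    mul_nonneg hε.le (Real.log_natCast_nonneg n)
  have hexp : ∀ n : ℕ, n ≠ 0 → Real.exp (-(ε * Real.log n)) = (n : ℝ) ^ (-ε) := fun n hn => by
    rw [Real.rpow_def_of_pos (by exact_mod_cast Nat.pos_of_ne_zero hn)]
    ring_nf
  have hinter : ∀ n : ℕ, Set.Ici (0 : ℝ) ∩ Set.Ici (ε * Real.log n) = Set.Ici (ε * Real.log n) :=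
    fun n => Set.inter_eq_right.2 (Set.Ici_subset_Ici.2 (hlog n))
  have hint : ∀ (C : ℝ) (n : ℕ), n ≠ 0 →
      ∫ w in Set.Ici 0, (Set.Ici (ε * Real.log n)).indicator (fun w => C * Real.exp (-w)) w
        = C * (n : ℝ) ^ (-ε) := by
    intro C n hn
    rw [setIntegral_indicator measurableSet_Ici, hinter, integral_Ici_eq_integral_Ioi,
      integral_const_mul, integral_exp_neg_Ioi, hexp n hn]
  have hF : ∀ n, Integrable (F n) (volume.restrict (Set.Ici 0)) := by
    intro n
    simp only [F]
    split_ifs with hn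
    · exact integrable_zero _ _ _
    · rw [integrable_indicator_iff measurableSet_Ici]
      have : IntegrableOn (fun w => Real.exp (-w)) (Set.Ioi (-1 : ℝ)) :=
        integrableOn_exp_neg_Ioi (-1)
      refine Integrable.const_mul ?_ _
      rw [Measure.restrict_restrict measurableSet_Ici, Set.inter_comm, hinter]
      exact this.mono_set fun w hw => by
        have h1 := hlog n
        have h2 : ε * Real.log n ≤ w := hw
        rw [Set.mem_Ioi]
        linarith
  have hFint : ∀ n, ∫ w in Set.Ici 0, F n w = a n * (n : ℝ) ^ (-ε) := by
    intro n
    simp only [F]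
    split_ifs with hn
    · simp [hn, Real.zero_rpow (neg_ne_zero.2 hε.ne')]
    · exact hint _ n hn
  have hFnorm : ∀ n, ∫ w in Set.Ici 0, ‖F n w‖ = ‖a n * (n : ℝ) ^ (-ε)‖ := by
    intro n
    simp only [F]
    split_ifs with hn
    · simp [hn, Real.zero_rpow (neg_ne_zero.2 hε.ne')]
    · simp only [norm_indicator_eq_indicator_norm, norm_mul, Real.norm_eq_abs, Real.abs_exp]
      rw [hint _ n hn, abs_of_nonneg (Real.rpow_nonneg n.cast_nonneg (-ε))]
  have hmain := hasSum_integral_of_summable_integral_norm hF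
    (by simp only [hFnorm]; exact hs.norm)
  simp only [hFint] at hmain
  rw [hmain.tsum_eq, ← integral_Ici_eq_integral_Ioi]
  refine setIntegral_congr_fun measurableSet_Ici fun w hw => ?_
  have hsum : ∀ n ∉ Finset.Ioc 0 ⌊Real.exp (w / ε)⌋₊, F n w = 0 := by
    intro n hn
    simp only [F]
    split_ifs with h0
    · rfl
    · rw [Set.indicator_of_notMem]
      intro hmem
      rw [Set.mem_Ici, mul_comm, ← le_div_iff₀ hε] at hmem
      have hn0 := Nat.pos_of_ne_zero h0
      exact hn (mem_Ioc_floor_iff.2 ⟨hn0,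
        (Real.log_le_iff_le_exp (by exact_mod_cast hn0)).1 hmem⟩)
  rw [tsum_eq_sum hsum, partialSum, Finset.sum_mul]
  refine Finset.sum_congr rfl fun n hn => ?_
  obtain ⟨h1, h2⟩ := mem_Ioc_floor hn
  simp only [F]
  rw [if_neg (Finset.mem_Ioc.1 hn).1.ne', Set.indicator_of_mem]
  rw [Set.mem_Ici, mul_comm, ← le_div_iff₀ hε]
  exact (Real.log_le_iff_le_exp (by linarith)).2 h2

/-- If `∑_{n ≤ x} a(n) ~ c log^κ x`, then `∑ a(n) n^{-ε} ~ c Γ(κ + 1) ε^{-κ}` as `ε → 0+`. -/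
theorem tendsto_rpow_mul_tsum (hκ : 0 ≤ κ)
    (hs : ∀ ε : ℝ, 0 < ε → Summable fun n : ℕ => a n * (n : ℝ) ^ (-ε))
    (h : Tendsto (fun v => partialSum a (Real.exp v) / v ^ κ) atTop (𝓝 c)) :
    Tendsto (fun ε : ℝ => ε ^ κ * ∑' n : ℕ, a n * (n : ℝ) ^ (-ε)) (𝓝[>] 0)
      (𝓝 (c * Real.Gamma (κ + 1))) := by
  obtain ⟨K, hK, hKb⟩ := exists_abs_partialSum_le h
  have hΓ : c * Real.Gamma (κ + 1) = ∫ w in Set.Ioi (0 : ℝ), c * (Real.exp (-w) * w ^ κ) := by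
    rw [integral_const_mul, Real.Gamma_eq_integral (by linarith), add_sub_cancel_right]
  rw [hΓ]
  have hlim : Tendsto (fun ε : ℝ => ∫ w in Set.Ioi (0 : ℝ),
      ε ^ κ * (partialSum a (Real.exp (w / ε)) * Real.exp (-w))) (𝓝[>] 0)
      (𝓝 (∫ w in Set.Ioi (0 : ℝ), c * (Real.exp (-w) * w ^ κ))) := by
    refine tendsto_integral_filter_of_dominated_convergence
      (fun w => K * (Real.exp (-w) + Real.exp (-w) * w ^ κ)) ?_ ?_ ?_ ?_
    · refine Eventually.of_forall fun ε => Measurable.aestronglyMeasurable ?_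
      exact (((measurable_partialSum a).comp (by fun_prop)).mul (by fun_prop)).const_mul _
    · have h1 : ∀ᶠ ε : ℝ in 𝓝[>] 0, ε < 1 :=
        nhdsWithin_le_nhds (eventually_lt_nhds one_pos)
      filter_upwards [h1, self_mem_nhdsWithin] with ε hε1 hε
      rw [Set.mem_Ioi] at hε
      filter_upwards [ae_restrict_mem measurableSet_Ioi] with w hw
      rw [Set.mem_Ioi] at hw
      have hb := hKb (w / ε) (by positivity)
      have hεκ : 0 < ε ^ κ := by positivity
      have hεκ1 : ε ^ κ ≤ 1 := Real.rpow_le_one hε.le hε1.le hκ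
      rw [Real.norm_eq_abs, abs_mul, abs_mul, abs_of_pos hεκ, Real.abs_exp]
      calc ε ^ κ * (|partialSum a (Real.exp (w / ε))| * Real.exp (-w))
          ≤ ε ^ κ * (K * (1 + (w / ε) ^ κ) * Real.exp (-w)) := by gcongr
        _ = K * ((ε ^ κ + w ^ κ) * Real.exp (-w)) := by
          rw [Real.div_rpow hw.le hε.le]
          field_simp
        _ ≤ K * ((1 + w ^ κ) * Real.exp (-w)) := by gcongr
        _ = _ := by ring
    · refine Integrable.const_mul (Integrable.add (integrableOn_exp_neg_Ioi 0) ?_) K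
      have h1 := Real.GammaIntegral_convergent (s := κ + 1) (by linarith)
      simp only [add_sub_cancel_right] at h1
      exact h1
    · filter_upwards [ae_restrict_mem measurableSet_Ioi] with w hw
      rw [Set.mem_Ioi] at hw
      have h1 : Tendsto (fun ε : ℝ => w / ε) (𝓝[>] 0) atTop := by
        simpa [div_eq_mul_inv] using tendsto_inv_nhdsGT_zero.const_mul_atTop hw
      have h2 := (h.comp h1).mul_const (Real.exp (-w) * w ^ κ)
      refine h2.congr' ?_
      filter_upwards [self_mem_nhdsWithin] with ε hε
      rw [Set.mem_Ioi] at hε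
      simp only [Function.comp]
      rw [Real.div_rpow hw.le hε.le]
      have : ε ^ κ ≠ 0 := (Real.rpow_pos_of_pos hε κ).ne'
      have : w ^ κ ≠ 0 := (Real.rpow_pos_of_pos hw κ).ne'
      field_simp
  refine hlim.congr' ?_
  filter_upwards [self_mem_nhdsWithin] with ε hε
  rw [tsum_mul_rpow_eq_integral hε (hs ε hε), integral_const_mul]

end

end MultiplicativeSets

/-! ### The Euler-Kronecker constant -/

namespace MultiplicativeSets

open Filter Topology ArithmeticFunction

section

variable {a b : ArithmeticFunction ℝ}

lemma term_ofReal (a : ℕ → ℝ) {s : ℝ} (hs : s ≠ 0) (n : ℕ) :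
    LSeries.term (fun n => (a n : ℂ)) (s : ℂ) n = ((a n * (n : ℝ) ^ (-s) : ℝ) : ℂ) := by
  rcases eq_or_ne n 0 with rfl | hn
  · simp [Real.zero_rpow (neg_ne_zero.2 hs)]
  · rw [LSeries.term_of_ne_zero hn, Real.rpow_neg n.cast_nonneg]
    push_cast
    rw [Complex.ofReal_cpow n.cast_nonneg, div_eq_mul_inv, Complex.ofReal_natCast]

lemma LSeries_ofReal (a : ℕ → ℝ) {s : ℝ} (hs : s ≠ 0) :
    LSeries (fun n => (a n : ℂ)) (s : ℂ) = ((∑' n : ℕ, a n * (n : ℝ) ^ (-s) : ℝ) : ℂ) := by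
  rw [LSeries, Complex.ofReal_tsum]
  exact tsum_congr fun n => term_ofReal a hs n

lemma riemannZeta_ofReal {s : ℝ} (hs : 1 < s) :
    riemannZeta s = ((∑' n : ℕ, (n : ℝ) ^ (-s) : ℝ) : ℂ) := by
  have h4 := LSeries_ofReal (fun _ => 1) (show s ≠ 0 by linarith)
  simp only [one_mul, Complex.ofReal_one] at h4
  rw [← h4, ← LSeries_one_eq_riemannZeta (by simpa using hs)]
  rfl

lemma LSeriesSummable_ofReal_iff (a : ℕ → ℝ) {s : ℝ} (hs : s ≠ 0) :
    LSeriesSummable (fun n => (a n : ℂ)) (s : ℂ) ↔ Summable fun n : ℕ => a n * (n : ℝ) ^ (-s) := by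
  rw [LSeriesSummable, ← Complex.summable_ofReal]
  exact summable_congr fun n => term_ofReal a hs n

lemma LSeries_ofReal_mul {s : ℂ} (ha : LSeriesSummable (fun n => (a n : ℂ)) s)
    (hb : LSeriesSummable (fun n => (b n : ℂ)) s) :
    LSeries (fun n => ((a * b) n : ℂ)) s
      = LSeries (fun n => (a n : ℂ)) s * LSeries (fun n => (b n : ℂ)) s := by
  rw [← LSeries_convolution' ha hb, LSeries.convolution_def]
  congr 1
  ext n
  rw [mul_apply]
  push_cast
  rfl

lemma abscissaOfAbsConv_ofReal_le_one {a : ℕ → ℝ} (h : ∀ n, |a n| ≤ 1) :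
    LSeries.abscissaOfAbsConv (fun n => (a n : ℂ)) ≤ 1 :=
  LSeries.abscissaOfAbsConv_le_of_le_const ⟨1, fun n _ => by simpa using h n⟩

end

section

variable {L : ℕ → ℝ} {δ B : ℝ}

lemma partialSum_one_div_eq_harmonic (x : ℝ) :
    partialSum (fun n => 1 / (n : ℝ)) x = harmonic ⌊x⌋₊ := by
  rw [partialSum, harmonic_eq_sum_Icc]
  push_cast
  exact Finset.sum_congr rfl fun n _ => one_div _

lemma tendsto_partialSum_one_div :
    Tendsto (fun v => partialSum (fun n => 1 / (n : ℝ)) (Real.exp v) - v) atTop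
      (𝓝 Real.eulerMascheroniConstant) := by
  have h1 : Tendsto (fun v => ⌊Real.exp v⌋₊) atTop atTop :=
    tendsto_nat_floor_atTop.comp Real.tendsto_exp_atTop
  have h2 := Real.tendsto_harmonic_sub_log.comp h1
  have h3 : Tendsto (fun v => Real.log (⌊Real.exp v⌋₊ / Real.exp v)) atTop (𝓝 0) := by
    have := ((tendsto_nat_floor_div_atTop (R := ℝ)).comp Real.tendsto_exp_atTop).log one_ne_zero
    simpa using this
  have h4 := h2.add h3
  rw [add_zero] at h4
  refine h4.congr' ?_
  filter_upwards [eventually_ge_atTop 0] with v hv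
  have hfl : 1 ≤ ⌊Real.exp v⌋₊ := Nat.one_le_floor_iff _ |>.2 (Real.one_le_exp hv)
  have hfl' : (⌊Real.exp v⌋₊ : ℝ) ≠ 0 := by positivity
  simp only [Function.comp]
  rw [partialSum_one_div_eq_harmonic, Real.log_div hfl' (Real.exp_pos v).ne', Real.log_exp]
  ring

/-- If `∑_{n ≤ x} L(n)/n = δ log x + B + o(1)`, then `∑ L(n) n^{-s} = δ/(s-1) + B + o(1)` as
`s → 1+`. The main term is removed by comparison with the zeta function, which leaves a series
whose partial sums converge. -/
lemma tendsto_tsum_sub_div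
    (hs : ∀ s : ℝ, 1 < s → Summable fun n : ℕ => L n * (n : ℝ) ^ (-s))
    (hL : Tendsto (fun x => partialSum (fun n => L n / n) x - δ * Real.log x) atTop (𝓝 B)) :
    Tendsto (fun s : ℝ => (∑' n : ℕ, L n * (n : ℝ) ^ (-s)) - δ / (s - 1)) (𝓝[>] 1) (𝓝 B) := by
  have hzs : ∀ s : ℝ, 1 < s → Summable fun n : ℕ => (n : ℝ) ^ (-s) := fun s hs =>
    Real.summable_nat_rpow.2 (by linarith)
  have hterm : ∀ (n : ℕ) (s : ℝ), 1 < s →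
      (L n - δ) / n * (n : ℝ) ^ (-(s - 1)) = L n * (n : ℝ) ^ (-s) - δ * (n : ℝ) ^ (-s) := by
    intro n s hs
    rcases eq_or_ne n 0 with rfl | hn
    · simp [Real.zero_rpow (show -s ≠ 0 by linarith)]
    · have hn' : (0 : ℝ) < n := by positivity
      rw [show -(s - 1) = 1 + -s by ring, Real.rpow_add hn', Real.rpow_one]
      field_simp
  have hsum : ∀ ε : ℝ, 0 < ε → Summable fun n : ℕ => (L n - δ) / n * (n : ℝ) ^ (-ε) := by
    intro ε hε
    have h1 : 1 < 1 + ε := by linarith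
    refine ((hs _ h1).sub ((hzs _ h1).mul_left δ)).congr fun n => ?_
    have h2 := hterm n _ h1
    rw [add_sub_cancel_left] at h2
    exact h2.symm
  have hpart : Tendsto (fun v => partialSum (fun n => (L n - δ) / n) (Real.exp v) / v ^ (0 : ℝ))
      atTop (𝓝 (B - δ * Real.eulerMascheroniConstant)) := by
    refine ((hL.comp Real.tendsto_exp_atTop).sub
      (tendsto_partialSum_one_div.const_mul δ)).congr fun v => ?_
    simp only [Function.comp, Real.rpow_zero, div_one, Real.log_exp, partialSum, mul_sub,
      Finset.mul_sum]
    rw [sub_sub_sub_cancel_right, ← Finset.sum_sub_distrib]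
    exact Finset.sum_congr rfl fun n _ => by ring
  have h1 := tendsto_rpow_mul_tsum le_rfl hsum hpart
  rw [zero_add, Real.Gamma_one, mul_one] at h1
  have hshift : Tendsto (fun s : ℝ => s - 1) (𝓝[>] 1) (𝓝[>] 0) := by
    refine tendsto_nhdsWithin_iff.2 ⟨?_, ?_⟩
    · have : Tendsto (fun s : ℝ => s - 1) (𝓝 1) (𝓝 (1 - 1)) :=
        tendsto_id.sub_const 1
      rw [sub_self] at this
      exact this.mono_left nhdsWithin_le_nhds
    · filter_upwards [self_mem_nhdsWithin] with s hs
      rw [Set.mem_Ioi] at hs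
      exact sub_pos.2 hs
  have hz : Tendsto (fun s : ℝ => (∑' n : ℕ, (n : ℝ) ^ (-s)) - 1 / (s - 1)) (𝓝[>] 1)
      (𝓝 Real.eulerMascheroniConstant) := by
    have h2 := (Complex.continuous_re.tendsto _).comp
      ZetaAsymptotics.tendsto_riemannZeta_sub_one_div_nhds_right
    refine h2.congr' ?_
    filter_upwards [self_mem_nhdsWithin] with s hs
    rw [Set.mem_Ioi] at hs
    simp only [Function.comp]
    rw [riemannZeta_ofReal hs, ← Complex.ofReal_one, ← Complex.ofReal_sub, ← Complex.ofReal_div,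
      ← Complex.ofReal_sub, Complex.ofReal_re]
  have h2 := (h1.comp hshift).add (hz.const_mul δ)
  rw [sub_add_cancel] at h2
  refine h2.congr' ?_
  filter_upwards [self_mem_nhdsWithin] with s hs'
  rw [Set.mem_Ioi] at hs'
  simp only [Function.comp, Real.rpow_zero, one_mul]
  rw [tsum_congr fun n => hterm n s hs', (hs s hs').tsum_sub ((hzs s hs').mul_left δ),
    tsum_mul_left]
  ring

end

section

variable {S : Set ℕ} {δ B : ℝ}

lemma abscissaOfAbsConv_smoothFun :
    LSeries.abscissaOfAbsConv (fun n => (smoothFun S n : ℂ)) ≤ 1 :=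
  abscissaOfAbsConv_ofReal_le_one fun n => by
    rw [abs_of_nonneg (smoothFun_nonneg n)]; exact smoothFun_le_one n

lemma abscissaOfAbsConv_charFun :
    LSeries.abscissaOfAbsConv (fun n => (charFun S n : ℂ)) ≤ 1 :=
  abscissaOfAbsConv_ofReal_le_one fun n => by
    rw [abs_of_nonneg (charFun_nonneg n)]; exact charFun_le_one n

lemma abscissaOfAbsConv_correctionFun (hS : IsMultiplicativeSet S) :
    LSeries.abscissaOfAbsConv (fun n => (correctionFun S n : ℂ)) ≤ ((1 / 2 : ℝ) : EReal) := by
  refine LSeries.abscissaOfAbsConv_le_of_forall_lt_LSeriesSummable fun y hy => ?_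
  rw [LSeriesSummable_ofReal_iff _ (show y ≠ 0 by linarith)]
  refine Summable.of_norm ((summable_correctionFun hS hy).congr fun n => ?_)
  rw [norm_mul, Real.norm_eq_abs, Real.norm_eq_abs,
    abs_of_nonneg (Real.rpow_nonneg n.cast_nonneg _)]

lemma LSeriesSummable_smoothMangoldt {s : ℂ} (hs : 1 < s.re) :
    LSeriesSummable (fun n => (smoothMangoldt S n : ℂ)) s := by
  refine Summable.of_norm_bounded (LSeriesSummable_vonMangoldt hs).norm fun n =>
    LSeries.norm_term_le s ?_
  rw [Complex.norm_real, Complex.norm_real, Real.norm_of_nonneg (smoothMangoldt_nonneg n),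
    Real.norm_of_nonneg vonMangoldt_nonneg]
  exact mul_le_of_le_one_right vonMangoldt_nonneg (smoothFun_le_one n)

lemma dirichletSeries_eq (hS : IsMultiplicativeSet S) :
    dirichletSeries S = LSeries (fun n => (charFun S n : ℂ)) := by
  classical
  rw [dirichletSeries]
  congr 1
  ext n
  rw [charFun_apply hS, Set.indicator_apply, Set.indicator_apply]
  split_ifs <;> simp

lemma one_lt_re_of_abscissa {a : ℕ → ℂ} (h : LSeries.abscissaOfAbsConv a ≤ 1) {s : ℂ}
    (hs : 1 < s.re) : LSeries.abscissaOfAbsConv a < s.re :=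
  h.trans_lt (by exact_mod_cast hs)

lemma abscissaOfAbsConv_correctionFun_lt (hS : IsMultiplicativeSet S) {s : ℂ} (hs : 1 / 2 < s.re) :
    LSeries.abscissaOfAbsConv (fun n => (correctionFun S n : ℂ)) < s.re :=
  (abscissaOfAbsConv_correctionFun hS).trans_lt (EReal.coe_lt_coe_iff.2 hs)

lemma dirichletSeries_eq_mul (hS : IsMultiplicativeSet S) {s : ℂ} (hs : 1 < s.re) :
    dirichletSeries S s = LSeries (fun n => (correctionFun S n : ℂ)) s
      * LSeries (fun n => (smoothFun S n : ℂ)) s := by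
  rw [dirichletSeries_eq hS, ← correctionFun_mul_smoothFun]
  exact LSeries_ofReal_mul
    (LSeriesSummable_of_abscissaOfAbsConv_lt_re
      (abscissaOfAbsConv_correctionFun_lt hS (by linarith)))
    (LSeriesSummable_of_abscissaOfAbsConv_lt_re
      (one_lt_re_of_abscissa abscissaOfAbsConv_smoothFun hs))

lemma summable_charFun {s : ℝ} (hs : 1 < s) :
    Summable fun n : ℕ => charFun S n * (n : ℝ) ^ (-s) := by
  refine Summable.of_nonneg_of_le (fun n => mul_nonneg (charFun_nonneg n) (by positivity))
    (fun n => mul_le_of_le_one_left (by positivity) (charFun_le_one n))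
    (Real.summable_nat_rpow.2 (show -s < -1 by linarith))

lemma dirichletSeries_ne_zero (hS : IsMultiplicativeSet S) {s : ℝ} (hs : 1 < s) :
    dirichletSeries S s ≠ 0 := by
  rw [dirichletSeries_eq hS, LSeries_ofReal _ (by linarith), Complex.ofReal_ne_zero]
  have h1 := (summable_charFun (S := S) hs).le_tsum 1
    fun n _ => mul_nonneg (charFun_nonneg n) (by positivity)
  have h2 : charFun S 1 = 1 := (charFun_isMultiplicative hS).map_one
  rw [h2, Nat.cast_one, Real.one_rpow, one_mul] at h1
  linarith

lemma deriv_LSeries_smoothFun {s : ℂ} (hs : 1 < s.re) :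
    HasDerivAt (LSeries fun n => (smoothFun S n : ℂ))
      (-(LSeries (fun n => (smoothFun S n : ℂ)) s
        * LSeries (fun n => (smoothMangoldt S n : ℂ)) s)) s := by
  have hab := one_lt_re_of_abscissa (abscissaOfAbsConv_smoothFun (S := S)) hs
  rw [← LSeries_ofReal_mul (LSeriesSummable_of_abscissaOfAbsConv_lt_re hab)
    (LSeriesSummable_smoothMangoldt hs)]
  refine (LSeries_hasDerivAt hab).congr_deriv ?_
  congr 2
  ext n
  rw [← smoothFun_mul_log, LSeries.logMul]
  push_cast
  rw [mul_comm]

/-- The logarithmic derivative of the Dirichlet series of a multiplicative set. -/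
lemma logDeriv_dirichletSeries (hS : IsMultiplicativeSet S) {s : ℝ} (hs : 1 < s) :
    deriv (dirichletSeries S) s / dirichletSeries S s
      = deriv (LSeries fun n => (correctionFun S n : ℂ)) s
          / LSeries (fun n => (correctionFun S n : ℂ)) s
        - LSeries (fun n => (smoothMangoldt S n : ℂ)) s := by
  have hs' : 1 < (s : ℂ).re := by simpa using hs
  have hne := dirichletSeries_ne_zero hS hs
  rw [dirichletSeries_eq_mul hS hs'] at hne
  have h1 := left_ne_zero_of_mul hne
  have h2 := right_ne_zero_of_mul hne
  have hev : dirichletSeries S =ᶠ[𝓝 (s : ℂ)] fun z =>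
      LSeries (fun n => (correctionFun S n : ℂ)) z * LSeries (fun n => (smoothFun S n : ℂ)) z := by
    filter_upwards [(isOpen_lt continuous_const Complex.continuous_re).mem_nhds hs'] with z hz
    exact dirichletSeries_eq_mul hS hz
  have hd := (LSeries_hasDerivAt
    (abscissaOfAbsConv_correctionFun_lt hS (show 1 / 2 < (s : ℂ).re by linarith)))
  have hder := hd.mul (deriv_LSeries_smoothFun (S := S) hs')
  rw [hev.deriv_eq, hev.eq_of_nhds]
  have := hder.deriv
  rw [Pi.mul_def] at this
  rw [this, hd.deriv]
  field_simp
  ring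

/-- The Euler-Kronecker constant is `-B - H'/H`, where `B` is the constant term of
`∑_{n ≤ x} Λ_g(n)/n`, and `H = ∑ h(n)/n`, `H' = ∑ h(n) log n/n` with the correction `h`. -/
theorem isEulerKroneckerConstant (hS : IsMultiplicativeSet S)
    (hB : Tendsto (fun x => partialSum (fun n => smoothMangoldt S n / n) x - δ * Real.log x)
      atTop (𝓝 B)) :
    IsEulerKroneckerConstant S δ (-B - (∑' n : ℕ, correctionFun S n * Real.log n / n)
      / ∑' n : ℕ, correctionFun S n / n) := by
  have hab : LSeries.abscissaOfAbsConv (fun n => (correctionFun S n : ℂ)) < (1 : ℂ).re :=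
    abscissaOfAbsConv_correctionFun_lt hS (by norm_num)
  have hH : LSeries (fun n => (correctionFun S n : ℂ)) 1
      = ((∑' n : ℕ, correctionFun S n / n : ℝ) : ℂ) := by
    have := LSeries_ofReal (correctionFun S) one_ne_zero
    simpa only [Complex.ofReal_one, Real.rpow_neg_one, ← div_eq_mul_inv] using this
  have hH' : deriv (LSeries fun n => (correctionFun S n : ℂ)) 1
      = ((-∑' n : ℕ, correctionFun S n * Real.log n / n : ℝ) : ℂ) := by
    rw [LSeries_deriv hab, Complex.ofReal_neg]
    have := LSeries_ofReal (fun n => correctionFun S n * Real.log n) one_ne_zero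
    simp only [Complex.ofReal_one, Real.rpow_neg_one, ← div_eq_mul_inv] at this
    rw [← this]
    congr 2
    ext n
    rw [LSeries.logMul]
    push_cast
    rw [mul_comm]
  have hHpos : 0 < ∑' n : ℕ, correctionFun S n / n := by
    linarith [half_le_tsum_correctionFun hS]
  have han : AnalyticAt ℂ (LSeries fun n => (correctionFun S n : ℂ)) 1 :=
    LSeries_analyticOnNhd _ 1 hab
  have hcast : Tendsto (fun s : ℝ => (s : ℂ)) (𝓝[>] 1) (𝓝 1) :=
    (Complex.continuous_ofReal.tendsto' 1 1 Complex.ofReal_one).mono_left nhdsWithin_le_nhds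
  have h1 := (han.deriv.continuousAt.tendsto.comp hcast).div
    (han.continuousAt.tendsto.comp hcast) (by rw [hH]; exact_mod_cast hHpos.ne')
  have h2 := (Complex.continuous_ofReal.tendsto _).comp
    (tendsto_tsum_sub_div (L := smoothMangoldt S) (fun s hs => by
      rw [← LSeriesSummable_ofReal_iff _ (show s ≠ 0 by linarith)]
      exact LSeriesSummable_smoothMangoldt (by simpa using hs)) hB)
  have h3 := h1.sub h2
  rw [hH, hH'] at h3
  unfold IsEulerKroneckerConstant
  convert h3.congr' ?_ using 2
  · push_cast
    ring
  · filter_upwards [self_mem_nhdsWithin] with s hs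
    rw [Set.mem_Ioi] at hs
    simp only [Function.comp, Pi.div_apply]
    rw [logDeriv_dirichletSeries hS hs, LSeries_ofReal (smoothMangoldt S) (by linarith)]
    push_cast
    ring

end

end MultiplicativeSets

/-! ### Mertens' estimate for `∑ log p / p` -/

namespace MultiplicativeSets

open Filter Topology ArithmeticFunction

lemma partialSum_log_eq (x : ℝ) :
    partialSum (fun n => Real.log n) x = Real.log (Nat.factorial ⌊x⌋₊) := by
  rw [partialSum]
  induction ⌊x⌋₊ with
  | zero => simp
  | succ n ih =>
    rw [Finset.sum_Ioc_succ_top (Nat.zero_le n), ih, Nat.factorial_succ, Nat.cast_mul,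
      Real.log_mul (by positivity) (by positivity), add_comm]

lemma abs_partialSum_log_sub_le {x : ℝ} (hx : 1 ≤ x) :
    |partialSum (fun n => Real.log n) x - x * Real.log x| ≤ 3 * x := by
  have hlog : 0 ≤ Real.log x := Real.log_nonneg hx
  have hfl : 1 ≤ ⌊x⌋₊ := (Nat.one_le_floor_iff x).2 hx
  have hflx : (⌊x⌋₊ : ℝ) ≤ x := Nat.floor_le (by linarith)
  have hlt : x < ⌊x⌋₊ + 1 := Nat.lt_floor_add_one x
  have hfl1 : (1 : ℝ) ≤ ⌊x⌋₊ := by exact_mod_cast hfl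
  have hup : partialSum (fun n => Real.log n) x ≤ x * Real.log x := by
    calc partialSum (fun n => Real.log n) x
        ≤ ∑ _n ∈ Finset.Ioc 0 ⌊x⌋₊, Real.log x := by
          refine Finset.sum_le_sum fun n hn => ?_
          obtain ⟨h1, h2⟩ := mem_Ioc_floor hn
          exact Real.log_le_log (by linarith) h2
      _ = ⌊x⌋₊ * Real.log x := by simp
      _ ≤ _ := by gcongr
  have hst := Stirling.le_log_factorial_stirling (n := ⌊x⌋₊) (by omega)
  rw [← partialSum_log_eq] at hst
  have h2 : Real.log x - Real.log 2 ≤ Real.log ⌊x⌋₊ := by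
    rw [← Real.log_div (by linarith) (by norm_num)]
    exact Real.log_le_log (by linarith) (by linarith)
  have h3 : Real.log 2 ≤ 1 := by linarith [Real.log_two_lt_d9]
  have h4 : Real.log x ≤ x := (Real.log_le_sub_one_of_pos (by linarith)).trans (by linarith)
  have h5 : 0 ≤ Real.log ⌊x⌋₊ := Real.log_nonneg hfl1
  have h6 : 0 ≤ Real.log (2 * Real.pi) := Real.log_nonneg (by nlinarith [Real.pi_gt_three])
  have h7 : (⌊x⌋₊ : ℝ) * (Real.log x - Real.log 2) ≤ ⌊x⌋₊ * Real.log ⌊x⌋₊ := by gcongr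
  have h8 : (x - 1) * Real.log x ≤ ⌊x⌋₊ * Real.log x := by
    gcongr
    linarith
  have h9 : (⌊x⌋₊ : ℝ) * Real.log 2 ≤ x * 1 := by gcongr
  rw [abs_le]
  constructor <;> linarith

/-- Mertens' estimate for the von Mangoldt function, by comparing
`log N! = ∑ Λ(d) ⌊N/d⌋` with `N ∑ Λ(d)/d`. -/
lemma exists_abs_partialSum_vonMangoldt_div_sub_log_le :
    ∃ K, ∀ x : ℝ, 1 ≤ x → |partialSum (fun n => vonMangoldt n / n) x - Real.log x| ≤ K := by
  refine ⟨Real.log 4 + 4 + 3, fun x hx => ?_⟩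
  have hx0 : 0 < x := by linarith
  have h1 : partialSum (fun n => Real.log n) x
      = ∑ d ∈ Finset.Ioc 0 ⌊x⌋₊, vonMangoldt d * ⌊x / d⌋₊ := by
    have h := partialSum_mul vonMangoldt ((zeta : ArithmeticFunction ℕ) : ArithmeticFunction ℝ) x
    rw [vonMangoldt_mul_zeta] at h
    refine Eq.trans (Finset.sum_congr rfl fun n _ => (log_apply).symm) (h.trans ?_)
    refine Finset.sum_congr rfl fun d _ => ?_
    congr 1
    rw [partialSum]
    refine Eq.trans (Finset.sum_congr rfl fun n hn => ?_) (b := ∑ _n ∈ Finset.Ioc 0 ⌊x / d⌋₊, 1) ?_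
    · rw [natCoe_apply, zeta_apply_ne (Finset.mem_Ioc.1 hn).1.ne', Nat.cast_one]
    · simp
  have h2 : |x * partialSum (fun n => vonMangoldt n / n) x - partialSum (fun n => Real.log n) x|
      ≤ (Real.log 4 + 4) * x := by
    refine le_trans ?_ (Chebyshev.psi_le_const_mul_self hx0.le)
    rw [h1, partialSum, Finset.mul_sum, ← Finset.sum_sub_distrib, Chebyshev.psi]
    refine (Finset.abs_sum_le_sum_abs _ _).trans (Finset.sum_le_sum fun d _ => ?_)
    have h3 : x * (vonMangoldt d / d) - vonMangoldt d * ⌊x / d⌋₊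
        = vonMangoldt d * (x / d - ⌊x / d⌋₊) := by ring
    have h4 : (⌊x / d⌋₊ : ℝ) ≤ x / d := Nat.floor_le (by positivity)
    have h5 : x / d < ⌊x / d⌋₊ + 1 := Nat.lt_floor_add_one _
    rw [h3, abs_mul, abs_of_nonneg vonMangoldt_nonneg, abs_of_nonneg (by linarith)]
    exact mul_le_of_le_one_right vonMangoldt_nonneg (by linarith)
  have h3 := abs_partialSum_log_sub_le hx
  have h4 : |x * (partialSum (fun n => vonMangoldt n / n) x - Real.log x)|
      ≤ (Real.log 4 + 4 + 3) * x := by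
    have := abs_add_le (x * partialSum (fun n => vonMangoldt n / n) x
      - partialSum (fun n => Real.log n) x) (partialSum (fun n => Real.log n) x - x * Real.log x)
    rw [mul_sub]
    rw [sub_add_sub_cancel] at this
    linarith
  rw [abs_mul, abs_of_pos hx0, mul_comm] at h4
  exact le_of_mul_le_mul_right h4 hx0

lemma summable_vonMangoldt_not_prime :
    Summable fun n : ℕ => if n.Prime then 0 else vonMangoldt n / (n : ℝ) := by
  have hs := (summable_powerful (σ := 3 / 4) (by norm_num)).mul_left 4
  refine Summable.of_nonneg_of_le (fun n => ?_) (fun n => ?_) hs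
  · split_ifs
    · exact le_rfl
    · exact div_nonneg vonMangoldt_nonneg n.cast_nonneg
  · have hnn : 0 ≤ 4 * powerful.indicator (fun n : ℕ => (n : ℝ) ^ (-(3 / 4 : ℝ))) n :=
      mul_nonneg (by norm_num) (Set.indicator_nonneg (fun _ _ => by positivity) _)
    split_ifs with hn
    · exact hnn
    · by_cases h0 : vonMangoldt n = 0
      · rw [h0, zero_div]
        exact hnn
      · rw [← ne_eq, vonMangoldt_ne_zero_iff, isPrimePow_nat_iff] at h0
        obtain ⟨p, k, hp, hk, rfl⟩ := h0
        have hk2 : 2 ≤ k := by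
          by_contra hlt
          exact hn (by rw [show k = 1 by omega, pow_one]; exact hp)
        have hmem : p ^ k ∈ powerful := by
          refine ⟨(pow_pos hp.pos k).ne', fun q hq hd => ?_⟩
          rw [(Nat.prime_dvd_prime_iff_eq hq hp).1 (hq.dvd_of_dvd_pow hd)]
          exact pow_dvd_pow p hk2
        rw [Set.indicator_of_mem hmem]
        have h1 : (1 : ℝ) ≤ ((p ^ k : ℕ) : ℝ) := by exact_mod_cast Nat.one_le_pow _ _ hp.pos
        set d : ℝ := ((p ^ k : ℕ) : ℝ)
        have hd : 0 < d := by linarith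
        calc vonMangoldt (p ^ k) / d ≤ 4 * d ^ (1 / 4 : ℝ) / d := by
              gcongr
              exact vonMangoldt_le_log.trans (log_le_mul_rpow h1)
          _ = 4 * d ^ (-(3 / 4 : ℝ)) := by
              rw [mul_div_assoc, ← Real.rpow_sub_one hd.ne']
              norm_num

theorem exists_abs_partialSum_log_div_prime_sub_log_le :
    ∃ K, ∀ x : ℝ, 1 ≤ x →
      |partialSum (fun n => if n.Prime then Real.log n / n else 0) x - Real.log x| ≤ K := by
  obtain ⟨K, hK⟩ := exists_abs_partialSum_vonMangoldt_div_sub_log_le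
  refine ⟨K + ∑' n : ℕ, if n.Prime then 0 else vonMangoldt n / (n : ℝ), fun x hx => ?_⟩
  have hnn : ∀ n : ℕ, 0 ≤ if n.Prime then 0 else vonMangoldt n / (n : ℝ) := fun n => by
    split_ifs
    · exact le_rfl
    · exact div_nonneg vonMangoldt_nonneg n.cast_nonneg
  have h1 := summable_vonMangoldt_not_prime.sum_le_tsum (Finset.Ioc 0 ⌊x⌋₊) fun n _ => hnn n
  have h2 : 0 ≤ partialSum (fun n => if n.Prime then 0 else vonMangoldt n / (n : ℝ)) x :=
    partialSum_nonneg hnn x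
  have h3 : partialSum (fun n => if n.Prime then Real.log n / n else 0) x
      = partialSum (fun n => vonMangoldt n / n) x
        - partialSum (fun n => if n.Prime then 0 else vonMangoldt n / (n : ℝ)) x := by
    simp only [partialSum]
    rw [← Finset.sum_sub_distrib]
    refine Finset.sum_congr rfl fun n _ => ?_
    split_ifs with hn
    · rw [vonMangoldt_apply_prime hn, sub_zero]
    · rw [sub_self]
  have h4 := hK x hx
  change partialSum (fun n => if n.Prime then 0 else vonMangoldt n / (n : ℝ)) x ≤ _ at h1
  rw [h3]
  rw [abs_le] at h4 ⊢
  constructor <;> linarith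

end MultiplicativeSets

/-! ### The Landau constant -/

namespace MultiplicativeSets

open Filter Topology ArithmeticFunction

section

variable {S : Set ℕ} {δ A : ℝ}

/-- The coefficients of the part of `∑_p log ((1 - g(p) p^{-s})⁻¹ (1 - p^{-s})^δ)` linear
in `p^{-s}`, divided by `p`. -/
noncomputable def primeDefect (S : Set ℕ) (δ : ℝ) (n : ℕ) : ℝ :=
  if n.Prime then (smoothFun S n - δ) / n else 0

/-- The part of `log ((1 - g z)⁻¹ (1 - z)^δ)` of order `z²`. -/
noncomputable def logRemainder (δ g z : ℝ) : ℝ :=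
  -(Real.log (1 - g * z) + g * z) + δ * (Real.log (1 - z) + z)

lemma sum_range_eq_partialSum {a : ℕ → ℝ} (h0 : a 0 = 0) (N : ℕ) :
    ∑ n ∈ Finset.range (N + 1), a n = partialSum a N := by
  rw [partialSum, Nat.floor_natCast]
  induction N with
  | zero => simp [h0]
  | succ n ih => rw [Finset.sum_range_succ, ih, Finset.sum_Ioc_succ_top (Nat.zero_le n)]

/-- The series `∑_p (g(p) - δ)/p` converges, by Dirichlet's test: the sums
`∑_{p ≤ x} (g(p) - δ) log p / p` are bounded. -/
lemma exists_tendsto_sum_primeDefect (hB : ConditionB S δ) :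
    ∃ β, Tendsto (fun N : ℕ => ∑ n ∈ Finset.range N, primeDefect S δ n) atTop (𝓝 β) := by
  obtain ⟨ρ, c, hρ, hb⟩ := exists_primeLog_bound hB
  obtain ⟨B, hBlim⟩ := exists_tendsto_partialSum_div hρ hb
  obtain ⟨K, hK⟩ := exists_abs_partialSum_log_div_prime_sub_log_le
  obtain ⟨K', hK'⟩ := (Metric.isBounded_range_of_tendsto _
    (hBlim.comp tendsto_natCast_atTop_atTop)).exists_norm_le
  set z : ℕ → ℝ := fun n => primeDefect S δ n * Real.log n
  have hδ : 0 < δ := hB.1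
  have hz : ∀ N, ‖∑ n ∈ Finset.range N, z n‖ ≤ K' + δ * K := by
    intro N
    have hK0 : 0 ≤ K := (abs_nonneg _).trans (hK 1 le_rfl)
    have hK'0 : 0 ≤ K' := (norm_nonneg _).trans (hK' _ ⟨0, rfl⟩)
    rcases Nat.lt_or_ge N 2 with hN | hN
    · have : ∑ n ∈ Finset.range N, z n = 0 := Finset.sum_eq_zero fun n hn => by
        have : n = 0 := by have := Finset.mem_range.1 hn; omega
        simp [z, this]
      rw [this, norm_zero]
      positivity
    obtain ⟨M, rfl⟩ : ∃ M, N = M + 1 := ⟨N - 1, by omega⟩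
    have hM : (1 : ℝ) ≤ M := by exact_mod_cast (by omega : 1 ≤ M)
    rw [sum_range_eq_partialSum (by simp [z])]
    have h1 := hK M hM
    have h2 : |partialSum (fun n => primeLog S n / n) M - δ * Real.log M| ≤ K' := hK' _ ⟨M, rfl⟩
    have h3 : partialSum z M = (partialSum (fun n => primeLog S n / n) M - δ * Real.log M)
        - δ * (partialSum (fun n => if n.Prime then Real.log n / n else 0) M - Real.log M) := by
      rw [mul_sub, sub_sub_sub_cancel_right]
      simp only [partialSum]
      rw [Finset.mul_sum, ← Finset.sum_sub_distrib]
      refine Finset.sum_congr rfl fun n _ => ?_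
      simp only [z, primeDefect, primeLog]
      split_ifs <;> ring
    rw [h3, Real.norm_eq_abs]
    refine (abs_sub _ _).trans (add_le_add h2 ?_)
    rw [abs_mul, abs_of_pos hδ]
    gcongr
  set φ : ℕ → ℝ := fun n => 1 / Real.log (max n 2 : ℕ)
  have hlogpos : ∀ n : ℕ, 0 < Real.log (max n 2 : ℕ) := fun n =>
    Real.log_pos (by exact_mod_cast (by omega : 1 < max n 2))
  have hφ : Antitone φ := fun m n hmn =>
    one_div_le_one_div_of_le (hlogpos m) (Real.log_le_log
      (by exact_mod_cast (by omega : 0 < max m 2))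
      (by exact_mod_cast (by omega : max m 2 ≤ max n 2)))
  have hφ0 : Tendsto φ atTop (𝓝 0) := by
    have h1 : Tendsto (fun n : ℕ => ((max n 2 : ℕ) : ℝ)) atTop atTop :=
      tendsto_natCast_atTop_atTop.comp (tendsto_atTop_mono (fun n => le_max_left n 2) tendsto_id)
    simp only [φ, one_div]
    exact (Real.tendsto_log_atTop.comp h1).inv_tendsto_atTop
  obtain ⟨β, hβ⟩ := cauchySeq_tendsto_of_complete
    (hφ.cauchySeq_series_mul_of_tendsto_zero_of_bounded hφ0 hz)
  refine ⟨β, hβ.congr fun N => Finset.sum_congr rfl fun n _ => ?_⟩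
  simp only [z, φ, smul_eq_mul]
  by_cases hn : n.Prime
  · have := hlogpos n
    rw [max_eq_left hn.two_le] at this ⊢
    field_simp
  · simp [primeDefect, hn]

lemma abs_log_one_sub_add_le {z : ℝ} (h0 : 0 ≤ z) (h1 : z ≤ 1 / 2) :
    |Real.log (1 - z) + z| ≤ 2 * z ^ 2 := by
  have h := Real.abs_log_sub_add_sum_range_le (x := z) (by rw [abs_of_nonneg h0]; linarith) 1
  simp only [Finset.sum_range_one, zero_add, pow_one, Nat.cast_zero, div_one, abs_of_nonneg h0] at h
  rw [add_comm]
  refine h.trans ?_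
  rw [div_le_iff₀ (by linarith), show 1 + 1 = 2 from rfl]
  nlinarith [sq_nonneg z]

lemma abs_logRemainder_le (hδ : 0 ≤ δ) {g z : ℝ} (hg0 : 0 ≤ g) (hg1 : g ≤ 1) (h0 : 0 ≤ z)
    (h1 : z ≤ 1 / 2) : |logRemainder δ g z| ≤ (2 + 2 * δ) * z ^ 2 := by
  have hgz : g * z ≤ z := mul_le_of_le_one_left h0 hg1
  have hgz0 : 0 ≤ g * z := mul_nonneg hg0 h0
  have h2 := abs_log_one_sub_add_le hgz0 (hgz.trans h1)
  have h3 := abs_log_one_sub_add_le h0 h1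
  have h4 : (g * z) ^ 2 ≤ z ^ 2 := by gcongr
  have h5 : δ * |Real.log (1 - z) + z| ≤ δ * (2 * z ^ 2) := by gcongr
  refine (abs_add_le _ _).trans ?_
  rw [abs_neg, abs_mul, abs_of_nonneg hδ]
  linarith

lemma rpow_neg_le_half {p : ℕ} (hp : p.Prime) {s : ℝ} (hs : 1 ≤ s) :
    (p : ℝ) ^ (-s) ≤ 1 / 2 := by
  have h2 : (2 : ℝ) ≤ p := by exact_mod_cast hp.two_le
  calc (p : ℝ) ^ (-s) ≤ (p : ℝ) ^ (-1 : ℝ) := by gcongr; linarith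
    _ = 1 / p := by rw [Real.rpow_neg_one, one_div]
    _ ≤ 1 / 2 := by gcongr

/-- The logarithm of the Euler factor of `L_g(s) ζ(s)^{-δ}` at `s = 1 + ε`, split into its linear
part and the remainder. -/
lemma euler_factor_eq_exp {p : ℕ} (hp : p.Prime) {ε : ℝ} (hε : 0 ≤ ε) :
    (1 - smoothFun S p * (p : ℝ) ^ (-(1 + ε)))⁻¹ * (1 - (p : ℝ) ^ (-(1 + ε))) ^ δ
      = Real.exp (primeDefect S δ p * (p : ℝ) ^ (-ε)
        + logRemainder δ (smoothFun S p) ((p : ℝ) ^ (-(1 + ε)))) := by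
  have hz := rpow_neg_le_half hp (show 1 ≤ 1 + ε by linarith)
  have hz0 : 0 ≤ (p : ℝ) ^ (-(1 + ε)) := by positivity
  have hgz : smoothFun S p * (p : ℝ) ^ (-(1 + ε)) ≤ (p : ℝ) ^ (-(1 + ε)) :=
    mul_le_of_le_one_left hz0 (smoothFun_le_one p)
  have hp0 : (0 : ℝ) < p := by exact_mod_cast hp.pos
  have h1 : primeDefect S δ p * (p : ℝ) ^ (-ε) = (smoothFun S p - δ) * (p : ℝ) ^ (-(1 + ε)) := by
    rw [primeDefect, if_pos hp, show -(1 + ε) = -ε - 1 by ring, Real.rpow_sub_one hp0.ne']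
    ring
  rw [h1, logRemainder]
  set z := (p : ℝ) ^ (-(1 + ε))
  rw [show (smoothFun S p - δ) * z + (-(Real.log (1 - smoothFun S p * z) + smoothFun S p * z)
      + δ * (Real.log (1 - z) + z)) = -Real.log (1 - smoothFun S p * z) + Real.log (1 - z) * δ by
    ring, Real.exp_add, Real.exp_neg, Real.exp_log (by linarith),
    Real.rpow_def_of_pos (by linarith)]

/-- `n ↦ g(n) n^{-s}` as a monoid homomorphism. -/
noncomputable def smoothHom (S : Set ℕ) (s : ℝ) : ℕ →*₀ ℝ where
  toFun n := smoothFun S n * (n : ℝ) ^ (-s)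
  map_zero' := by simp
  map_one' := by simp [smoothFun_one]
  map_mul' a b := by
    rw [smoothFun_mul, Nat.cast_mul, Real.mul_rpow a.cast_nonneg b.cast_nonneg]
    ring

lemma summable_smoothFun {s : ℝ} (hs : 1 < s) :
    Summable fun n : ℕ => smoothFun S n * (n : ℝ) ^ (-s) :=
  Summable.of_nonneg_of_le (fun n => mul_nonneg (smoothFun_nonneg n) (by positivity))
    (fun n => mul_le_of_le_one_left (by positivity) (smoothFun_le_one n))
    (Real.summable_nat_rpow.2 (show -s < -1 by linarith))

lemma tendsto_prod_smoothFun {s : ℝ} (hs : 1 < s) :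
    Tendsto (fun P : ℕ => ∏ p ∈ Nat.primesBelow P, (1 - smoothFun S p * (p : ℝ) ^ (-s))⁻¹) atTop
      (𝓝 (∑' n : ℕ, smoothFun S n * (n : ℝ) ^ (-s))) :=
  EulerProduct.eulerProduct_completely_multiplicative (f := smoothHom S s)
    (summable_smoothFun hs).norm

lemma smoothFun_univ {n : ℕ} (hn : n ≠ 0) : smoothFun Set.univ n = 1 := by
  classical
  rw [smoothFun_apply, if_pos ⟨hn, fun _ _ _ => trivial⟩]

lemma tendsto_prod_zeta {s : ℝ} (hs : 1 < s) :
    Tendsto (fun P : ℕ => ∏ p ∈ Nat.primesBelow P, (1 - (p : ℝ) ^ (-s))⁻¹) atTop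
      (𝓝 (∑' n : ℕ, (n : ℝ) ^ (-s))) := by
  have h := tendsto_prod_smoothFun (S := Set.univ) hs
  have h1 : ∑' n : ℕ, smoothFun Set.univ n * (n : ℝ) ^ (-s) = ∑' n : ℕ, (n : ℝ) ^ (-s) := by
    refine tsum_congr fun n => ?_
    rcases eq_or_ne n 0 with rfl | hn
    · simp [Real.zero_rpow (show -s ≠ 0 by linarith)]
    · rw [smoothFun_univ hn, one_mul]
  rw [h1] at h
  refine h.congr fun P => Finset.prod_congr rfl fun p hp => ?_
  rw [smoothFun_univ (Nat.prime_of_mem_primesBelow hp).ne_zero, one_mul]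

lemma one_le_tsum_rpow {s : ℝ} (hs : 1 < s) : 1 ≤ ∑' n : ℕ, (n : ℝ) ^ (-s) := by
  have h1 := (Real.summable_nat_rpow.2 (show -s < -1 by linarith)).le_tsum 1
    fun n _ => by positivity
  simpa using h1

/-- The remainder in the logarithm of the Euler product, at `s = 1 + ε`. -/
noncomputable def eulerRemainder (S : Set ℕ) (δ ε : ℝ) (n : ℕ) : ℝ :=
  if n.Prime then logRemainder δ (smoothFun S n) ((n : ℝ) ^ (-(1 + ε))) else 0

lemma abs_eulerRemainder_le (hδ : 0 ≤ δ) {ε : ℝ} (hε : 0 ≤ ε) (n : ℕ) :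
    |eulerRemainder S δ ε n| ≤ (2 + 2 * δ) * (n : ℝ) ^ (-2 : ℝ) := by
  unfold eulerRemainder
  split_ifs with hn
  · refine (abs_logRemainder_le hδ (smoothFun_nonneg n) (smoothFun_le_one n) (by positivity)
      (rpow_neg_le_half hn (by linarith))).trans ?_
    have h1 : (1 : ℝ) ≤ n := by exact_mod_cast hn.one_lt.le
    rw [← Real.rpow_natCast, ← Real.rpow_mul n.cast_nonneg]
    gcongr
    push_cast
    linarith
  · rw [abs_zero]
    positivity

lemma summable_eulerRemainder (hδ : 0 ≤ δ) {ε : ℝ} (hε : 0 ≤ ε) :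
    Summable (eulerRemainder S δ ε) :=
  Summable.of_norm_bounded ((Real.summable_nat_rpow.2 (by norm_num)).mul_left (2 + 2 * δ))
    (abs_eulerRemainder_le hδ hε)

lemma tendsto_tsum_eulerRemainder (hδ : 0 ≤ δ) :
    Tendsto (fun ε => ∑' n, eulerRemainder S δ ε n) (𝓝[>] 0)
      (𝓝 (∑' n, eulerRemainder S δ 0 n)) := by
  refine tendsto_tsum_of_dominated_convergence
    ((Real.summable_nat_rpow.2 (show (-2 : ℝ) < -1 by norm_num)).mul_left (2 + 2 * δ))
    (fun n => ?_) ?_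
  · unfold eulerRemainder
    split_ifs with hn
    · refine Tendsto.mono_left ?_ nhdsWithin_le_nhds
      have hn0 : (n : ℝ) ≠ 0 := by exact_mod_cast hn.ne_zero
      have hz := rpow_neg_le_half hn (show (1 : ℝ) ≤ 1 + 0 by norm_num)
      have hz0 : 0 ≤ (n : ℝ) ^ (-(1 + 0 : ℝ)) := by positivity
      have hgz : smoothFun S n * (n : ℝ) ^ (-(1 + 0 : ℝ)) ≤ (n : ℝ) ^ (-(1 + 0 : ℝ)) :=
        mul_le_of_le_one_left hz0 (smoothFun_le_one n)
      have hc : ContinuousAt (fun ε : ℝ => (n : ℝ) ^ (-(1 + ε))) 0 :=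
        ContinuousAt.rpow continuousAt_const (by fun_prop) (Or.inl hn0)
      have hc1 : ContinuousAt (fun ε : ℝ => Real.log (1 - (n : ℝ) ^ (-(1 + ε)))) 0 :=
        (continuousAt_const.sub hc).log
          (sub_pos.2 (hz.trans_lt one_half_lt_one)).ne'
      have hc2 : ContinuousAt
          (fun ε : ℝ => Real.log (1 - smoothFun S n * (n : ℝ) ^ (-(1 + ε)))) 0 :=
        (continuousAt_const.sub (continuousAt_const.mul hc)).log
          (sub_pos.2 ((hgz.trans hz).trans_lt one_half_lt_one)).ne'
      unfold logRemainder
      exact ((hc2.add (continuousAt_const.mul hc)).neg.add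
        (continuousAt_const.mul (hc1.add hc))).tendsto
    · exact tendsto_const_nhds
  · filter_upwards [self_mem_nhdsWithin] with ε hε n
    exact abs_eulerRemainder_le hδ (le_of_lt hε) n

lemma prod_primesBelow_eq_exp {ε : ℝ} (hε : 0 ≤ ε) (P : ℕ) :
    ∏ p ∈ Nat.primesBelow P,
        ((1 - smoothFun S p * (p : ℝ) ^ (-(1 + ε)))⁻¹ * (1 - (p : ℝ) ^ (-(1 + ε))) ^ δ)
      = Real.exp (∑ n ∈ Finset.range P, primeDefect S δ n * (n : ℝ) ^ (-ε)
        + ∑ n ∈ Finset.range P, eulerRemainder S δ ε n) := by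
  rw [← Finset.sum_add_distrib, Real.exp_sum, Nat.primesBelow, Finset.prod_filter]
  refine Finset.prod_congr rfl fun p _ => ?_
  split_ifs with hp
  · rw [euler_factor_eq_exp hp hε, eulerRemainder, if_pos hp]
  · simp [primeDefect, eulerRemainder, hp]

lemma summable_primeDefect (hδ : 0 ≤ δ) {ε : ℝ} (hε : 0 < ε) :
    Summable fun n : ℕ => primeDefect S δ n * (n : ℝ) ^ (-ε) := by
  refine Summable.of_norm_bounded
    ((Real.summable_nat_rpow.2 (show -(1 + ε) < -1 by linarith)).mul_left (1 + δ)) fun n => ?_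
  unfold primeDefect
  split_ifs with hn
  · have hn0 : (0 : ℝ) < n := by exact_mod_cast hn.pos
    rw [norm_mul, norm_div, Real.norm_natCast, Real.norm_eq_abs, Real.norm_of_nonneg (by positivity),
      show -(1 + ε) = -ε - 1 by ring, Real.rpow_sub_one hn0.ne']
    have h1 : |smoothFun S n - δ| ≤ 1 + δ := by
      have := smoothFun_nonneg (S := S) n
      have := smoothFun_le_one (S := S) n
      rw [abs_le]
      constructor <;> linarith
    calc |smoothFun S n - δ| / n * (n : ℝ) ^ (-ε) ≤ (1 + δ) / n * (n : ℝ) ^ (-ε) := by gcongr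
      _ = _ := by ring
  · rw [zero_mul, norm_zero]
    positivity

/-- For `ε > 0` the Euler product of `L_g(1 + ε) ζ(1 + ε)^{-δ}`, in exponential form. -/
lemma tsum_smoothFun_mul_rpow_eq_exp (hδ : 0 ≤ δ) {ε : ℝ} (hε : 0 < ε) :
    (∑' n : ℕ, smoothFun S n * (n : ℝ) ^ (-(1 + ε)))
        * (∑' n : ℕ, (n : ℝ) ^ (-(1 + ε))) ^ (-δ)
      = Real.exp (∑' n : ℕ, primeDefect S δ n * (n : ℝ) ^ (-ε) + ∑' n, eulerRemainder S δ ε n) := by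
  have hs : 1 < 1 + ε := by linarith
  have h1 := tendsto_prod_smoothFun (S := S) hs
  have h2 := (tendsto_prod_zeta hs).rpow_const (p := -δ)
    (Or.inl (by linarith [one_le_tsum_rpow hs]))
  have h3 := ((summable_primeDefect (S := S) hδ hε).hasSum.tendsto_sum_nat.add
    (summable_eulerRemainder (S := S) hδ hε.le).hasSum.tendsto_sum_nat).rexp
  refine tendsto_nhds_unique (h1.mul h2) (h3.congr fun P => ?_)
  rw [← prod_primesBelow_eq_exp hε.le, Finset.prod_mul_distrib]
  congr 1
  have hz : ∀ p ∈ Nat.primesBelow P, 0 < 1 - (p : ℝ) ^ (-(1 + ε)) := fun p hp => by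
    linarith [rpow_neg_le_half (Nat.prime_of_mem_primesBelow hp) hs.le]
  rw [← Real.finsetProd_rpow _ _ (fun p hp => inv_nonneg.2 (hz p hp).le)]
  refine Finset.prod_congr rfl fun p hp => ?_
  rw [Real.inv_rpow (hz p hp).le, Real.rpow_neg (hz p hp).le, inv_inv]

/-- `L_g(1 + ε) ζ(1 + ε)^{-δ}` tends to `A Γ(δ + 1)`. -/
lemma tendsto_tsum_smoothFun_mul_rpow (hδ : 0 ≤ δ)
    (hA : Tendsto (fun u => partialSum (fun n => smoothFun S n / n) (Real.exp u) / u ^ δ) atTop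
      (𝓝 A)) :
    Tendsto (fun ε : ℝ => (∑' n : ℕ, smoothFun S n * (n : ℝ) ^ (-(1 + ε)))
        * (∑' n : ℕ, (n : ℝ) ^ (-(1 + ε))) ^ (-δ)) (𝓝[>] 0) (𝓝 (A * Real.Gamma (δ + 1))) := by
  have hterm : ∀ (a : ℝ) (n : ℕ) (ε : ℝ), 0 < ε →
      a / n * (n : ℝ) ^ (-ε) = a * (n : ℝ) ^ (-(1 + ε)) := by
    intro a n ε hε
    rcases eq_or_ne n 0 with rfl | hn
    · rw [Nat.cast_zero, div_zero, zero_mul, Real.zero_rpow (by linarith), mul_zero]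
    · have hn' : (n : ℝ) ≠ 0 := by exact_mod_cast hn
      rw [show -(1 + ε) = -ε - 1 by ring, Real.rpow_sub_one hn']
      ring
  have h1 := tendsto_rpow_mul_tsum hδ (fun ε hε => (summable_smoothFun (S := S)
    (show 1 < 1 + ε by linarith)).congr fun n => (hterm _ n ε hε).symm) hA
  have h2 : Tendsto (fun v => partialSum (fun n => 1 / (n : ℝ)) (Real.exp v) / v ^ (1 : ℝ)) atTop
      (𝓝 1) := by
    have := (tendsto_partialSum_one_div.mul tendsto_inv_atTop_zero).add_const 1
    rw [mul_zero, zero_add] at this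
    refine this.congr' ?_
    filter_upwards [eventually_gt_atTop 0] with v hv
    rw [Real.rpow_one]
    field_simp
    ring
  have h3 := tendsto_rpow_mul_tsum zero_le_one (fun ε hε =>
    (Real.summable_nat_rpow.2 (show -(1 + ε) < -1 by linarith)).congr fun n => by
      rw [hterm _ n ε hε, one_mul]) h2
  rw [show (1 : ℝ) + 1 = 2 by norm_num, Real.Gamma_two, one_mul] at h3
  have h4 := h3.rpow_const (p := -δ) (Or.inl one_ne_zero)
  rw [Real.one_rpow] at h4
  have h5 := h1.mul h4
  rw [mul_one] at h5
  refine h5.congr' ?_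
  filter_upwards [self_mem_nhdsWithin] with ε hε
  rw [Set.mem_Ioi] at hε
  rw [tsum_congr fun n => hterm (smoothFun S n) n ε hε, tsum_congr fun n => hterm 1 n ε hε]
  simp only [one_mul, Real.rpow_one]
  have h6 := one_le_tsum_rpow (show 1 < 1 + ε by linarith)
  rw [Real.mul_rpow hε.le (by linarith), Real.rpow_neg hε.le]
  have : ε ^ δ ≠ 0 := (Real.rpow_pos_of_pos hε δ).ne'
  field_simp

/-- The Mertens product `∏_{p < P} (1 - g(p)/p)⁻¹ (1 - 1/p)^δ` converges to `A Γ(δ + 1)`: its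
logarithm converges by Dirichlet's test, and the limit is found by Abel summation. -/
lemma tendsto_prod_primesBelow (hB : ConditionB S δ)
    (hA : Tendsto (fun u => partialSum (fun n => smoothFun S n / n) (Real.exp u) / u ^ δ) atTop
      (𝓝 A)) :
    Tendsto (fun P : ℕ => ∏ p ∈ Nat.primesBelow P,
      ((1 - smoothFun S p / p)⁻¹ * (1 - 1 / (p : ℝ)) ^ δ)) atTop
      (𝓝 (A * Real.Gamma (δ + 1))) := by
  have hδ : 0 ≤ δ := hB.1.le
  obtain ⟨β, hβ⟩ := exists_tendsto_sum_primeDefect hB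
  have hpart : Tendsto (fun v => partialSum (primeDefect S δ) (Real.exp v) / v ^ (0 : ℝ)) atTop
      (𝓝 β) := by
    have h1 : Tendsto (fun v => ⌊Real.exp v⌋₊ + 1) atTop atTop :=
      (tendsto_add_atTop_nat 1).comp (tendsto_nat_floor_atTop.comp Real.tendsto_exp_atTop)
    refine (hβ.comp h1).congr fun v => ?_
    simp only [Function.comp]
    rw [sum_range_eq_partialSum (by simp [primeDefect]), Real.rpow_zero, div_one, partialSum,
      partialSum, Nat.floor_natCast]
  have h1 := tendsto_rpow_mul_tsum le_rfl (fun ε hε => summable_primeDefect hδ hε) hpart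
  simp only [Real.rpow_zero, one_mul, zero_add, Real.Gamma_one, mul_one] at h1
  have h2 := (h1.add (tendsto_tsum_eulerRemainder (S := S) hδ)).rexp
  have h3 : Real.exp (β + ∑' n, eulerRemainder S δ 0 n) = A * Real.Gamma (δ + 1) := by
    refine tendsto_nhds_unique h2 ((tendsto_tsum_smoothFun_mul_rpow hδ hA).congr' ?_)
    filter_upwards [self_mem_nhdsWithin] with ε hε
    exact tsum_smoothFun_mul_rpow_eq_exp hδ hε
  rw [← h3]
  refine ((hβ.add (summable_eulerRemainder (S := S) hδ le_rfl).hasSum.tendsto_sum_nat).rexp).congr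
    fun P => ?_
  have h4 := prod_primesBelow_eq_exp (S := S) (δ := δ) le_rfl P
  simp only [neg_zero, Real.rpow_zero, mul_one, add_zero, Real.rpow_neg_one] at h4
  rw [← h4]
  simp only [div_eq_mul_inv, one_mul]

/-- The Landau constant is `δ A H`, where `H = ∑ h(n)/n`. -/
theorem isLandauConstant (hS : IsMultiplicativeSet S) (hB : ConditionB S δ)
    (hA : Tendsto (fun u => partialSum (fun n => smoothFun S n / n) (Real.exp u) / u ^ δ) atTop
      (𝓝 A)) :
    IsLandauConstant S δ (δ * A * ∑' n : ℕ, correctionFun S n / n) := by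
  have hδ := hB.1
  have h1 := ((tendsto_prod_correctionFun hS).mul (tendsto_prod_primesBelow hB hA)).const_mul
    (1 / Real.Gamma δ)
  have h2 : 1 / Real.Gamma δ * ((∑' n : ℕ, correctionFun S n / n) * (A * Real.Gamma (δ + 1)))
      = δ * A * ∑' n : ℕ, correctionFun S n / n := by
    have := (Real.Gamma_pos_of_pos hδ).ne'
    rw [Real.Gamma_add_one hδ.ne']
    field_simp
  rw [h2] at h1
  refine h1.congr fun P => ?_
  rw [← Finset.prod_mul_distrib]
  congr 1
  refine Finset.prod_congr rfl fun p hp => ?_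
  have hp' := Nat.prime_of_mem_primesBelow hp
  have h3 : (2 : ℝ) ≤ p := by exact_mod_cast hp'.two_le
  have h4 : (1 - smoothFun S p / p) ≠ 0 := by
    have : smoothFun S p / p ≤ 1 / 2 := by
      have := smoothFun_le_one (S := S) p
      gcongr
    linarith
  rw [mul_assoc, mul_inv_cancel_left₀ h4]

end

end MultiplicativeSets

/-! ### A lower bound for the Euler-Kronecker constant in density one -/

namespace MultiplicativeSets

open Filter Topology ArithmeticFunction

section

lemma one_sub_mul_tsum_le {c : ℕ → ℝ} (hc0 : c 0 = 1) (hcnn : ∀ k, 0 ≤ c k) (hc1 : ∀ k, c k ≤ 1)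
    {z w : ℝ} (hz : 0 ≤ z) (hzw : z ≤ w) (hw : w ≤ 1 / 2) :
    (1 - w) * ∑' k, c k * w ^ k ≤ (1 - z) * ∑' k, c k * z ^ k := by
  -- `1 - (1 - x) ∑ c_k x^k = ∑_{k ≥ 1} (1 - c_k) (x^k - x^{k+1})`, which increases on `[0, 1/2]`.
  have hgeo : ∀ x : ℝ, 0 ≤ x → x ≤ 1 / 2 →
      Summable (fun k => (1 - c k) * ((1 - x) * x ^ k)) ∧
        (1 - x) * ∑' k, c k * x ^ k = 1 - ∑' k, (1 - c k) * ((1 - x) * x ^ k) := by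
    intro x hx hx1
    have h1 : Summable fun k => x ^ k := summable_geometric_of_lt_one hx (by linarith)
    have h2 : Summable fun k => c k * x ^ k :=
      Summable.of_nonneg_of_le (fun k => mul_nonneg (hcnn k) (by positivity))
        (fun k => mul_le_of_le_one_left (by positivity) (hc1 k)) h1
    have h3 : ∀ k, (1 - c k) * ((1 - x) * x ^ k) = (1 - x) * (x ^ k - c k * x ^ k) :=
      fun k => by ring
    refine ⟨((h1.sub h2).mul_left (1 - x)).congr fun k => (h3 k).symm, ?_⟩
    rw [tsum_congr h3, tsum_mul_left, h1.tsum_sub h2, tsum_geometric_of_lt_one hx (by linarith),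
      mul_sub, mul_inv_cancel₀ (by linarith)]
    ring
  obtain ⟨hs1, he1⟩ := hgeo w (hz.trans hzw) hw
  obtain ⟨hs2, he2⟩ := hgeo z hz (hzw.trans hw)
  rw [he1, he2]
  refine sub_le_sub_left (hs2.tsum_le_tsum (fun k => ?_) hs1) 1
  rcases k with _ | k
  · simp [hc0]
  · refine mul_le_mul_of_nonneg_left ?_ (by linarith [hc1 (k + 1)])
    have h1 : (1 - z) * z ≤ (1 - w) * w := by nlinarith
    have h2 : z ^ k ≤ w ^ k := by gcongr
    calc (1 - z) * z ^ (k + 1) = (1 - z) * z * z ^ k := by ring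
      _ ≤ (1 - w) * w * w ^ k := by
        refine mul_le_mul h1 h2 (by positivity) (mul_nonneg (by linarith) (by linarith))
      _ = (1 - w) * w ^ (k + 1) := by ring

variable {S : Set ℕ}

lemma tendsto_prod_charFun (hS : IsMultiplicativeSet S) {s : ℝ} (hs : 1 < s) :
    Tendsto (fun P : ℕ => ∏ p ∈ Nat.primesBelow P,
      ((1 - (p : ℝ) ^ (-s)) * ∑' k : ℕ, charFun S (p ^ k) * ((p : ℝ) ^ (-s)) ^ k)) atTop
      (𝓝 ((∑' n : ℕ, charFun S n * (n : ℝ) ^ (-s)) / ∑' n : ℕ, (n : ℝ) ^ (-s))) := by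
  have hm := charFun_isMultiplicative hS
  have h1 := EulerProduct.eulerProduct (f := fun n : ℕ => charFun S n * (n : ℝ) ^ (-s))
    (by simp [hm.map_one])
    (fun {m n} hmn => by
      rw [hm.map_mul_of_coprime hmn, Nat.cast_mul, Real.mul_rpow m.cast_nonneg n.cast_nonneg]
      ring)
    (summable_charFun hs).norm (by simp)
  have h2 := (tendsto_prod_zeta hs).inv₀ (by linarith [one_le_tsum_rpow hs])
  rw [div_eq_inv_mul]
  refine (h2.mul h1).congr fun P => ?_
  rw [← Finset.prod_inv_distrib, ← Finset.prod_mul_distrib]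
  refine Finset.prod_congr rfl fun p _ => ?_
  rw [inv_inv]
  congr 1
  refine tsum_congr fun k => ?_
  rw [Nat.cast_pow, ← Real.rpow_natCast, ← Real.rpow_natCast, ← Real.rpow_mul p.cast_nonneg,
    ← Real.rpow_mul p.cast_nonneg, mul_comm (k : ℝ)]

/-- `L_S(s)/ζ(s)` increases with `s`, since each of its Euler factors does. -/
lemma tsum_charFun_div_le (hS : IsMultiplicativeSet S) {s t : ℝ} (hs : 1 < s) (hst : s ≤ t) :
    (∑' n : ℕ, charFun S n * (n : ℝ) ^ (-s)) / (∑' n : ℕ, (n : ℝ) ^ (-s))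
      ≤ (∑' n : ℕ, charFun S n * (n : ℝ) ^ (-t)) / ∑' n : ℕ, (n : ℝ) ^ (-t) := by
  refine le_of_tendsto_of_tendsto' (tendsto_prod_charFun hS hs)
    (tendsto_prod_charFun hS (hs.trans_le hst)) fun P => Finset.prod_le_prod (fun p hp => ?_)
    fun p hp => ?_
  · have hp' := Nat.prime_of_mem_primesBelow hp
    have := rpow_neg_le_half hp' hs.le
    exact mul_nonneg (by linarith)
      (tsum_nonneg fun k => mul_nonneg (charFun_nonneg _) (by positivity))
  · have hp' := Nat.prime_of_mem_primesBelow hp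
    have hp1 : (1 : ℝ) ≤ p := by exact_mod_cast hp'.one_lt.le
    refine one_sub_mul_tsum_le (c := fun k => charFun S (p ^ k)) ?_ (fun _ => charFun_nonneg _)
      (fun _ => charFun_le_one _) (by positivity) ?_ (rpow_neg_le_half hp' hs.le)
    · simp [(charFun_isMultiplicative hS).map_one]
    · gcongr

lemma dirichletSeries_ofReal (hS : IsMultiplicativeSet S) {s : ℝ} (hs : 1 < s) :
    dirichletSeries S s = ((∑' n : ℕ, charFun S n * (n : ℝ) ^ (-s) : ℝ) : ℂ) := by
  rw [dirichletSeries_eq hS, LSeries_ofReal _ (by linarith)]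

lemma re_logDeriv_riemannZeta_le (hS : IsMultiplicativeSet S) {s : ℝ} (hs : 1 < s) :
    (deriv riemannZeta s / riemannZeta s).re
      ≤ (deriv (dirichletSeries S) s / dirichletSeries S s).re := by
  have hs' : 1 < (s : ℂ).re := by simpa using hs
  have hL0 := dirichletSeries_ne_zero hS hs
  have hZ0 : riemannZeta s ≠ 0 := riemannZeta_ne_zero_of_one_lt_re hs'
  have hL : DifferentiableAt ℂ (dirichletSeries S) s := by
    rw [dirichletSeries_eq hS]
    exact (LSeries_hasDerivAt (one_lt_re_of_abscissa abscissaOfAbsConv_charFun hs')).differentiableAt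
  have hZ : DifferentiableAt ℂ riemannZeta s := differentiableAt_riemannZeta (by
    intro h
    rw [h] at hs'
    simp at hs')
  have hq := (hL.hasDerivAt.div hZ.hasDerivAt hZ0).real_of_complex
  set r : ℝ → ℝ := fun t =>
    (∑' n : ℕ, charFun S n * (n : ℝ) ^ (-t)) / ∑' n : ℕ, (n : ℝ) ^ (-t)
  have hr : ∀ t : ℝ, 1 < t → dirichletSeries S t / riemannZeta t = (r t : ℂ) := fun t ht => by
    rw [dirichletSeries_ofReal hS ht, riemannZeta_ofReal ht, ← Complex.ofReal_div]
  have hev : r =ᶠ[𝓝 s] fun t : ℝ => ((dirichletSeries S / riemannZeta) (t : ℂ)).re := by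
    filter_upwards [eventually_gt_nhds hs] with t ht
    rw [Pi.div_apply, hr t ht, Complex.ofReal_re]
  have hd := hq.congr_of_eventuallyEq hev
  have hmono : MonotoneOn r (Set.Ioi 1) := fun a ha b _ hab => tsum_charFun_div_le hS ha hab
  have hnn := hmono.derivWithin_nonneg (x := s)
  rw [hd.hasDerivWithinAt.derivWithin (isOpen_Ioi.uniqueDiffWithinAt hs)] at hnn
  have hfac : (deriv (dirichletSeries S) s * riemannZeta s - dirichletSeries S s
      * deriv riemannZeta s) / riemannZeta s ^ 2
      = (r s : ℂ) * (deriv (dirichletSeries S) s / dirichletSeries S s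
        - deriv riemannZeta s / riemannZeta s) := by
    rw [← hr s hs]
    field_simp
  rw [hfac, Complex.re_ofReal_mul, Complex.sub_re] at hnn
  have hrpos : 0 < r s := by
    have h1 : (r s : ℂ) ≠ 0 := by rw [← hr s hs]; exact div_ne_zero hL0 hZ0
    have h2 : 0 ≤ r s := div_nonneg
      (tsum_nonneg fun n => mul_nonneg (charFun_nonneg n) (by positivity))
      (tsum_nonneg fun n => by positivity)
    exact lt_of_le_of_ne h2 fun h => h1 (by rw [← h, Complex.ofReal_zero])
  linarith [nonneg_of_mul_nonneg_right hnn hrpos]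

/-- In density one the Euler-Kronecker constant is at least Euler's constant. -/
theorem eulerMascheroniConstant_le {γ : ℝ} (hS : IsMultiplicativeSet S)
    (hγ : IsEulerKroneckerConstant S 1 γ) : Real.eulerMascheroniConstant ≤ γ := by
  have hcast : Tendsto (fun s : ℝ => (s : ℂ)) (𝓝[>] 1) (𝓝[≠] 1) := by
    refine tendsto_nhdsWithin_iff.2 ⟨(Complex.continuous_ofReal.tendsto' 1 1
      Complex.ofReal_one).mono_left nhdsWithin_le_nhds, ?_⟩
    filter_upwards [self_mem_nhdsWithin] with s hs
    rw [Set.mem_Ioi] at hs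
    exact fun h => hs.ne' (Complex.ofReal_eq_one.1 h)
  have h1 := (Asymptotics.isLittleO_one_iff ℂ).1 log_deriv_riemannZeta_add_inv_sub_sub_isLittleO
  have h2 := (Complex.continuous_re.tendsto _).comp (h1.comp hcast)
  have h3 := (Complex.continuous_re.tendsto _).comp hγ
  rw [Complex.zero_re] at h2
  rw [Complex.ofReal_re] at h3
  have h4 := h3.sub (h2.add_const Real.eulerMascheroniConstant)
  rw [zero_add] at h4
  refine sub_nonneg.1 (ge_of_tendsto h4 ?_)
  filter_upwards [self_mem_nhdsWithin] with s hs
  have h5 := re_logDeriv_riemannZeta_le hS hs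
  simp only [Function.comp, Complex.add_re, Complex.sub_re, Complex.ofReal_re, Complex.ofReal_one,
    one_div]
  linarith

end

end MultiplicativeSets

/-! ### Comparison of the two approximations -/

namespace MultiplicativeSets

open Filter Topology ArithmeticFunction

section

variable {S : Set ℕ} {δ C γ : ℝ}

lemma count_eq_partialSum (hS : IsMultiplicativeSet S) (x : ℝ) :
    count S x = partialSum (charFun S) x := by
  classical
  have h : {n : ℕ | n ∈ S ∧ (n : ℝ) ≤ x}
      = ((Finset.Ioc 0 ⌊x⌋₊).filter fun n => n ∈ S : Finset ℕ) := by
    ext n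
    simp only [Set.mem_ofPred_eq, Finset.coe_filter, mem_Ioc_floor_iff]
    constructor
    · rintro ⟨h1, h2⟩
      exact ⟨⟨Nat.pos_of_ne_zero fun h0 => hS.zero_notMem (h0 ▸ h1), h2⟩, h1⟩
    · rintro ⟨⟨-, h2⟩, h1⟩
      exact ⟨h1, h2⟩
  rw [count, h, Set.ncard_coe_finset, Finset.card_filter, partialSum]
  push_cast
  refine Finset.sum_congr rfl fun n _ => ?_
  rw [charFun_apply hS, Set.indicator_apply, Pi.one_apply]

/-- `∫_2^x log^{δ-1} t dt = x log^{δ-1} x (1 + (1 - δ)/log x + o(1/log x))`. -/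
lemma tendsto_mul_integral_sub_one (δ : ℝ) :
    Tendsto (fun u => u * ((∫ t in (2 : ℝ)..Real.exp u, Real.log t ^ (δ - 1))
      / (Real.exp u * u ^ (δ - 1)) - 1)) atTop (𝓝 (1 - δ)) := by
  set f : ℝ → ℝ := fun u =>
    (∫ t in (2 : ℝ)..Real.exp u, Real.log t ^ (δ - 1)) - Real.exp u * u ^ (δ - 1)
  have hd : ∀ u : ℝ, 0 < u → HasDerivAt f ((1 - δ) * (Real.exp u * u ^ (δ - 2))) u := by
    intro u hu
    refine ((hasDerivAt_integral_log_rpow_exp (δ - 1) hu).sub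
      (hasDerivAt_exp_mul_rpow (δ - 1) hu)).congr_deriv ?_
    rw [show δ - 2 = δ - 1 - 1 by ring, Real.rpow_sub_one hu.ne' (δ - 1)]
    field_simp
    ring
  have h := tendsto_div_of_rightDeriv (f := f)
    (f' := fun u => (1 - δ) * (Real.exp u * u ^ (δ - 2))) (κ := δ - 2) (C := 1 - δ) (a := 1)
    (fun u hu => (hd u (zero_lt_one.trans_le hu)).continuousAt.continuousWithinAt)
    (fun u hu => (hd u (zero_lt_one.trans_le hu)).hasDerivWithinAt)
    (tendsto_const_nhds.congr' (by
      filter_upwards [eventually_gt_atTop 0] with u hu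
      have : Real.exp u * u ^ (δ - 2) ≠ 0 := by positivity
      field_simp))
  refine h.congr' ?_
  filter_upwards [eventually_gt_atTop 0] with u hu
  have h1 : u ^ (δ - 1) ≠ 0 := by positivity
  simp only [f]
  rw [show δ - 2 = δ - 1 - 1 by ring, Real.rpow_sub_one hu.ne' (δ - 1)]
  field_simp

/-- The second-order asymptotics of `S(x)`, in terms of the Landau constant `C` and the
Euler-Kronecker constant `γ`:
`S(x) = C x log^{δ-1} x (1 + (1 - δ)(1 - γ)/log x + o(1/log x))`. -/
theorem exists_secondOrder (hS : IsMultiplicativeSet S) (hB : ConditionB S δ) :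
    ∃ C γ : ℝ, 0 < C ∧ IsLandauConstant S δ C ∧ IsEulerKroneckerConstant S δ γ ∧
      Tendsto (fun u => u * (count S (Real.exp u) / (Real.exp u * u ^ (δ - 1)) - C)) atTop
        (𝓝 (C * ((1 - δ) * (1 - γ)))) := by
  have hδ := hB.1
  obtain ⟨ρ, c, hρ, hb⟩ := exists_smoothMangoldt_bound hB
  obtain ⟨K, hK⟩ := exists_bound_of_eventually smoothMangoldt_nonneg hδ hρ hb
  obtain ⟨B, hBlim⟩ := exists_tendsto_partialSum_div hρ hb
  have hψ : ∀ x, 1 ≤ x → partialSum (smoothMangoldt S) x ≤ (Real.log 4 + 4) * x := fun x hx =>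
    (Finset.sum_le_sum fun n _ => mul_le_of_le_one_right vonMangoldt_nonneg
      (smoothFun_le_one n)).trans (Chebyshev.psi_le_const_mul_self (by linarith))
  obtain ⟨A, hA, hM⟩ := exists_logarithmicSum_asymptotic smoothFun_nonneg smoothFun_one
    smoothMangoldt_nonneg smoothFun_mul_log hδ hψ hBlim
  have hG := tendsto_partialSum_secondOrder smoothFun_nonneg smoothFun_mul_log hδ hρ hK hBlim hA hM
  have hF := tendsto_partialSum_mul hδ smoothFun_nonneg smoothFun_le_one
    (summable_correctionFun hS (σ := 3 / 4) (by norm_num)) hG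
  rw [correctionFun_mul_smoothFun] at hF
  have hH : 0 < ∑' n : ℕ, correctionFun S n / n := by linarith [half_le_tsum_correctionFun hS]
  refine ⟨_, _, by positivity, isLandauConstant hS hB (tendsto_of_tendsto_mul_sub hM),
    isEulerKroneckerConstant hS hBlim, ?_⟩
  simp only [count_eq_partialSum hS]
  convert hF using 2
  field_simp
  ring

/-- If the error of an approximation `T₁`, on the scale `x log^{δ-2} x`, tends to a limit of smaller
absolute value than that of `T₂`, then `T₁` is eventually the better approximation. -/
lemma eventually_abs_sub_lt {F T₁ T₂ : ℝ → ℝ} {l₁ l₂ : ℝ}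
    (h₁ : Tendsto (fun u => u * ((F (Real.exp u) - T₁ (Real.exp u)) / (Real.exp u * u ^ (δ - 1))))
      atTop (𝓝 l₁))
    (h₂ : Tendsto (fun u => u * ((F (Real.exp u) - T₂ (Real.exp u)) / (Real.exp u * u ^ (δ - 1))))
      atTop (𝓝 l₂)) (hl : |l₁| < |l₂|) :
    ∀ᶠ x in atTop, |F x - T₁ x| < |F x - T₂ x| := by
  have h := (h₁.abs.eventually_lt h₂.abs hl).and (eventually_gt_atTop 0)
  filter_upwards [Real.tendsto_log_atTop.eventually h, eventually_gt_atTop 0] with x hx hx0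
  obtain ⟨hx1, hx2⟩ := hx
  rw [Real.exp_log hx0] at hx1
  have h3 : 0 < x * Real.log x ^ (δ - 1) := by positivity
  rw [abs_mul, abs_mul, abs_div, abs_div, abs_of_pos hx2, abs_of_pos h3] at hx1
  exact (div_lt_div_iff_of_pos_right h3).1 (lt_of_mul_lt_mul_left hx1 hx2.le)

lemma tendsto_count_sub_landauApprox
    (h : Tendsto (fun u => u * (count S (Real.exp u) / (Real.exp u * u ^ (δ - 1)) - C)) atTop
      (𝓝 (C * ((1 - δ) * (1 - γ))))) :
    Tendsto (fun u => u * ((count S (Real.exp u) - landauApprox δ C (Real.exp u))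
      / (Real.exp u * u ^ (δ - 1)))) atTop (𝓝 (C * ((1 - δ) * (1 - γ)))) := by
  refine h.congr' ?_
  filter_upwards [eventually_gt_atTop 0] with u hu
  have : Real.exp u * u ^ (δ - 1) ≠ 0 := by positivity
  rw [landauApprox, Real.log_exp, sub_div, mul_div_cancel_right₀ _ this]

lemma tendsto_count_sub_ramanujanApprox
    (h : Tendsto (fun u => u * (count S (Real.exp u) / (Real.exp u * u ^ (δ - 1)) - C)) atTop
      (𝓝 (C * ((1 - δ) * (1 - γ))))) :
    Tendsto (fun u => u * ((count S (Real.exp u) - ramanujanApprox δ C (Real.exp u))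
      / (Real.exp u * u ^ (δ - 1)))) atTop (𝓝 (-(C * ((1 - δ) * γ)))) := by
  have h1 := h.sub ((tendsto_mul_integral_sub_one δ).const_mul C)
  rw [show C * ((1 - δ) * (1 - γ)) - C * (1 - δ) = -(C * ((1 - δ) * γ)) by ring] at h1
  refine h1.congr fun u => ?_
  rw [ramanujanApprox]
  ring

end

end MultiplicativeSets


theorem mainTheorem3 (S : Set ℕ) (δ : ℝ)
    (hS : MultiplicativeSets.IsMultiplicativeSet S)
    (hB : MultiplicativeSets.ConditionB S δ) :
    ∃ C γ : ℝ,
      MultiplicativeSets.IsLandauConstant S δ C ∧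
      MultiplicativeSets.IsEulerKroneckerConstant S δ γ ∧
      (γ < 1 / 2 → MultiplicativeSets.RamanujanBetter S δ C) ∧
      (1 / 2 < γ → δ ≠ 1 → MultiplicativeSets.LandauBetter S δ C) := by
  obtain ⟨C, γ, hC, hLandau, hEK, hasymp⟩ := MultiplicativeSets.exists_secondOrder hS hB
  have hL := MultiplicativeSets.tendsto_count_sub_landauApprox hasymp
  have hR := MultiplicativeSets.tendsto_count_sub_ramanujanApprox hasymp
  refine ⟨C, γ, hLandau, hEK, fun hγ => ?_, fun hγ hδ => ?_⟩
  · -- For `δ = 1` the two limits vanish and the comparison fails, but then `γ > 1/2`.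
    have hδ : δ ≠ 1 := by
      rintro rfl
      linarith [MultiplicativeSets.eulerMascheroniConstant_le hS hEK,
        Real.one_half_lt_eulerMascheroniConstant]
    refine MultiplicativeSets.eventually_abs_sub_lt hR hL ?_
    have hpos : 0 < |1 - δ| := abs_pos.2 (sub_ne_zero.2 hδ.symm)
    rw [abs_neg, abs_mul, abs_mul, abs_mul C, abs_mul (1 - δ), abs_of_pos hC]
    have : |γ| < |1 - γ| := sq_lt_sq.1 (by nlinarith)
    gcongr
  · refine MultiplicativeSets.eventually_abs_sub_lt hL hR ?_
    have hpos : 0 < |1 - δ| := abs_pos.2 (sub_ne_zero.2 hδ.symm)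
    rw [abs_neg, abs_mul, abs_mul, abs_mul C, abs_mul (1 - δ), abs_of_pos hC]
    have : |1 - γ| < |γ| := sq_lt_sq.1 (by nlinarith)
    gcongr
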